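/- Let $m\ge 1$ and $a>0$. Let $\mathbf C^{(m)}$ be the complex Clifford algebra generated by $\mathbf e_1,\dots,\mathbf e_m$ with $\mathbf e_j\mathbf e_k+\mathbf e_k\mathbf e_j=-2\delta_{jk}$, with basis $\mathbf e_T=\mathbf e_{j_1}\cdots\mathbf e_{j_l}$ ($T=\{j_1<\dots<j_l\}$), norm $|\sum_T x_T\mathbf e_T|=(\sum_T|x_T|^2)^{1/2}$, scalar part $\mathrm{Sc}(x)=x_\emptyset$, and the conjugate-linear conjugation $x\mapsto\overline x$ with $\overline{xy}=\overline y\,\overline x$, $\overline{\mathbf e_j}=-\mathbf e_j$. Identify $\underline x\in\mathbf R^m$ with $\sum_j x_j\mathbf e_j$ and $x=(x_0,\underline x)\in\mathbf R^{m+1}$ with the para-vector $x_0+\underline x$, so that $\overline x=x_0-\underline x$. A $C^1$ function $F$ from an open subset of $\mathbf R^{m+1}$ to $\mathbf C^{(m)}$ is left-monogenic if $\partial_0F+\sum_{k=1}^m\mathbf e_k\partial_kF=0$. For an open interval $I$ let $H^2(I\times\mathbf R^m)$ be the space of left-monogenic functions $F$ on $\{x_0+\underline x:x_0\in I\}$ with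 $\sup_{x_0\in I}\int_{\mathbf R^m}|F(x_0+\underline x)|^2d\underline x<\infty$; put $H^2(S_a)$, $H^2(\mathbf R^{m+1}_{+,-a})$, $H^2(\mathbf R^{m+1}_{-,a})$ for $I=(-a,a)$, $(-a,\infty)$, $(-\infty,a)$, where $S_a=\{|x_0|<a\}$. Let $\mathcal F$ be the $L^2$ Fourier transform normalised by $\mathcal Ff(\underline\xi)=\int e^{-i\langle\underline x,\underline\xi\rangle}f(\underline x)\,d\underline x$, and let $$e^{\pm}(x,\underline\xi)=e^{i\langle\underline x,\underline\xi\rangle}e^{\mp x_0|\underline\xi|}\,\tfrac12\Big(1\pm i\frac{\underline\xi}{|\underline\xi|}\Big),\qquad e=e^++e^-.$$ **(1) Paley–Wiener characterization.** A function $f\in L^2(\mathbf R^m,\mathbf C^{(m)})$ is the restriction to $\mathbf R^m$ of a function in $H^2(S_a)$ if and only if there is a measurable $g$ on $\mathbf R^m$ with $e^{a|\underline\xi|}g\in L^2(\mathbf R^m,\mathbf C^{(m)})$ such that $f$ is the restriction to $\mathbf R^m$ of the function $$F(x)=\frac1{(2\pi)^m}\int_{\mathbf R^m}e(x,\underline\xi)g(\underline\xi)\,d\underline\xi,\qquad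 x\in S_a$$ (the integral converging absolutely). In that case $F\in H^2(S_a)$ and $g=\mathcal Ff$ almost everywhere; and every function in $H^2(S_a)$ with restriction $f$ is given by this formula with $g=\mathcal Ff$, where $e^{a|\underline\xi|}\mathcal Ff\in L^2$. **(2) Decomposition.** Every $F\in H^2(S_a)$ is $F=f_++f_-$ on $S_a$ with $f_+\in H^2(\mathbf R^{m+1}_{+,-a})$ and $f_-\in H^2(\mathbf R^{m+1}_{-,a})$; the pair $(f_+,f_-)$ is unique; conversely, all such sums belong to $H^2(S_a)$. Thus $H^2(S_a)=H^2(\mathbf R^{m+1}_{+,-a})\oplus H^2(\mathbf R^{m+1}_{-,a})$. **(3) Induced inner product and Szegő kernel.** For $F\in H^2(S_a)$ put $F_a(\underline\xi)=e^{a|\underline\xi|}\mathcal F(F|_{\mathbf R^m})(\underline\xi)$. Then $F\mapsto F_a$ maps $H^2(S_a)$ onto $L^2(\mathbf R^m,\mathbf C^{(m)})$, and $$\langle F,G\rangle=\frac1{(2\pi)^m}\int_{\mathbf R^m}\overline{G_a}\,F_a\,d\underline\xi$$ is a well-defined $\mathbf C^{(m)}$-valued inner product on $H^2(S_a)$: the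 integrand is integrable, $\overline{\langle F,G\rangle}=\langle G,F\rangle$, it is additive and right $\mathbf C^{(m)}$-linear in $F$, $\mathrm{Sc}\langle F,F\rangle=(2\pi)^{-m}\int|F_a|^2<\infty$, and $\mathrm{Sc}\langle F,F\rangle=0$ only if $F=0$ on $S_a$. For $w,x\in S_a$ let $$S(w,\overline x)=\frac1{(2\pi)^m}\int_{\mathbf R^m}e^{-2a|\underline\xi|}e(w+\overline x,\underline\xi)\,d\underline\xi .$$ For every $x\in S_a$, $S(\cdot,\overline x)\in H^2(S_a)$ and $\langle F,S(\cdot,\overline x)\rangle=F(x)$ for all $F\in H^2(S_a)$. Moreover, with the Cauchy kernel $E(y)=\frac1{2\sigma_m}\frac{\overline y}{|y|^{m+1}}$, $\sigma_m=\pi^{\frac{m+1}2}/\Gamma(\frac{m+1}2)$, for all $w,x\in S_a$, $$\frac1{(2\pi)^m}\int_{\mathbf R^m} e^{-2a|\underline\xi|}e^{\pm}(w+\overline x,\underline\xi)\,d\underline\xi=\pm E(w+\overline x\pm2a)$$ with absolutely convergent integrals, so that $S(w,\overline x)=E(w+\overline x+2a)-E(w+\overline x-2a)$. -/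

import Mathlib

open MeasureTheory Set
open scoped FourierTransform ENNReal symmDiff

noncomputable section

namespace PWStrip

/-! ### The complex Clifford algebra with `m` generators of square `-1` -/

/-- The underlying Hilbert space of the complex Clifford algebra: an element `x` is the family of
its coefficients `x T`, where `T` runs over the subsets of the index set, i.e. `x = ∑ x T e_T` with
`e_T = e_{j_1} ⋯ e_{j_l}` for `T = {j_1 < ⋯ < j_l}`; the norm is `|x| = (∑ |x T|²)^(1/2)`. -/
def Cl (m : ℕ) : Type := EuclideanSpace ℂ (Finset (Fin m))

variable {m : ℕ}

instance : NormedAddCommGroup (Cl m) :=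
  inferInstanceAs (NormedAddCommGroup (EuclideanSpace ℂ (Finset (Fin m))))

instance : InnerProductSpace ℂ (Cl m) :=
  inferInstanceAs (InnerProductSpace ℂ (EuclideanSpace ℂ (Finset (Fin m))))

instance : FiniteDimensional ℂ (Cl m) :=
  inferInstanceAs (FiniteDimensional ℂ (EuclideanSpace ℂ (Finset (Fin m))))

instance : CompleteSpace (Cl m) := FiniteDimensional.complete ℂ (Cl m)

/-- The coefficient of `x` at the basis element `e_T`. -/
def coeff (x : Cl m) (T : Finset (Fin m)) : ℂ := WithLp.ofLp x T

/-- The element with prescribed coefficients. -/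
def mk (c : Finset (Fin m) → ℂ) : Cl m := WithLp.toLp 2 c

@[simp] lemma coeff_mk (c : Finset (Fin m) → ℂ) (T) : coeff (mk c) T = c T := rfl
@[simp] lemma coeff_add (x y : Cl m) (T) : coeff (x + y) T = coeff x T + coeff y T := rfl
@[simp] lemma coeff_zero (T) : coeff (0 : Cl m) T = 0 := rfl
@[simp] lemma coeff_neg (x : Cl m) (T) : coeff (-x) T = -coeff x T := rfl
@[simp] lemma coeff_smul (c : ℂ) (x : Cl m) (T) : coeff (c • x) T = c * coeff x T := rfl

lemma ext_coeff {x y : Cl m} (h : ∀ T, coeff x T = coeff y T) : x = y :=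
  congrArg (WithLp.toLp 2) (funext h)

lemma norm_sq_eq (x : Cl m) : ‖x‖ ^ 2 = ∑ T, ‖coeff x T‖ ^ 2 :=
  EuclideanSpace.norm_sq_eq (𝕜 := ℂ) (n := Finset (Fin m)) x

/-- The basis element `e_T`. -/
def basisE (T : Finset (Fin m)) : Cl m := mk (fun U => if U = T then 1 else 0)

/-- The sign in `e_S e_T = sgn S T · e_{S ∆ T}`: a factor `-1` for each pair `t < s` (which has to
be transposed, `e_s e_t = -e_t e_s`) and for each pair `t = s` (because `e_s² = -1`). -/
def sgn (S T : Finset (Fin m)) : ℂ := ∏ s ∈ S, ∏ t ∈ T, if t ≤ s then -1 else 1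

/-- Clifford multiplication: the bilinear extension of `e_S e_T = sgn S T · e_{S ∆ T}`. -/
instance : Mul (Cl m) :=
  ⟨fun x y => mk fun U => ∑ S, sgn S (S ∆ U) * (coeff x S * coeff y (S ∆ U))⟩

instance : One (Cl m) := ⟨basisE ∅⟩

lemma coeff_mul (x y : Cl m) (U) :
    coeff (x * y) U = ∑ S, sgn S (S ∆ U) * (coeff x S * coeff y (S ∆ U)) := rfl

lemma coeff_one (U : Finset (Fin m)) : coeff (1 : Cl m) U = if U = ∅ then 1 else 0 := rfl

lemma coeff_basisE (T U : Finset (Fin m)) :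
    coeff (basisE T) U = if U = T then 1 else 0 := rfl

lemma prod_symmDiff_of_sq {ι : Type*} [DecidableEq ι] (f : ι → ℂ) (hf : ∀ i, f i * f i = 1)
    (S T : Finset ι) : ∏ i ∈ S ∆ T, f i = (∏ i ∈ S, f i) * ∏ i ∈ T, f i := by
  have h1 : ∏ i ∈ S ∆ T, f i = (∏ i ∈ S \ T, f i) * ∏ i ∈ T \ S, f i := by
    rw [symmDiff_def, Finset.sup_eq_union, Finset.prod_union]
    exact disjoint_sdiff_sdiff
  have h2 : (∏ i ∈ S ∩ T, f i) * ∏ i ∈ S ∩ T, f i = 1 := by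
    rw [← Finset.prod_mul_distrib]
    exact Finset.prod_eq_one fun i _ => hf i
  rw [h1, ← Finset.prod_inter_mul_prod_sdiff S T, ← Finset.prod_inter_mul_prod_sdiff T S,
    Finset.inter_comm T S]
  linear_combination (-(∏ i ∈ S \ T, f i) * ∏ i ∈ T \ S, f i) * h2

lemma sgn_symmDiff_left (S T W : Finset (Fin m)) : sgn (S ∆ T) W = sgn S W * sgn T W := by
  refine prod_symmDiff_of_sq _ (fun i => ?_) S T
  rw [← Finset.prod_mul_distrib]
  refine Finset.prod_eq_one fun j _ => ?_
  split_ifs <;> simp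

lemma sgn_symmDiff_right (S T W : Finset (Fin m)) : sgn S (T ∆ W) = sgn S T * sgn S W := by
  unfold sgn
  rw [← Finset.prod_mul_distrib]
  refine Finset.prod_congr rfl fun i _ => prod_symmDiff_of_sq _ (fun j => ?_) T W
  split_ifs <;> simp

lemma sgn_sq (S T : Finset (Fin m)) : sgn S T * sgn S T = 1 := by
  rw [← sgn_symmDiff_right, symmDiff_self]; simp [sgn]

@[simp] lemma sgn_empty_left (T : Finset (Fin m)) : sgn ∅ T = 1 := by simp [sgn]
@[simp] lemma sgn_empty_right (T : Finset (Fin m)) : sgn T ∅ = 1 := by simp [sgn]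

lemma star_sgn (S T : Finset (Fin m)) : star (sgn S T) = sgn S T := by
  simp only [sgn, star_prod]
  refine Finset.prod_congr rfl fun i _ => Finset.prod_congr rfl fun j _ => ?_
  split_ifs <;> simp

/-- Reindexing a sum over all subsets by the involution `S ↦ T ∆ S`. -/
lemma sum_symmDiff {M : Type*} [AddCommMonoid M] (T : Finset (Fin m))
    (f : Finset (Fin m) → M) : ∑ S, f (T ∆ S) = ∑ S, f S :=
  Fintype.sum_bijective (fun S => T ∆ S)
    (Function.Involutive.bijective fun S => symmDiff_symmDiff_cancel_left T S) _ _ fun _ => rfl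

lemma mul_assoc_aux (x y z : Cl m) : x * y * z = x * (y * z) := by
  refine ext_coeff fun U => ?_
  simp only [coeff_mul, Finset.mul_sum, Finset.sum_mul]
  rw [Finset.sum_comm]
  refine Finset.sum_congr rfl fun S _ => ?_
  rw [← sum_symmDiff S]
  refine Finset.sum_congr rfl fun T _ => ?_
  have h : S ∆ (S ∆ T) = T := symmDiff_symmDiff_cancel_left S T
  have h2 : S ∆ T ∆ U = T ∆ (S ∆ U) := by
    rw [symmDiff_comm S T, symmDiff_assoc]
  have h3 : S ∆ U = T ∆ (T ∆ (S ∆ U)) := (symmDiff_symmDiff_cancel_left T _).symm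
  rw [h, h2, sgn_symmDiff_left]
  have h4 : sgn S (S ∆ U) = sgn S T * sgn S (T ∆ (S ∆ U)) := by
    rw [← sgn_symmDiff_right, ← h3]
  rw [h4]
  ring

instance : Ring (Cl m) :=
  { (inferInstance : AddCommGroup (Cl m)) with
    mul := (· * ·)
    one := 1
    left_distrib := fun x y z => ext_coeff fun U => by
      simp [coeff_mul, mul_add, Finset.sum_add_distrib]
    right_distrib := fun x y z => ext_coeff fun U => by
      simp [coeff_mul, add_mul, mul_add, Finset.sum_add_distrib]
    zero_mul := fun x => ext_coeff fun U => by simp [coeff_mul]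
    mul_zero := fun x => ext_coeff fun U => by simp [coeff_mul]
    mul_assoc := mul_assoc_aux
    one_mul := fun x => ext_coeff fun U => by
      rw [coeff_mul, Finset.sum_eq_single ∅]
      · have h : (∅ : Finset (Fin m)) ∆ U = U := bot_symmDiff U
        rw [h]; simp [coeff_one]
      · intro S _ hS; simp [coeff_one, hS]
      · simp
    mul_one := fun x => ext_coeff fun U => by
      rw [coeff_mul, Finset.sum_eq_single U]
      · have h : U ∆ U = ∅ := symmDiff_self U
        rw [h]; simp [coeff_one]
      · intro S _ hS
        have : S ∆ U ≠ ∅ := fun h => hS (symmDiff_eq_bot.1 h)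
        simp [coeff_one, this]
      · simp }

instance : Algebra ℂ (Cl m) :=
  Algebra.ofModule
    (fun c x y => ext_coeff fun U => by
      simp only [coeff_mul, coeff_smul, Finset.mul_sum]
      exact Finset.sum_congr rfl fun S _ => by ring)
    (fun c x y => ext_coeff fun U => by
      simp only [coeff_mul, coeff_smul, Finset.mul_sum]
      exact Finset.sum_congr rfl fun S _ => by ring)

/-- Clifford conjugation `x̄ = ∑ conj(x T) ē_T`. Here `ē_T = (-1)^(|T|(|T|+1)/2) e_T`, and
`sgn T T` is this sign (there are `|T|(|T|+1)/2` pairs `t ≤ s` in `T`). The laws of a star ring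
below, together with `star_gen` and `star_smul_eq`, say that it is the conjugate-linear
antiautomorphism with `ē_j = -e_j`. -/
instance : Star (Cl m) := ⟨fun x => mk fun T => sgn T T * star (coeff x T)⟩

lemma coeff_star (x : Cl m) (T) : coeff (star x) T = sgn T T * star (coeff x T) := rfl

instance : StarRing (Cl m) where
  star_involutive x := ext_coeff fun T => by
    rw [coeff_star, coeff_star, star_mul', star_star, star_sgn, ← mul_assoc, sgn_sq, one_mul]
  star_add x y := ext_coeff fun T => by
    simp [coeff_star, mul_add]
  star_mul x y := ext_coeff fun U => by
    rw [coeff_star, coeff_mul, coeff_mul, star_sum, Finset.mul_sum, ← sum_symmDiff U]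
    refine Finset.sum_congr rfl fun S _ => ?_
    have h1 : U ∆ S ∆ U = S := by
      rw [symmDiff_comm (U ∆ S) U, symmDiff_symmDiff_cancel_left]
    have h2 : S ∆ U = U ∆ S := symmDiff_comm S U
    rw [h1, h2, coeff_star, coeff_star]
    simp only [star_mul', star_sgn]
    have h3 : sgn U U = sgn S S * sgn S (U ∆ S) * (sgn (U ∆ S) S * sgn (U ∆ S) (U ∆ S)) := by
      rw [← sgn_symmDiff_right, ← sgn_symmDiff_right, ← sgn_symmDiff_left]
      have : S ∆ (U ∆ S) = U := by
        rw [symmDiff_comm U S, symmDiff_symmDiff_cancel_left]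
      rw [this]
    rw [h3]
    linear_combination (sgn S S * sgn S (U ∆ S) * sgn (U ∆ S) (U ∆ S) * star (coeff x (U ∆ S)) *
      star (coeff y S)) * sgn_sq (U ∆ S) S

/-- The generators `e_1, …, e_m`. -/
def gen (j : Fin m) : Cl m := basisE {j}

lemma star_smul_eq (c : ℂ) (x : Cl m) : star (c • x) = star c • star x :=
  ext_coeff fun T => by simp only [coeff_star, coeff_smul, star_mul']; ring

lemma star_gen (j : Fin m) : star (gen j) = -gen j :=
  ext_coeff fun T => by
    simp only [coeff_star, coeff_neg, gen, coeff_basisE]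
    split_ifs with h
    · subst h; simp [sgn]
    · simp

lemma basisE_mul (S T : Finset (Fin m)) : basisE S * basisE T = sgn S T • basisE (S ∆ T) := by
  refine ext_coeff fun U => ?_
  rw [coeff_mul, Finset.sum_eq_single S]
  · simp only [coeff_basisE, coeff_smul, if_true, one_mul]
    by_cases h : U = S ∆ T
    · subst h; simp [symmDiff_symmDiff_cancel_left]
    · have : S ∆ U ≠ T := fun h' => h (by rw [← h', symmDiff_symmDiff_cancel_left])
      simp [h, this]
  · intro V _ hV; simp [coeff_basisE, hV]
  · simp

/-- The defining relations of the Clifford algebra. -/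
lemma gen_mul_gen (j k : Fin m) :
    gen j * gen k + gen k * gen j = if j = k then (-2 : Cl m) else 0 := by
  simp only [gen, basisE_mul]
  split_ifs with h
  · subst h
    have h1 : basisE (∅ : Finset (Fin m)) = 1 := rfl
    have h2 : ({j} : Finset (Fin m)) ∆ {j} = ∅ := symmDiff_self _
    rw [h2, h1]
    have : sgn ({j} : Finset (Fin m)) {j} = -1 := by simp [sgn]
    rw [this, neg_one_smul]
    norm_num
  · rw [symmDiff_comm ({k} : Finset (Fin m)) {j}, ← add_smul]
    have : sgn ({j} : Finset (Fin m)) {k} + sgn {k} {j} = 0 := by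
      rcases lt_or_gt_of_ne h with h' | h' <;> simp [sgn, h'.le, h'.not_ge]
    rw [this, zero_smul]

/-- The basis elements are the ordered products of the generators. -/
lemma basisE_insert (j : Fin m) (T : Finset (Fin m)) (h : ∀ t ∈ T, j < t) :
    basisE (insert j T) = gen j * basisE T := by
  have hj : j ∉ T := fun h' => lt_irrefl _ (h j h')
  have h1 : ({j} : Finset (Fin m)) ∆ T = insert j T := by
    rw [Disjoint.symmDiff_eq_sup (by simpa using hj)]; rfl
  have h2 : sgn {j} T = 1 := by
    simp only [sgn, Finset.prod_singleton]
    exact Finset.prod_eq_one fun t ht => if_neg (h t ht).not_ge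
  rw [gen, basisE_mul, h1, h2, one_smul]

/-! ### Vectors, para-vectors and left-monogenic functions -/

/-- `ℝ^m` with its Euclidean norm. -/
abbrev E (m : ℕ) : Type := EuclideanSpace ℝ (Fin m)

/-- A vector `v = (v_1, …, v_m)` as the element `v_1 e_1 + ⋯ + v_m e_m`. -/
def vec (v : E m) : Cl m := ∑ j, ((v j : ℝ) : ℂ) • gen j

/-- A point `x = (x_0, v)` of `ℝ^(m+1) = ℝ × ℝ^m` as the para-vector `x_0 + v`. -/
def para (x : ℝ × E m) : Cl m := ((x.1 : ℝ) : ℂ) • 1 + vec x.2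

/-- Conjugation of para-vectors, `x_0 + v ↦ x_0 - v`, on `ℝ^(m+1)`. -/
def pconj (x : ℝ × E m) : ℝ × E m := (x.1, -x.2)

/-- The Dirac operator `D F = ∂_0 F + ∑ e_k ∂_k F`. -/
def dirac (F : ℝ × E m → Cl m) (x : ℝ × E m) : Cl m :=
  fderiv ℝ F x (1, 0) + ∑ k : Fin m, gen k * fderiv ℝ F x (0, EuclideanSpace.single k 1)

/-- `F` is left-monogenic in the open set `U`: it is continuously differentiable there and
`D F = 0`. -/
def LeftMonogenicOn (F : ℝ × E m → Cl m) (U : Set (ℝ × E m)) : Prop :=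
  ContDiffOn ℝ 1 F U ∧ ∀ x ∈ U, dirac F x = 0

/-- For an open interval `I`, the domain `{x_0 + v : x_0 ∈ I, v ∈ ℝ^m}`: the strip `|x_0| < a` for
`I = (-a, a)`, the half-spaces `x_0 > -a` and `x_0 < a` for `I = (-a, ∞)` and `I = (-∞, a)`. -/
def slab (m : ℕ) (I : Set ℝ) : Set (ℝ × E m) := I ×ˢ univ

/-- Membership in the Hardy space `H²` of `slab m I`: left-monogenic with
`sup_{x_0 ∈ I} ∫ |F(x_0 + v)|² dv < ∞`. -/
def MemHardy (I : Set ℝ) (F : ℝ × E m → Cl m) : Prop :=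
  LeftMonogenicOn F (slab m I) ∧ (⨆ t ∈ I, ∫⁻ v : E m, ‖F (t, v)‖ₑ ^ 2) < ∞

/-! ### Fourier transform and monogenic exponentials -/

/-- `L²(ℝ^m, ℂ^(m))`. -/
abbrev L2 (m : ℕ) : Type := Lp (Cl m) 2 (volume : Measure (E m))

/-- The `L²` Fourier transform normalised as `f̂(ξ) = ∫ e^{-i⟨x,ξ⟩} f(x) dx`, obtained from
Mathlib's (which has `e^{-2πi⟨x,ξ⟩}`) by rescaling. -/
def fourierL2 (f : L2 m) : E m → Cl m :=
  fun ξ => ((𝓕 f : L2 m) : E m → Cl m) ((2 * Real.pi)⁻¹ • ξ)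

/-- `χ_+(ξ) = (1 + i ξ/|ξ|) / 2`. -/
def chiP (ξ : E m) : Cl m := (1 / 2 : ℂ) • (1 + (Complex.I / (‖ξ‖ : ℂ)) • vec ξ)

/-- `χ_-(ξ) = (1 - i ξ/|ξ|) / 2`. -/
def chiM (ξ : E m) : Cl m := (1 / 2 : ℂ) • (1 - (Complex.I / (‖ξ‖ : ℂ)) • vec ξ)

/-- `e⁺(x, ξ) = e^{i⟨v,ξ⟩} e^{-x_0|ξ|} χ_+(ξ)` for `x = x_0 + v`. -/
def eP (x : ℝ × E m) (ξ : E m) : Cl m :=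
  (Complex.exp (Complex.I * (inner ℝ x.2 ξ : ℝ)) * (Real.exp (-x.1 * ‖ξ‖) : ℝ)) • chiP ξ

/-- `e⁻(x, ξ) = e^{i⟨v,ξ⟩} e^{x_0|ξ|} χ_-(ξ)` for `x = x_0 + v`. -/
def eM (x : ℝ × E m) (ξ : E m) : Cl m :=
  (Complex.exp (Complex.I * (inner ℝ x.2 ξ : ℝ)) * (Real.exp (x.1 * ‖ξ‖) : ℝ)) • chiM ξ

/-- The monogenic exponential function `e(x, ξ) = e⁺(x, ξ) + e⁻(x, ξ)`. -/
def monoExp (x : ℝ × E m) (ξ : E m) : Cl m := eP x ξ + eM x ξ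

/-- The constant `(2π)^{-m}`. -/
def twoPiInv (m : ℕ) : ℝ := ((2 * Real.pi) ^ m)⁻¹

/-- The weight condition `e^{a|ξ|} g(ξ) ∈ L²(ℝ^m, ℂ^(m))`. -/
def WeightedL2 (a : ℝ) (g : E m → Cl m) : Prop :=
  MemLp (fun ξ => Real.exp (a * ‖ξ‖) • g ξ) 2 (volume : Measure (E m))

/-- `F(x) = (2π)^{-m} ∫ e(x, ξ) g(ξ) dξ` for all `x` in the strip `|x_0| < a`, the integral being
absolutely convergent. -/
def Represents (a : ℝ) (g : E m → Cl m) (F : ℝ × E m → Cl m) : Prop :=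
  ∀ x ∈ slab m (Ioo (-a) a), Integrable (fun ξ => monoExp x ξ * g ξ) ∧
    F x = twoPiInv m • ∫ ξ, monoExp x ξ * g ξ

/-- `f` is the restriction of `F` to `ℝ^m = {x_0 = 0}` (as an element of `L²`). -/
def IsRestriction (f : L2 m) (F : ℝ × E m → Cl m) : Prop :=
  (fun v : E m => F (0, v)) =ᵐ[volume] (f : E m → Cl m)

/-! ### The induced inner product and the Szegő kernel -/

open Classical in
/-- The Fourier transform of the restriction of `F` to `ℝ^m` (zero if that restriction is not in
`L²`, which does not occur for Hardy functions on the strip). -/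
def restrFourier (F : ℝ × E m → Cl m) : E m → Cl m :=
  if h : MemLp (fun v : E m => F (0, v)) 2 (volume : Measure (E m)) then fourierL2 h.toLp else 0

/-- The function `F_a(ξ) = e^{a|ξ|} F̂(ξ)` of `L²(ℝ^m, ℂ^(m))` associated with a function of the
Hardy space on the strip. -/
def assoc (a : ℝ) (F : ℝ × E m → Cl m) : E m → Cl m :=
  fun ξ => Real.exp (a * ‖ξ‖) • restrFourier F ξ

/-- The Clifford-valued inner product `⟨F, G⟩ = (2π)^{-m} ∫ conj(G_a) F_a dξ`. -/
def hardyInner (a : ℝ) (F G : ℝ × E m → Cl m) : Cl m :=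
  twoPiInv m • ∫ ξ, star (assoc a G ξ) * assoc a F ξ

/-- The Szegő kernel `S(w, x̄) = (2π)^{-m} ∫ e^{-2a|ξ|} e(w + x̄, ξ) dξ`, as a function of `w` and
`x`. -/
def szego (a : ℝ) (w x : ℝ × E m) : Cl m :=
  twoPiInv m • ∫ ξ : E m, Real.exp (-2 * a * ‖ξ‖) • monoExp (w + pconj x) ξ

/-- `σ_m = π^((m+1)/2) / Γ((m+1)/2)`. -/
def sigma (m : ℕ) : ℝ := Real.pi ^ (((m : ℝ) + 1) / 2) / Real.Gamma (((m : ℝ) + 1) / 2)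

/-- The Cauchy kernel `y ↦ (1 / (2σ_m)) ȳ / |y|^(m+1)`. -/
def cauchyKernel (y : ℝ × E m) : Cl m :=
  (1 / (2 * sigma m) / ‖para y‖ ^ (m + 1)) • para (pconj y)

end PWStrip

end

open PWStrip

/-! The Dirac equation is a linear evolution equation in `x_0`: `∂_0 F = -∑ e_k ∂_k F`. On the
Fourier side of `ℝ^m` it reads `∂_t F̂_t = -iξ F̂_t`, where `F̂_t` is the transform of the slice
`F(t, ·)`. As `(iξ)² = |ξ|²`, the elements `χ_±(ξ)` are complementary idempotents on which `-iξ`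
acts as `∓|ξ|`. Hence `F̂_t(ξ) = e(t - s, ξ) F̂_s(ξ)`, which is `MemHardy.fourierL2_slice`; parts
(1) and (2) follow from it.

Multiplying by `χ_±` gives `e^{∓t|ξ|} χ_± F̂_0 = χ_± F̂_t`, and by Plancherel the right side is
bounded in `L²` uniformly in `t`. On the strip, `t → ∓a` and Fatou yield `e^{a|ξ|} F̂_0 ∈ L²`
(`MemHardy.weightedL2`); Fourier inversion on each slice then gives the integral formula
(`MemHardy.represents`). On a half-space `t` may tend to infinity, which forces one of `χ_± F̂_0` to
vanish; a function common to both half-spaces is therefore zero, and the decomposition is unique.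
Conversely, if `e^{a|ξ|} g ∈ L²`, the integrals of `e⁺ g` and `e⁻ g` can be differentiated under the
integral sign and are Hardy functions on the two half-spaces (`memHardy_expSynth`). This gives the
converse in (1) and the existence in (2).

The work lies in justifying the evolution equation, because nothing is known about the derivatives
of `F` at infinity. It is used weakly: slices are paired with test functions, first compactly
supported, then Schwartz by a cutoff argument in which the Hardy bound makes the derivatives
converge uniformly. If the test function on the frequency side has compact support, the `n`-th
`t`-derivative of the pairing is at most `K R^n`. The Taylor series in `t` then converges to the
pairing, and its sum contains the exponential series of the symbol, that is `e(t - s, ξ)`.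

For (3), `F ↦ F_a` identifies the Hardy space with `L²`. Writing `F(x)` through `F_a` exhibits it as
an inner product with `e^{-a|ξ|} e(x̄, ξ)`, which is the function associated with the Szegő kernel.
The factor `e^{-2a|ξ|}` only shifts `x_0` by `±2a`, so the closed form reduces to `integral_eP`. Its
scalar part is the Poisson kernel, found by subordination to Gaussians; its vector part is recovered
from its `x_0`-derivative and its decay as `x_0 → ∞`. -/

noncomputable section

namespace PWStrip

variable {m : ℕ}

/-! ### Clifford algebra -/

/-- Clifford multiplication as a continuous complex bilinear map. -/
def mulL : Cl m →L[ℂ] Cl m →L[ℂ] Cl m := (LinearMap.mul ℂ (Cl m)).toContinuousBilinearMap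

/-- The coefficient norm is not submultiplicative: `x = 1 + i e_1` has `|x|² = 2` but `|x²| = 2√2`.
The operator norm of the multiplication therefore enters every estimate of a product. -/
lemma norm_mul_le_mulL (x y : Cl m) : ‖x * y‖ ≤ ‖(mulL : Cl m →L[ℂ] _)‖ * ‖x‖ * ‖y‖ :=
  mulL.le_opNorm₂ x y

/-- Left multiplication as a continuous real linear map. -/
def mulLeft (x : Cl m) : Cl m →L[ℝ] Cl m := (mulL x).restrictScalars ℝ

@[simp] lemma mulLeft_apply (x y : Cl m) : mulLeft x y = x * y := rfl

/-- Right multiplication as a continuous real linear map. -/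
def mulRight (y : Cl m) : Cl m →L[ℝ] Cl m := (mulL.flip y).restrictScalars ℝ

@[simp] lemma mulRight_apply (x y : Cl m) : mulRight y x = x * y := rfl

instance : ContinuousMul (Cl m) :=
  ⟨((mulL : Cl m →L[ℂ] _).continuous₂ :)⟩

/-- The sign `sgn S S` occurs once in the conjugation and once in the product `e_S e_S`, so it
cancels. This is the source of positive definiteness of the inner product. -/
lemma coeff_star_mul_self (x : Cl m) : coeff (star x * x) ∅ = ((‖x‖ ^ 2 : ℝ) : ℂ) := by
  rw [norm_sq_eq, coeff_mul, Complex.ofReal_sum]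
  refine Finset.sum_congr rfl fun S _ => ?_
  have h : S ∆ (∅ : Finset (Fin m)) = S := symmDiff_bot S
  rw [h, coeff_star, Complex.ofReal_pow, ← Complex.conj_mul']
  rw [starRingEnd_apply]
  linear_combination (star (coeff x S) * coeff x S) * sgn_sq S S

@[simp] lemma coeff_real_smul (c : ℝ) (x : Cl m) (T) : coeff (c • x) T = c * coeff x T := rfl

/-- The embedding of vectors as a continuous linear map. -/
def vecL : E m →L[ℝ] Cl m :=
  LinearMap.toContinuousLinearMap
    { toFun := vec
      map_add' := fun v w => by simp [vec, add_smul, Finset.sum_add_distrib]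
      map_smul' := fun c v => by
        simp only [vec, PiLp.smul_apply, smul_eq_mul, Complex.ofReal_mul, mul_smul,
          RingHom.id_apply, Finset.smul_sum]
        rfl }

lemma vec_neg (v : E m) : vec (-v) = -vec v := vecL.map_neg v

@[simp] lemma vec_zero : vec (0 : E m) = 0 := vecL.map_zero

lemma continuous_vec : Continuous (vec : E m → Cl m) := vecL.continuous

lemma coeff_sum {ι : Type*} (s : Finset ι) (f : ι → Cl m) (T) :
    coeff (∑ i ∈ s, f i) T = ∑ i ∈ s, coeff (f i) T := by
  classical
  induction s using Finset.induction_on with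
  | empty => simp
  | insert i s hi ih => rw [Finset.sum_insert hi, Finset.sum_insert hi, coeff_add, ih]

lemma coeff_vec_singleton (v : E m) (k : Fin m) : coeff (vec v) {k} = v k := by
  rw [vec, coeff_sum, Finset.sum_eq_single k]
  · simp [gen, coeff_basisE]
  · intro j _ hj
    simp [gen, coeff_basisE, hj.symm]
  · simp

lemma coeff_vec_of_card_ne (v : E m) (T : Finset (Fin m)) (hT : T.card ≠ 1) :
    coeff (vec v) T = 0 := by
  rw [vec, coeff_sum]
  refine Finset.sum_eq_zero fun j _ => ?_
  have : T ≠ {j} := fun h => hT (by simp [h])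
  simp [gen, coeff_basisE, this]

/-- The scalar part sits at `∅` and the vector part at the singletons, so the two do not interfere.
-/
lemma norm_para_sq (x : ℝ × E m) : ‖para x‖ ^ 2 = x.1 ^ 2 + ‖x.2‖ ^ 2 := by
  have hc : ∀ T, ‖coeff (para x) T‖ ^ 2 =
      (if T = ∅ then x.1 ^ 2 else 0) + ∑ k, if T = {k} then x.2 k ^ 2 else 0 := by
    intro T
    rw [para, coeff_add, coeff_smul, coeff_one]
    by_cases h0 : T = ∅
    · subst h0
      have : ∀ k : Fin m, (∅ : Finset (Fin m)) ≠ {k} := fun k => (Finset.singleton_ne_empty k).symm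
      rw [coeff_vec_of_card_ne _ _ (by simp)]
      simp [this]
    · rw [if_neg h0, if_neg h0, mul_zero, zero_add, zero_add]
      by_cases h1 : T.card = 1
      · obtain ⟨j, rfl⟩ := Finset.card_eq_one.1 h1
        rw [coeff_vec_singleton, Finset.sum_eq_single j]
        · simp
        · intro k _ hk; simp [hk.symm]
        · simp
      · rw [coeff_vec_of_card_ne _ _ h1]
        have : ∀ k : Fin m, T ≠ {k} := fun k h => h1 (by simp [h])
        simp [this]
  rw [norm_sq_eq, Finset.sum_congr rfl fun T _ => hc T, Finset.sum_add_distrib,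
    Finset.sum_comm, EuclideanSpace.norm_sq_eq]
  simp

lemma norm_vec (v : E m) : ‖vec v‖ = ‖v‖ := by
  have h := norm_para_sq ((0 : ℝ), v)
  rw [show para ((0 : ℝ), v) = vec v by simp [para]] at h
  exact (pow_left_inj₀ (norm_nonneg _) (norm_nonneg _) two_ne_zero).1 (by simpa using h)

lemma norm_one_cl : ‖(1 : Cl m)‖ = 1 := by
  have h := norm_para_sq ((1 : ℝ), (0 : E m))
  rw [show para ((1 : ℝ), (0 : E m)) = 1 by simp [para]] at h
  refine (pow_left_inj₀ (norm_nonneg _) zero_le_one two_ne_zero).1 ?_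
  simpa using h

/-- Adding the double sum to its transpose leaves only anticommutators of generators, and these
vanish off the diagonal. -/
lemma vec_mul_self (v : E m) : vec v * vec v = -((‖v‖ ^ 2 : ℝ) : ℂ) • (1 : Cl m) := by
  have h1 : vec v * vec v = ∑ j, ∑ k, ((v j : ℂ) * v k) • (gen j * gen k) := by
    rw [vec, Finset.sum_mul_sum]
    exact Finset.sum_congr rfl fun j _ => Finset.sum_congr rfl fun k _ => smul_mul_smul_comm _ _ _ _
  have h2 : vec v * vec v = ∑ j, ∑ k, ((v j : ℂ) * v k) • (gen k * gen j) := by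
    rw [h1, Finset.sum_comm]
    exact Finset.sum_congr rfl fun j _ => Finset.sum_congr rfl fun k _ => by rw [mul_comm]
  have h3 : vec v * vec v + vec v * vec v = (2 : ℂ) • (-((‖v‖ ^ 2 : ℝ) : ℂ) • (1 : Cl m)) := by
    nth_rewrite 1 [h1]
    rw [h2, ← Finset.sum_add_distrib]
    simp_rw [← Finset.sum_add_distrib, ← smul_add, gen_mul_gen]
    rw [EuclideanSpace.norm_sq_eq]
    have : (-2 : Cl m) = (-2 : ℂ) • (1 : Cl m) := by
      rw [neg_smul, ofNat_smul_eq_nsmul]; simp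
    simp only [smul_ite, smul_zero, Finset.sum_ite_eq, Finset.mem_univ, if_true, this, smul_smul,
      ← Finset.sum_smul]
    congr 1
    push_cast
    rw [← Finset.sum_neg_distrib, Finset.mul_sum]
    refine Finset.sum_congr rfl fun j _ => ?_
    rw [Real.norm_eq_abs, ← Complex.ofReal_pow, sq_abs]
    push_cast
    ring
  rw [← two_smul ℂ] at h3
  exact (smul_right_injective (Cl m) (two_ne_zero (α := ℂ))) h3

lemma star_vec (v : E m) : star (vec v) = -vec v := by
  simp only [vec, star_sum, star_smul_eq, star_gen, smul_neg, Finset.sum_neg_distrib]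
  simp

/-! ### The projections `χ_±` and the monogenic exponentials -/

lemma chiP_add_chiM (ξ : E m) : chiP ξ + chiM ξ = 1 := by
  rw [chiP, chiM, ← smul_add, add_add_sub_cancel, ← two_smul ℂ, smul_smul]
  norm_num

/-- Idempotence comes from `(iξ/|ξ|)² = 1`. At `ξ = 0` division by zero gives `χ_± = 1/2`, which is
not idempotent; hence the hypothesis here and in the other product rules. -/
lemma chiP_mul_chiP {ξ : E m} (hξ : ξ ≠ 0) : chiP ξ * chiP ξ = chiP ξ := by
  have h : (‖ξ‖ : ℂ) ≠ 0 := by simpa using hξ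
  simp only [chiP, smul_mul_smul_comm, add_mul, mul_add, one_mul, mul_one, vec_mul_self, smul_smul,
    smul_add]
  have : Complex.I / (‖ξ‖ : ℂ) * (Complex.I / ‖ξ‖) * (-((‖ξ‖ ^ 2 : ℝ) : ℂ)) = 1 := by
    push_cast; field_simp; rw [Complex.I_sq]; ring
  rw [show (1 / 2 * (Complex.I / (‖ξ‖ : ℂ)) * (1 / 2 * (Complex.I / (‖ξ‖ : ℂ))) *
    -((‖ξ‖ ^ 2 : ℝ) : ℂ)) = 1 / 4 by linear_combination (1 / 4) * this]
  module

lemma chiP_mul_chiM {ξ : E m} (hξ : ξ ≠ 0) : chiP ξ * chiM ξ = 0 := by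
  rw [eq_sub_of_add_eq' (chiP_add_chiM ξ), mul_sub, mul_one, chiP_mul_chiP hξ, sub_self]

lemma chiM_mul_chiP {ξ : E m} (hξ : ξ ≠ 0) : chiM ξ * chiP ξ = 0 := by
  rw [eq_sub_of_add_eq' (chiP_add_chiM ξ), sub_mul, one_mul, chiP_mul_chiP hξ, sub_self]

lemma chiM_mul_chiM {ξ : E m} (hξ : ξ ≠ 0) : chiM ξ * chiM ξ = chiM ξ := by
  conv_lhs => rw [eq_sub_of_add_eq' (chiP_add_chiM ξ), sub_mul, one_mul]
  rw [← eq_sub_of_add_eq' (chiP_add_chiM ξ), chiP_mul_chiM hξ, sub_zero]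

/-- Spectral decomposition of the Dirac symbol. It survives at `ξ = 0`, where both sides vanish, and
so do the eigenvalue relations derived from it. -/
lemma I_smul_vec (ξ : E m) : Complex.I • vec ξ = (‖ξ‖ : ℂ) • (chiP ξ - chiM ξ) := by
  rcases eq_or_ne ξ 0 with rfl | hξ
  · simp
  have h : (‖ξ‖ : ℂ) ≠ 0 := by simpa using hξ
  have : chiP ξ - chiM ξ = (Complex.I / (‖ξ‖ : ℂ)) • vec ξ := by
    simp only [chiP, chiM]; module
  rw [this, smul_smul, mul_div_cancel₀ _ h]

lemma I_smul_vec_mul_chiP (ξ : E m) : Complex.I • vec ξ * chiP ξ = (‖ξ‖ : ℂ) • chiP ξ := by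
  rcases eq_or_ne ξ 0 with rfl | hξ
  · simp
  rw [I_smul_vec, smul_mul_assoc, sub_mul, chiP_mul_chiP hξ, chiM_mul_chiP hξ, sub_zero]

lemma I_smul_vec_mul_chiM (ξ : E m) : Complex.I • vec ξ * chiM ξ = -(‖ξ‖ : ℂ) • chiM ξ := by
  rcases eq_or_ne ξ 0 with rfl | hξ
  · simp
  rw [I_smul_vec, smul_mul_assoc, sub_mul, chiM_mul_chiM hξ, chiP_mul_chiM hξ, zero_sub, smul_neg,
    neg_smul]

lemma star_chiP (ξ : E m) : star (chiP ξ) = chiP ξ := by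
  simp only [chiP, star_smul_eq, star_add, star_one, star_vec]
  simp [neg_div]

lemma star_chiM (ξ : E m) : star (chiM ξ) = chiM ξ := by
  simp only [chiM, star_smul_eq, star_sub, star_one, star_vec]
  simp [neg_div]

lemma norm_I_div_smul_vec_le (ξ : E m) : ‖(Complex.I / (‖ξ‖ : ℂ)) • vec ξ‖ ≤ 1 := by
  rw [norm_smul, norm_vec, norm_div, Complex.norm_I, Complex.norm_real, norm_norm]
  rcases eq_or_ne ξ 0 with rfl | hξ
  · simp
  · rw [one_div, inv_mul_cancel₀ (norm_ne_zero_iff.2 hξ)]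

lemma norm_chiP_le (ξ : E m) : ‖chiP ξ‖ ≤ 1 := by
  rw [chiP, norm_smul]
  have := norm_add_le (1 : Cl m) ((Complex.I / (‖ξ‖ : ℂ)) • vec ξ)
  rw [norm_one_cl] at this
  have h2 := norm_I_div_smul_vec_le ξ
  norm_num
  linarith

lemma norm_chiM_le (ξ : E m) : ‖chiM ξ‖ ≤ 1 := by
  rw [chiM, norm_smul]
  have := norm_sub_le (1 : Cl m) ((Complex.I / (‖ξ‖ : ℂ)) • vec ξ)
  rw [norm_one_cl] at this
  have h2 := norm_I_div_smul_vec_le ξ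
  norm_num
  linarith

lemma stronglyMeasurable_unitVec :
    StronglyMeasurable fun ξ : E m => (Complex.I / (‖ξ‖ : ℂ)) • vec ξ := by
  refine StronglyMeasurable.smul (𝕜 := ℂ) ?_ (continuous_vec (m := m)).stronglyMeasurable
  exact (Measurable.const_div (by fun_prop) _).stronglyMeasurable

lemma stronglyMeasurable_chiP : StronglyMeasurable (chiP : E m → Cl m) :=
  (stronglyMeasurable_const (b := (1 : Cl m)).add stronglyMeasurable_unitVec).const_smul (1 / 2 : ℂ)

lemma stronglyMeasurable_chiM : StronglyMeasurable (chiM : E m → Cl m) :=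
  (stronglyMeasurable_const (b := (1 : Cl m)).sub stronglyMeasurable_unitVec).const_smul (1 / 2 : ℂ)

lemma stronglyMeasurable_eP (x : ℝ × E m) : StronglyMeasurable (eP x) :=
  (Continuous.stronglyMeasurable (f := fun ξ : E m => Complex.exp (Complex.I * (inner ℝ x.2 ξ : ℝ)) *
    (Real.exp (-x.1 * ‖ξ‖) : ℝ)) (by fun_prop)).smul stronglyMeasurable_chiP

lemma stronglyMeasurable_eM (x : ℝ × E m) : StronglyMeasurable (eM x) :=
  (Continuous.stronglyMeasurable (f := fun ξ : E m => Complex.exp (Complex.I * (inner ℝ x.2 ξ : ℝ)) *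
    (Real.exp (x.1 * ‖ξ‖) : ℝ)) (by fun_prop)).smul stronglyMeasurable_chiM

lemma stronglyMeasurable_monoExp (x : ℝ × E m) : StronglyMeasurable (monoExp x) :=
  (stronglyMeasurable_eP x).add (stronglyMeasurable_eM x)

lemma norm_cexp_I_mul_ofReal (r : ℝ) : ‖Complex.exp (Complex.I * r)‖ = 1 := by
  rw [mul_comm, Complex.norm_exp_ofReal_mul_I]

lemma norm_eP_le (x : ℝ × E m) (ξ : E m) : ‖eP x ξ‖ ≤ Real.exp (-x.1 * ‖ξ‖) := by
  rw [eP, norm_smul, norm_mul, norm_cexp_I_mul_ofReal, one_mul, Complex.norm_real, Real.norm_eq_abs,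
    Real.abs_exp]
  exact mul_le_of_le_one_right (Real.exp_pos _).le (norm_chiP_le ξ)

lemma norm_eM_le (x : ℝ × E m) (ξ : E m) : ‖eM x ξ‖ ≤ Real.exp (x.1 * ‖ξ‖) := by
  rw [eM, norm_smul, norm_mul, norm_cexp_I_mul_ofReal, one_mul, Complex.norm_real, Real.norm_eq_abs,
    Real.abs_exp]
  exact mul_le_of_le_one_right (Real.exp_pos _).le (norm_chiM_le ξ)

lemma norm_monoExp_le (x : ℝ × E m) (ξ : E m) : ‖monoExp x ξ‖ ≤ 2 * Real.exp (|x.1| * ‖ξ‖) := by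
  have h1 : Real.exp (-x.1 * ‖ξ‖) ≤ Real.exp (|x.1| * ‖ξ‖) := by
    gcongr; exact neg_le_abs _
  have h2 : Real.exp (x.1 * ‖ξ‖) ≤ Real.exp (|x.1| * ‖ξ‖) := by
    gcongr; exact le_abs_self _
  have := norm_add_le (eP x ξ) (eM x ξ)
  rw [monoExp]
  linarith [norm_eP_le x ξ, norm_eM_le x ξ]

lemma monoExp_zero_right (x : ℝ × E m) : monoExp x 0 = 1 := by
  simp [monoExp, eP, eM, chiP_add_chiM]

/-- With orthogonal idempotents `χ_±` the product splits into two scalar exponentials. At `ξ = 0`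
idempotence fails, but `e(x, 0) = χ_+ + χ_- = 1` for every `x`. -/
lemma monoExp_add (x y : ℝ × E m) (ξ : E m) :
    monoExp (x + y) ξ = monoExp x ξ * monoExp y ξ := by
  rcases eq_or_ne ξ 0 with rfl | hξ
  · simp [monoExp_zero_right]
  simp only [monoExp, eP, eM, add_mul, mul_add, smul_mul_smul_comm, chiP_mul_chiP hξ,
    chiP_mul_chiM hξ, chiM_mul_chiP hξ, chiM_mul_chiM hξ, smul_zero, add_zero, zero_add,
    Prod.fst_add, Prod.snd_add, inner_add_left]
  congr 2
  · push_cast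
    simp only [← Complex.exp_add]
    congr 1; ring
  · push_cast
    simp only [← Complex.exp_add]
    congr 1; ring

/-- The projections `χ_±` are self-conjugate, and the sign change of the vector part undoes the
complex conjugation of the phase. This turns the density of the Szegő kernel into the evaluation at
`x`. -/
lemma star_monoExp_pconj (x : ℝ × E m) (ξ : E m) : star (monoExp (pconj x) ξ) = monoExp x ξ := by
  simp only [monoExp, eP, eM, pconj, star_add, star_smul_eq, star_chiP, star_chiM, star_mul',
    inner_neg_left]
  simp [← Complex.exp_conj]

lemma monoExp_eq_cexp_smul (x : ℝ × E m) (ξ : E m) :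
    monoExp x ξ = Complex.exp (Complex.I * (inner ℝ x.2 ξ : ℝ)) • monoExp (x.1, 0) ξ := by
  simp [monoExp, eP, eM, mul_smul, smul_add]

lemma monoExp_zero_left (ξ : E m) : monoExp 0 ξ = 1 := by
  simp [monoExp, eP, eM, chiP_add_chiM]

/-- Projecting by `χ_±` isolates a single real exponential; this is how decay of the Fourier
transform is read off from bounds on the slices. -/
lemma chiP_mul_monoExp {ξ : E m} (hξ : ξ ≠ 0) (t : ℝ) :
    chiP ξ * monoExp (t, 0) ξ = (Real.exp (-t * ‖ξ‖)) • chiP ξ := by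
  simp only [monoExp, eP, eM, mul_add, mul_smul_comm, chiP_mul_chiP hξ, chiP_mul_chiM hξ]
  simp [← Complex.coe_smul]

lemma chiM_mul_monoExp {ξ : E m} (hξ : ξ ≠ 0) (t : ℝ) :
    chiM ξ * monoExp (t, 0) ξ = (Real.exp (t * ‖ξ‖)) • chiM ξ := by
  simp only [monoExp, eP, eM, mul_add, mul_smul_comm, chiM_mul_chiP hξ, chiM_mul_chiM hξ]
  simp [← Complex.coe_smul]

/-! ### The Fourier transform on `L²` -/

section LintegralSq

variable {α F : Type*} [MeasurableSpace α] {μ : Measure α} [NormedAddCommGroup F]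

lemma eLpNorm_two_sq (f : α → F) : eLpNorm f 2 μ ^ 2 = ∫⁻ x, ‖f x‖ₑ ^ 2 ∂μ := by
  have h := eLpNorm_nnreal_pow_eq_lintegral (f := f) (μ := μ) (p := 2) two_ne_zero
  norm_num at h
  exact h

lemma memLp_two_iff_lintegral_lt_top {f : α → F} (hf : AEStronglyMeasurable f μ) :
    MemLp f 2 μ ↔ ∫⁻ x, ‖f x‖ₑ ^ 2 ∂μ < ∞ := by
  rw [← eLpNorm_two_sq, ENNReal.pow_lt_top_iff]
  simp [MemLp, hf]

end LintegralSq

/-! ### The `L²` Fourier transform by duality with Schwartz functions. -/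

lemma integral_schwartz_smul_fourier (f : L2 m) (φ : SchwartzMap (E m) ℂ) :
    ∫ ξ, φ ξ • ((𝓕 f : L2 m) : E m → Cl m) ξ = ∫ v, (𝓕 φ) v • (f : E m → Cl m) v := by
  have h := congrArg (fun T : TemperedDistribution (E m) (Cl m) => T φ)
    (Lp.fourier_toTemperedDistribution_eq f)
  simp only [TemperedDistribution.fourier_apply, Lp.toTemperedDistribution_apply] at h
  exact h.symm

lemma integral_schwartz_smul_fourierInv (f : L2 m) (φ : SchwartzMap (E m) ℂ) :
    ∫ ξ, φ ξ • ((𝓕⁻ f : L2 m) : E m → Cl m) ξ = ∫ v, (𝓕⁻ φ) v • (f : E m → Cl m) v := by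
  have h := congrArg (fun T : TemperedDistribution (E m) (Cl m) => T φ)
    (Lp.fourierInv_toTemperedDistribution_eq f)
  simp only [TemperedDistribution.fourierInv_apply, Lp.toTemperedDistribution_apply] at h
  exact h.symm

/-- Fubini, in the form of the self-adjointness of the forward transform, applied to the reflected
function `k (-x)`; the transform of the latter is `𝓕⁻ k`. -/
lemma integral_schwartz_smul_fourierInv_of_integrable {k : E m → Cl m} (hk : Integrable k)
    (φ : SchwartzMap (E m) ℂ) : ∫ v, φ v • 𝓕⁻ k v = ∫ ξ, (𝓕⁻ φ) ξ • k ξ := by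
  have h1 := VectorFourier.integral_fourierIntegral_smul_eq_flip (L := innerₗ (E m))
    (μ := volume) (ν := volume) (f := φ) (g := fun x => k (-x)) Real.continuous_fourierChar
    continuous_inner φ.integrable hk.comp_neg
  have h2 : ∫ x, 𝓕 (φ : E m → ℂ) x • k (-x) = ∫ x, φ x • 𝓕 (fun y => k (-y)) x := by
    rw [flip_innerₗ] at h1
    exact h1
  rw [Real.fourierInv_eq_fourier_comp_neg, ← h2,
    ← integral_neg_eq_self (fun x => 𝓕 (φ : E m → ℂ) x • k (-x))]
  refine integral_congr_ae (Filter.Eventually.of_forall fun x => ?_)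
  simp only [neg_neg]
  rw [SchwartzMap.fourierInv_coe, Real.fourierInv_eq_fourier_neg]

lemma continuous_fourierInv_of_integrable {k : E m → Cl m} (hk : Integrable k) :
    Continuous (𝓕⁻ k) := by
  rw [Real.fourierInv_eq_fourier_comp_neg]
  exact VectorFourier.fourierIntegral_continuous Real.continuous_fourierChar
    continuous_inner hk.comp_neg

/-- On `L¹ ∩ L²`, the inverse Fourier integral is the `L²` inverse Fourier transform. -/
lemma fourierInv_toLp_ae_eq {k : E m → Cl m} (hk : Integrable k) (hk2 : MemLp k 2) :
    ((𝓕⁻ (hk2.toLp k) : L2 m) : E m → Cl m) =ᵐ[volume] 𝓕⁻ k := by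
  refine ae_eq_of_integral_contDiff_smul_eq
    ((Lp.memLp (𝓕⁻ (hk2.toLp k) : L2 m)).locallyIntegrable (by norm_num))
    (continuous_fourierInv_of_integrable hk).locallyIntegrable fun g hg hgc => ?_
  have hg1 : HasCompactSupport (Complex.ofRealCLM ∘ g) := hgc.comp_left rfl
  have hg2 : ContDiff ℝ ((⊤ : ℕ∞) : WithTop ℕ∞) (Complex.ofRealCLM ∘ g) :=
    Complex.ofRealCLM.contDiff.comp hg
  have h1 := integral_schwartz_smul_fourierInv (hk2.toLp k) (hg1.toSchwartzMap hg2)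
  have h2 := integral_schwartz_smul_fourierInv_of_integrable hk (hg1.toSchwartzMap hg2)
  have h3 : ∫ v, (𝓕⁻ (hg1.toSchwartzMap hg2)) v • (hk2.toLp k : E m → Cl m) v =
      ∫ v, (𝓕⁻ (hg1.toSchwartzMap hg2)) v • k v := by
    refine integral_congr_ae ?_
    filter_upwards [hk2.coeFn_toLp] with v hv
    rw [hv]
  rw [h3, ← h2] at h1
  simpa using h1

lemma two_pi_ne_zero : (2 * Real.pi) ≠ 0 := by positivity

lemma quasiMeasurePreserving_scale :
    Measure.QuasiMeasurePreserving (fun ξ : E m => (2 * Real.pi)⁻¹ • ξ) volume volume :=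
  Measure.quasiMeasurePreserving_smul volume (inv_ne_zero two_pi_ne_zero)

lemma fourierL2_congr {f : L2 m} {G : E m → Cl m}
    (h : ((𝓕 f : L2 m) : E m → Cl m) =ᵐ[volume] G) :
    fourierL2 f =ᵐ[volume] fun ξ => G ((2 * Real.pi)⁻¹ • ξ) :=
  quasiMeasurePreserving_scale.ae_eq_comp h

lemma aestronglyMeasurable_fourierL2 (f : L2 m) : AEStronglyMeasurable (fourierL2 f) volume :=
  (Lp.aestronglyMeasurable (𝓕 f : L2 m)).comp_quasiMeasurePreserving quasiMeasurePreserving_scale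

lemma twoPiInv_pos : 0 < twoPiInv m := by unfold twoPiInv; positivity

lemma lintegral_comp_scale (f : E m → ℝ≥0∞) :
    ∫⁻ ξ, f ((2 * Real.pi)⁻¹ • ξ) = ENNReal.ofReal (twoPiInv m)⁻¹ * ∫⁻ ξ, f ξ := by
  have h0 : (2 * Real.pi)⁻¹ ≠ 0 := inv_ne_zero two_pi_ne_zero
  have h := lintegral_map_equiv (μ := (volume : Measure (E m))) f
    (Homeomorph.smulOfNeZero ((2 * Real.pi)⁻¹) h0).toMeasurableEquiv
  have h2 := Measure.map_addHaar_smul (volume : Measure (E m)) h0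
  have h3 : ⇑(Homeomorph.smulOfNeZero (α := E m) ((2 * Real.pi)⁻¹) h0).toMeasurableEquiv =
    fun ξ => (2 * Real.pi)⁻¹ • ξ := rfl
  rw [h3] at h
  rw [← h, h2, lintegral_smul_measure, smul_eq_mul]
  congr 2
  rw [finrank_euclideanSpace_fin, abs_of_pos (by positivity), twoPiInv, inv_pow]

/-- Plancherel's identity for `fourierL2`. -/
lemma lintegral_fourierL2 (f : L2 m) :
    ∫⁻ ξ, ‖fourierL2 f ξ‖ₑ ^ 2 =
      ENNReal.ofReal (twoPiInv m)⁻¹ * ∫⁻ v, ‖(f : E m → Cl m) v‖ₑ ^ 2 := by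
  have h := lintegral_comp_scale (fun ξ => ‖((𝓕 f : L2 m) : E m → Cl m) ξ‖ₑ ^ 2)
  have h1 : ‖(𝓕 f : L2 m)‖ₑ = ‖f‖ₑ := by
    rw [← ofReal_norm, ← ofReal_norm, Lp.norm_fourier_eq]
  rw [← eLpNorm_two_sq, ← eLpNorm_two_sq, ← Lp.enorm_def, h1] at h
  rw [← eLpNorm_two_sq, ← eLpNorm_two_sq, ← Lp.enorm_def]
  exact h

lemma memLp_fourierL2 (f : L2 m) : MemLp (fourierL2 f) 2 := by
  rw [memLp_two_iff_lintegral_lt_top (aestronglyMeasurable_fourierL2 f), lintegral_fourierL2]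
  exact ENNReal.mul_lt_top ENNReal.ofReal_lt_top
    ((memLp_two_iff_lintegral_lt_top (Lp.aestronglyMeasurable f)).1 (Lp.memLp f))

lemma ae_scale_iff {p : E m → Prop} (h : ∀ᵐ ξ, p ((2 * Real.pi)⁻¹ • ξ)) : ∀ᵐ ξ, p ξ := by
  have h1 := (Measure.quasiMeasurePreserving_smul (volume : Measure (E m)) two_pi_ne_zero).ae h
  filter_upwards [h1] with ξ hξ
  simpa only [smul_smul, inv_mul_cancel₀ two_pi_ne_zero, one_smul] using hξ

lemma fourierL2_injective {f g : L2 m} (h : fourierL2 f =ᵐ[volume] fourierL2 g) : f = g := by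
  have h1 : (𝓕 f : L2 m) = 𝓕 g := Lp.ext (ae_scale_iff h)
  exact (Lp.fourierTransformₗᵢ (E m) (Cl m)).injective h1

/-- The inverse Fourier integral `(2π)^{-m} ∫ e^{i⟨v,ξ⟩} h(ξ) dξ`. -/
def synth (h : E m → Cl m) (v : E m) : Cl m :=
  twoPiInv m • ∫ ξ, Complex.exp (Complex.I * (inner ℝ v ξ : ℝ)) • h ξ

/-- The substitution `ξ = 2πη` absorbs the factor `(2π)^{-m}` and translates between the two
normalisations. -/
lemma synth_eq_fourierInv (h : E m → Cl m) :
    synth h = 𝓕⁻ (fun η => h ((2 * Real.pi) • η)) := by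
  ext1 v
  rw [Real.fourierInv_eq']
  have h1 := Measure.integral_comp_smul (volume : Measure (E m))
    (fun ξ => Complex.exp (Complex.I * (inner ℝ v ξ : ℝ)) • h ξ) (2 * Real.pi)
  rw [finrank_euclideanSpace_fin, abs_of_pos (by positivity)] at h1
  rw [synth, twoPiInv, ← h1]
  refine integral_congr_ae (Filter.Eventually.of_forall fun η => ?_)
  simp only [real_inner_smul_right, real_inner_comm v η]
  congr 2
  rw [mul_comm]

lemma memLp_comp_two_pi {h : E m → Cl m} (h2 : MemLp h 2) :
    MemLp (fun η => h ((2 * Real.pi) • η)) 2 := by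
  have hq := Measure.quasiMeasurePreserving_smul (volume : Measure (E m)) two_pi_ne_zero
  have hm := h2.aestronglyMeasurable.comp_quasiMeasurePreserving hq
  refine (memLp_two_iff_lintegral_lt_top hm).2 ?_
  have h3 := lintegral_comp_scale (fun η => ‖h ((2 * Real.pi) • η)‖ₑ ^ 2)
  simp only [smul_smul, mul_inv_cancel₀ two_pi_ne_zero, one_smul] at h3
  have h4 := (memLp_two_iff_lintegral_lt_top h2.aestronglyMeasurable).1 h2
  rw [h3] at h4
  have h5 : ENNReal.ofReal (twoPiInv m)⁻¹ ≠ 0 := by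
    rw [Ne, ENNReal.ofReal_eq_zero, not_le]
    exact inv_pos.2 twoPiInv_pos
  by_contra h6
  rw [not_lt, top_le_iff] at h6
  simp only [Function.comp_apply] at h6
  rw [h6, ENNReal.mul_top h5] at h4
  exact lt_irrefl _ h4

lemma integrable_comp_two_pi {h : E m → Cl m} (h1 : Integrable h) :
    Integrable (fun η => h ((2 * Real.pi) • η)) :=
  (integrable_comp_smul_iff volume h two_pi_ne_zero).2 h1

lemma continuous_synth {h : E m → Cl m} (h1 : Integrable h) : Continuous (synth h) := by
  rw [synth_eq_fourierInv]
  exact continuous_fourierInv_of_integrable (integrable_comp_two_pi h1)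

lemma synth_ae_eq {h : E m → Cl m} (h1 : Integrable h) (h2 : MemLp h 2) :
    synth h =ᵐ[volume] ((𝓕⁻ ((memLp_comp_two_pi h2).toLp _) : L2 m) : E m → Cl m) := by
  rw [synth_eq_fourierInv]
  exact (fourierInv_toLp_ae_eq (integrable_comp_two_pi h1) (memLp_comp_two_pi h2)).symm

lemma memLp_synth {h : E m → Cl m} (h1 : Integrable h) (h2 : MemLp h 2) : MemLp (synth h) 2 :=
  (memLp_congr_ae (synth_ae_eq h1 h2)).2 (Lp.memLp _)

lemma fourierL2_of_ae_eq_synth {h : E m → Cl m} (h1 : Integrable h) (h2 : MemLp h 2) {f : L2 m}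
    (hf : synth h =ᵐ[volume] (f : E m → Cl m)) : fourierL2 f =ᵐ[volume] h := by
  have h3 : f = 𝓕⁻ ((memLp_comp_two_pi h2).toLp _) := Lp.ext (hf.symm.trans (synth_ae_eq h1 h2))
  have h4 : (𝓕 f : L2 m) = (memLp_comp_two_pi h2).toLp _ := by
    rw [h3]; exact (Lp.fourierTransformₗᵢ (E m) (Cl m)).apply_symm_apply _
  have h5 := fourierL2_congr (f := f) (G := fun η => h ((2 * Real.pi) • η))
    (by rw [h4]; exact (memLp_comp_two_pi h2).coeFn_toLp)
  simpa only [smul_smul, mul_inv_cancel₀ two_pi_ne_zero, one_smul] using h5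

lemma ae_eq_synth_of_fourierL2 {h : E m → Cl m} (h1 : Integrable h) (h2 : MemLp h 2) {f : L2 m}
    (hf : fourierL2 f =ᵐ[volume] h) : (f : E m → Cl m) =ᵐ[volume] synth h := by
  have h3 := fourierL2_of_ae_eq_synth h1 h2 (memLp_synth h1 h2).coeFn_toLp.symm
  rw [fourierL2_injective (hf.trans h3.symm)]
  exact (memLp_synth h1 h2).coeFn_toLp

/-- Fourier inversion in `L²` holds only almost everywhere; continuity of both sides upgrades it to
every point, which the representation formula requires. -/
lemma eq_synth_of_continuous {h : E m → Cl m} (h1 : Integrable h) (h2 : MemLp h 2) {f : L2 m}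
    (hf : fourierL2 f =ᵐ[volume] h) {F : E m → Cl m} (hF : Continuous F)
    (hfF : F =ᵐ[volume] (f : E m → Cl m)) : F = synth h :=
  (hF.ae_eq_iff_eq volume (continuous_synth h1)).1 (hfF.trans (ae_eq_synth_of_fourierL2 h1 h2 hf))

lemma lintegral_synth {h : E m → Cl m} (h1 : Integrable h) (h2 : MemLp h 2) :
    ∫⁻ v, ‖synth h v‖ₑ ^ 2 = ENNReal.ofReal (twoPiInv m) * ∫⁻ ξ, ‖h ξ‖ₑ ^ 2 := by
  have h3 := lintegral_fourierL2 ((memLp_synth h1 h2).toLp _)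
  have h4 : ∫⁻ ξ, ‖fourierL2 ((memLp_synth h1 h2).toLp _) ξ‖ₑ ^ 2 = ∫⁻ ξ, ‖h ξ‖ₑ ^ 2 := by
    refine lintegral_congr_ae ?_
    filter_upwards [fourierL2_of_ae_eq_synth h1 h2 (memLp_synth h1 h2).coeFn_toLp.symm] with ξ hξ
    rw [hξ]
  have h5 : ∫⁻ v, ‖((memLp_synth h1 h2).toLp _ : E m → Cl m) v‖ₑ ^ 2 =
      ∫⁻ v, ‖synth h v‖ₑ ^ 2 := by
    refine lintegral_congr_ae ?_
    filter_upwards [(memLp_synth h1 h2).coeFn_toLp] with ξ hξ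
    rw [hξ]
  rw [← h4, h3, h5, ← mul_assoc, ← ENNReal.ofReal_mul twoPiInv_pos.le, mul_inv_cancel₀ twoPiInv_pos.ne',
    ENNReal.ofReal_one, one_mul]

/-! ### Exponential weights -/

/-- Compare with `(1 + |ξ|)^{-(m+1)}`, integrable because the exponent exceeds the dimension,
through `z^{m+1}/(m+1)! ≤ e^z` at `z = c(1 + |ξ|)`. -/
lemma integrable_exp_neg_mul_norm {c : ℝ} (hc : 0 < c) :
    Integrable fun ξ : E m => Real.exp (-c * ‖ξ‖) := by
  have h1 : Integrable fun ξ : E m => (1 + ‖ξ‖) ^ (-((m + 1 : ℕ) : ℝ)) :=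
    integrable_one_add_norm (by rw [finrank_euclideanSpace_fin]; push_cast; linarith)
  refine (h1.const_mul (Real.exp c * (m + 1).factorial / c ^ (m + 1))).mono'
    (by fun_prop) (Filter.Eventually.of_forall fun ξ => ?_)
  have hp : 0 < 1 + ‖ξ‖ := by positivity
  have h2 := Real.pow_div_factorial_le_exp (c * (1 + ‖ξ‖)) (by positivity) (m + 1)
  rw [Real.norm_eq_abs, Real.abs_exp, Real.rpow_neg hp.le, Real.rpow_natCast]
  have h3 : Real.exp (-c * ‖ξ‖) = Real.exp c / Real.exp (c * (1 + ‖ξ‖)) := by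
    rw [← Real.exp_sub]; congr 1; ring
  rw [h3, div_le_iff₀ (Real.exp_pos _)]
  have h4 : 0 < (1 + ‖ξ‖) ^ (m + 1) := by positivity
  have h5 : (0 : ℝ) < (m + 1).factorial := by positivity
  calc Real.exp c = Real.exp c * (m + 1).factorial / c ^ (m + 1) * ((1 + ‖ξ‖) ^ (m + 1))⁻¹ *
        ((c * (1 + ‖ξ‖)) ^ (m + 1) / (m + 1).factorial) := by
        rw [mul_pow]; field_simp
    _ ≤ _ := by gcongr

lemma memLp_exp_neg_mul_norm {c : ℝ} (hc : 0 < c) :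
    MemLp (fun ξ : E m => Real.exp (-c * ‖ξ‖)) 2 := by
  rw [memLp_two_iff_integrable_sq (by fun_prop)]
  have : (fun ξ : E m => Real.exp (-c * ‖ξ‖) ^ 2) = fun ξ => Real.exp (-(2 * c) * ‖ξ‖) := by
    ext ξ; rw [← Real.exp_nat_mul]; congr 1; push_cast; ring
  rw [this]
  exact integrable_exp_neg_mul_norm (by positivity)

namespace WeightedL2

variable {a b : ℝ} {g h : E m → Cl m}

lemma exp_smul (hg : WeightedL2 a g) (hab : b ≤ a) :
    MemLp (fun ξ => Real.exp (b * ‖ξ‖) • g ξ) 2 := by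
  refine MemLp.of_le hg ?_ (Filter.Eventually.of_forall fun ξ => ?_)
  · have := (Continuous.aestronglyMeasurable (μ := (volume : Measure (E m)))
      (f := fun ξ : E m => Real.exp ((b - a) * ‖ξ‖)) (by fun_prop)).smul hg.aestronglyMeasurable
    refine this.congr (Filter.Eventually.of_forall fun ξ => ?_)
    simp only [Pi.smul_apply', smul_smul, ← Real.exp_add]
    congr 2; ring
  · simp only [norm_smul, Real.norm_eq_abs, Real.abs_exp]
    gcongr

lemma aestronglyMeasurable (hg : WeightedL2 a g) : AEStronglyMeasurable g volume := by
  have := (Continuous.aestronglyMeasurable (μ := (volume : Measure (E m)))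
    (f := fun ξ : E m => Real.exp (-a * ‖ξ‖)) (by fun_prop)).smul (MemLp.aestronglyMeasurable hg)
  refine this.congr (Filter.Eventually.of_forall fun ξ => ?_)
  simp only [Pi.smul_apply', smul_smul, ← Real.exp_add]
  simp

lemma memLp (hg : WeightedL2 a g) (ha : 0 ≤ a) : MemLp g 2 := by
  simpa using hg.exp_smul ha

/-- Cauchy–Schwarz: the spare factor `e^{-(a-b)|ξ|}` is in `L²` because `b < a` strictly. -/
lemma integrable_exp_smul (hg : WeightedL2 a g) (hab : b < a) :
    Integrable fun ξ => Real.exp (b * ‖ξ‖) • g ξ := by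
  have h1 := memLp_one_iff_integrable.1 (MemLp.smul (p := 2) (q := 2) (r := 1) hg
    (memLp_exp_neg_mul_norm (m := m) (sub_pos.2 hab)))
  refine h1.congr (Filter.Eventually.of_forall fun ξ => ?_)
  simp only [Pi.smul_apply', smul_smul, ← Real.exp_add]
  congr 2; ring

lemma integrable (hg : WeightedL2 a g) (ha : 0 < a) : Integrable g := by
  simpa using hg.integrable_exp_smul ha

lemma bounded_mul (hg : WeightedL2 a g) {u : E m → Cl m} (hu : StronglyMeasurable u)
    (hb : ∀ ξ, ‖u ξ‖ ≤ 1) : WeightedL2 a fun ξ => u ξ * g ξ := by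
  refine MemLp.of_le_mul (c := ‖(mulL : Cl m →L[ℂ] _)‖) hg ?_
    (Filter.Eventually.of_forall fun ξ => ?_)
  · exact (Continuous.aestronglyMeasurable
      (f := fun ξ : E m => Real.exp (a * ‖ξ‖)) (by fun_prop)).smul
      (hu.aestronglyMeasurable.mul hg.aestronglyMeasurable)
  · simp only [norm_smul]
    have h1 := norm_mul_le_mulL (u ξ) (g ξ)
    have h2 : ‖(mulL : Cl m →L[ℂ] _)‖ * ‖u ξ‖ * ‖g ξ‖ ≤ ‖(mulL : Cl m →L[ℂ] _)‖ * 1 * ‖g ξ‖ := by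
      gcongr; exact hb ξ
    calc ‖Real.exp (a * ‖ξ‖)‖ * ‖u ξ * g ξ‖
        ≤ ‖Real.exp (a * ‖ξ‖)‖ * (‖(mulL : Cl m →L[ℂ] _)‖ * 1 * ‖g ξ‖) := by
          gcongr; exact h1.trans h2
      _ = _ := by ring

lemma chiP_mul (hg : WeightedL2 a g) : WeightedL2 a fun ξ => chiP ξ * g ξ :=
  hg.bounded_mul stronglyMeasurable_chiP norm_chiP_le

lemma chiM_mul (hg : WeightedL2 a g) : WeightedL2 a fun ξ => chiM ξ * g ξ :=
  hg.bounded_mul stronglyMeasurable_chiM norm_chiM_le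

end WeightedL2

/-! ### Superpositions of monogenic exponentials -/

/-- The phase `i⟨v,ξ⟩ + σ x_0 |ξ|` as a real linear form in `x = (x_0, v)`. -/
def phase (σ : ℝ) (ξ : E m) : ℝ × E m →L[ℝ] ℂ :=
  Complex.I • (Complex.ofRealCLM ∘L innerSL ℝ ξ ∘L ContinuousLinearMap.snd ℝ ℝ (E m)) +
    (σ * ‖ξ‖) • (Complex.ofRealCLM ∘L ContinuousLinearMap.fst ℝ ℝ (E m))

lemma phase_apply (σ : ℝ) (ξ : E m) (x : ℝ × E m) :
    phase σ ξ x = Complex.I * (inner ℝ x.2 ξ : ℝ) + (σ * x.1 * ‖ξ‖ : ℝ) := by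
  simp [phase, real_inner_comm]
  ring

lemma continuous_phase (σ : ℝ) : Continuous fun ξ : E m => phase σ ξ := by
  unfold phase
  have h : Continuous fun ξ : E m => innerSL ℝ ξ := (innerSL ℝ).continuous
  fun_prop

lemma norm_phase_le (σ : ℝ) (ξ : E m) : ‖phase σ ξ‖ ≤ (1 + |σ|) * ‖ξ‖ := by
  refine ContinuousLinearMap.opNorm_le_bound _ (by positivity) fun x => ?_
  rw [phase_apply]
  refine (norm_add_le _ _).trans ?_
  rw [norm_mul, Complex.norm_I, one_mul, Complex.norm_real, Complex.norm_real, norm_mul, norm_mul,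
    norm_norm, Real.norm_eq_abs σ]
  have h1 := norm_inner_le_norm (𝕜 := ℝ) x.2 ξ
  have h2 := norm_fst_le x
  have h3 := norm_snd_le x
  have h4 : ‖x.2‖ * ‖ξ‖ ≤ ‖x‖ * ‖ξ‖ := by gcongr
  have h5 : |σ| * ‖x.1‖ * ‖ξ‖ ≤ |σ| * ‖x‖ * ‖ξ‖ := by gcongr
  nlinarith

lemma norm_cexp_phase (σ : ℝ) (ξ : E m) (x : ℝ × E m) :
    ‖Complex.exp (phase σ ξ x)‖ = Real.exp (σ * x.1 * ‖ξ‖) := by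
  rw [phase_apply, Complex.exp_add, norm_mul, norm_cexp_I_mul_ofReal, one_mul,
    Complex.norm_exp_ofReal]

/-- The function `(2π)^{-m} ∫ e^{i⟨v,ξ⟩ + σ x_0 |ξ|} h(ξ) dξ`. -/
def expSynth (σ : ℝ) (h : E m → Cl m) (x : ℝ × E m) : Cl m :=
  twoPiInv m • ∫ ξ, Complex.exp (phase σ ξ x) • h ξ

/-- The integrand of the derivative of `expSynth`. -/
def expSynthDeriv (σ : ℝ) (h : E m → Cl m) (x : ℝ × E m) (ξ : E m) : ℝ × E m →L[ℝ] Cl m :=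
  Complex.exp (phase σ ξ x) • (((ContinuousLinearMap.lsmul ℝ ℂ).flip (h ξ)).comp (phase σ ξ))

lemma expSynthDeriv_apply (σ : ℝ) (h : E m → Cl m) (x y : ℝ × E m) (ξ : E m) :
    expSynthDeriv σ h x ξ y = Complex.exp (phase σ ξ x) • phase σ ξ y • h ξ := rfl

lemma hasFDerivAt_cexp_phase_smul (σ : ℝ) (h : E m → Cl m) (x : ℝ × E m) (ξ : E m) :
    HasFDerivAt (fun x => Complex.exp (phase σ ξ x) • h ξ) (expSynthDeriv σ h x ξ) x := by
  have h1 := ((phase σ ξ).hasFDerivAt (x := x)).cexp.smul_const (h ξ)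
  refine h1.congr_fderiv ?_
  refine ContinuousLinearMap.ext fun y => ?_
  simp [expSynthDeriv_apply, mul_smul]

lemma norm_expSynthDeriv_le (σ : ℝ) (h : E m → Cl m) (x : ℝ × E m) (ξ : E m) :
    ‖expSynthDeriv σ h x ξ‖ ≤ Real.exp (σ * x.1 * ‖ξ‖) * ((1 + |σ|) * ‖ξ‖ * ‖h ξ‖) := by
  refine ContinuousLinearMap.opNorm_le_bound _ (by positivity) fun y => ?_
  rw [expSynthDeriv_apply, norm_smul, norm_smul, norm_cexp_phase]
  have h1 := ((phase σ ξ).le_opNorm y).trans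
    (mul_le_mul_of_nonneg_right (norm_phase_le σ ξ) (norm_nonneg y))
  calc _ ≤ Real.exp (σ * x.1 * ‖ξ‖) * ((1 + |σ|) * ‖ξ‖ * ‖y‖ * ‖h ξ‖) := by gcongr
    _ = _ := by ring

lemma aestronglyMeasurable_expSynthDeriv (σ : ℝ) {h : E m → Cl m}
    (hh : AEStronglyMeasurable h volume) (x : ℝ × E m) :
    AEStronglyMeasurable (expSynthDeriv σ h x) volume := by
  have hc : Continuous fun p : (ℝ × E m →L[ℝ] ℂ) × Cl m =>
      Complex.exp (p.1 x) • (((ContinuousLinearMap.lsmul ℝ ℂ).flip p.2).comp p.1) := by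
    have : Continuous fun p : (ℝ × E m →L[ℝ] ℂ) × Cl m =>
      ((ContinuousLinearMap.lsmul ℝ ℂ : ℂ →L[ℝ] Cl m →L[ℝ] Cl m).flip p.2) :=
      (ContinuousLinearMap.lsmul ℝ ℂ : ℂ →L[ℝ] Cl m →L[ℝ] Cl m).flip.continuous.comp continuous_snd
    have h2 : Continuous fun p : (ℝ × E m →L[ℝ] ℂ) × Cl m => Complex.exp (p.1 x) :=
      Complex.continuous_exp.comp (continuous_fst.clm_apply continuous_const)
    exact h2.smul (this.clm_comp continuous_fst)
  have hp : AEStronglyMeasurable (fun ξ => (phase σ ξ, h ξ)) volume :=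
    (continuous_phase σ).aestronglyMeasurable.prodMk hh
  have := hc.comp_aestronglyMeasurable hp
  exact this

lemma continuous_expSynthDeriv (σ : ℝ) (h : E m → Cl m) (ξ : E m) :
    Continuous fun x => expSynthDeriv σ h x ξ := by
  unfold expSynthDeriv
  fun_prop

section

variable {a σ : ℝ} {h : E m → Cl m}

/-- Used to pay for the factor `|ξ|` produced by a differentiation with a slightly larger exponent.
-/
lemma mul_exp_le {b c r : ℝ} (hbc : b < c) (_hr : 0 ≤ r) :
    r * Real.exp (b * r) ≤ (c - b)⁻¹ * Real.exp (c * r) := by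
  have h0 : 0 < c - b := sub_pos.2 hbc
  have h1 := Real.add_one_le_exp ((c - b) * r)
  have h2 : Real.exp (c * r) = Real.exp ((c - b) * r) * Real.exp (b * r) := by
    rw [← Real.exp_add]; congr 1; ring
  rw [h2, ← mul_assoc]
  gcongr
  rw [inv_mul_eq_div, le_div_iff₀ h0]
  linarith

/-- A dominating function for the derivative of `expSynth`, locally uniformly in `σ x_0 < a`. -/
lemma exists_bound_expSynthDeriv (hh : WeightedL2 a h) {x : ℝ × E m} (hx : σ * x.1 < a) :
    ∃ bound : E m → ℝ, Integrable bound ∧ ∃ s ∈ nhds x, ∀ y ∈ s, σ * y.1 < a ∧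
      ∀ ξ, ‖expSynthDeriv σ h y ξ‖ ≤ bound ξ := by
  -- The exponent `b` bounds `σ y_0` for all `y` near `x`; the larger `c` absorbs the factor `|ξ|`
  -- and still leaves `c < a` for integrability.
  obtain ⟨b, hb1, hb2⟩ := exists_between hx
  obtain ⟨c, hc1, hc2⟩ := exists_between hb2
  refine ⟨fun ξ => (1 + |σ|) * (c - b)⁻¹ * ‖Real.exp (c * ‖ξ‖) • h ξ‖,
    (hh.integrable_exp_smul hc2).norm.const_mul _, {y | σ * y.1 < b},
    (isOpen_lt (by fun_prop) continuous_const).mem_nhds hb1, fun y hy => ⟨hy.out.trans hb2, fun ξ => ?_⟩⟩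
  refine (norm_expSynthDeriv_le σ h y ξ).trans ?_
  have h1 : Real.exp (σ * y.1 * ‖ξ‖) ≤ Real.exp (b * ‖ξ‖) := by
    have := hy.out.le
    gcongr
  have h2 := mul_exp_le hc1 (norm_nonneg ξ)
  simp only [norm_smul, Real.norm_eq_abs, Real.abs_exp]
  calc _ ≤ Real.exp (b * ‖ξ‖) * ((1 + |σ|) * ‖ξ‖ * ‖h ξ‖) := by gcongr
    _ = (1 + |σ|) * ‖h ξ‖ * (‖ξ‖ * Real.exp (b * ‖ξ‖)) := by ring
    _ ≤ (1 + |σ|) * ‖h ξ‖ * ((c - b)⁻¹ * Real.exp (c * ‖ξ‖)) := by gcongr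
    _ = _ := by ring

lemma integrable_cexp_phase_smul (hh : WeightedL2 a h) {x : ℝ × E m} (hx : σ * x.1 < a) :
    Integrable fun ξ => Complex.exp (phase σ ξ x) • h ξ := by
  refine (hh.integrable_exp_smul hx).mono ?_ (Filter.Eventually.of_forall fun ξ => ?_)
  · refine (Continuous.aestronglyMeasurable (f := fun ξ : E m => Complex.exp (phase σ ξ x))
      ?_).smul hh.aestronglyMeasurable
    exact Complex.continuous_exp.comp ((continuous_phase σ).clm_apply continuous_const)
  · rw [norm_smul, norm_smul, norm_cexp_phase, Real.norm_eq_abs, Real.abs_exp]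

lemma hasFDerivAt_expSynth (hh : WeightedL2 a h) {x : ℝ × E m} (hx : σ * x.1 < a) :
    HasFDerivAt (expSynth σ h) (twoPiInv m • ∫ ξ, expSynthDeriv σ h x ξ) x := by
  obtain ⟨bound, hbi, s, hs, hb⟩ := exists_bound_expSynthDeriv hh hx
  refine HasFDerivAt.const_smul (hasFDerivAt_integral_of_dominated_of_fderiv_le hs ?_
    (integrable_cexp_phase_smul hh hx) (aestronglyMeasurable_expSynthDeriv σ hh.aestronglyMeasurable x)
    (Filter.Eventually.of_forall fun ξ y hy => (hb y hy).2 ξ) hbi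
    (Filter.Eventually.of_forall fun ξ y _ => hasFDerivAt_cexp_phase_smul σ h y ξ)) _
  filter_upwards [hs] with y hy
  exact (integrable_cexp_phase_smul hh (hb y hy).1).aestronglyMeasurable

lemma continuousAt_integral_expSynthDeriv (hh : WeightedL2 a h) {x : ℝ × E m}
    (hx : σ * x.1 < a) : ContinuousAt (fun y => ∫ ξ, expSynthDeriv σ h y ξ) x := by
  obtain ⟨bound, hbi, s, hs, hb⟩ := exists_bound_expSynthDeriv hh hx
  refine continuousAt_of_dominated
    (Filter.Eventually.of_forall fun y => aestronglyMeasurable_expSynthDeriv σ hh.aestronglyMeasurable y)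
    ?_ hbi (Filter.Eventually.of_forall fun ξ => (continuous_expSynthDeriv σ h ξ).continuousAt)
  filter_upwards [hs] with y hy
  exact Filter.Eventually.of_forall fun ξ => (hb y hy).2 ξ

lemma integrable_expSynthDeriv (hh : WeightedL2 a h) {x : ℝ × E m} (hx : σ * x.1 < a) :
    Integrable (expSynthDeriv σ h x) := by
  obtain ⟨bound, hbi, s, hs, hb⟩ := exists_bound_expSynthDeriv hh hx
  exact hbi.mono' (aestronglyMeasurable_expSynthDeriv σ hh.aestronglyMeasurable x)
    (Filter.Eventually.of_forall fun ξ => (hb x (mem_of_mem_nhds hs)).2 ξ)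

lemma isOpen_slab {I : Set ℝ} (hI : IsOpen I) : IsOpen (slab m I) := hI.prod isOpen_univ

lemma contDiffOn_expSynth (hh : WeightedL2 a h) {I : Set ℝ} (hI : IsOpen I)
    (hIa : ∀ t ∈ I, σ * t < a) : ContDiffOn ℝ 1 (expSynth σ h) (slab m I) := by
  have hd : ∀ x ∈ slab m I, HasFDerivAt (expSynth σ h)
      (twoPiInv m • ∫ ξ, expSynthDeriv σ h x ξ) x :=
    fun x hx => hasFDerivAt_expSynth hh (hIa x.1 hx.1)
  have h1 : ContDiffOn ℝ (0 + 1) (expSynth σ h) (slab m I) := by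
    rw [contDiffOn_succ_iff_fderiv_of_isOpen (isOpen_slab hI)]
    refine ⟨fun x hx => (hd x hx).differentiableAt.differentiableWithinAt, by simp, ?_⟩
    rw [contDiffOn_zero]
    refine ContinuousOn.congr (f := fun x => twoPiInv m • ∫ ξ, expSynthDeriv σ h x ξ) ?_
      fun x hx => (hd x hx).fderiv
    exact fun x hx => ((continuousAt_integral_expSynthDeriv hh
      (hIa x.1 hx.1)).const_smul (twoPiInv m)).continuousWithinAt
  simpa using h1

/-- The linear map on derivatives that defines the Dirac operator. -/
def diracL : (ℝ × E m →L[ℝ] Cl m) →L[ℝ] Cl m :=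
  ContinuousLinearMap.apply ℝ (Cl m) ((1, 0) : ℝ × E m) +
    ∑ k, mulLeft (gen k) ∘L ContinuousLinearMap.apply ℝ (Cl m) ((0, EuclideanSpace.single k 1) : ℝ × E m)

lemma diracL_apply (A : ℝ × E m →L[ℝ] Cl m) :
    diracL A = A (1, 0) + ∑ k, gen k * A (0, EuclideanSpace.single k 1) := by
  simp [diracL]

lemma dirac_eq_diracL (F : ℝ × E m → Cl m) (x) : dirac F x = diracL (fderiv ℝ F x) := by
  rw [diracL_apply, dirac]

/-- The Dirac operator acts on an exponential through its symbol `σ|ξ| + iξ`, so monogenicity of the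
superposition becomes a pointwise algebraic condition on the density. -/
lemma diracL_expSynthDeriv (x : ℝ × E m) (ξ : E m) :
    diracL (expSynthDeriv σ h x ξ) =
      Complex.exp (phase σ ξ x) • (((σ * ‖ξ‖ : ℝ) : ℂ) • h ξ + Complex.I • vec ξ * h ξ) := by
  rw [diracL_apply, vec, smul_add, Finset.smul_sum, Finset.sum_mul, Finset.smul_sum]
  congr 1
  · rw [expSynthDeriv_apply, phase_apply σ ξ (1, 0)]; simp
  · refine Finset.sum_congr rfl fun k _ => ?_
    rw [expSynthDeriv_apply, phase_apply σ ξ (0, _)]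
    simp only [mul_smul_comm, smul_mul_assoc, smul_smul, EuclideanSpace.inner_single_left]
    simp

lemma dirac_expSynth (hh : WeightedL2 a h) {x : ℝ × E m} (hx : σ * x.1 < a)
    (hm : ∀ ξ, ((σ * ‖ξ‖ : ℝ) : ℂ) • h ξ + Complex.I • vec ξ * h ξ = 0) :
    dirac (expSynth σ h) x = 0 := by
  rw [dirac_eq_diracL, (hasFDerivAt_expSynth hh hx).fderiv, map_smul,
    ← ContinuousLinearMap.integral_comp_comm _ (integrable_expSynthDeriv hh hx)]
  simp only [diracL_expSynthDeriv, hm, smul_zero, integral_zero]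

lemma expSynth_slice (t : ℝ) (v : E m) :
    expSynth σ h (t, v) = synth (fun ξ => Real.exp (σ * t * ‖ξ‖) • h ξ) v := by
  rw [expSynth, synth]
  congr 2
  ext1 ξ
  rw [phase_apply, Complex.exp_add, mul_smul, ← Complex.ofReal_exp, Complex.coe_smul]

/-- By Plancherel the `L²` norm of the slice at `t` is that of `e^{σt|ξ|} h`, and `σt < a` bounds it
by the norm of `e^{a|ξ|} h` uniformly in `t`. -/
lemma memHardy_expSynth (hh : WeightedL2 a h) {I : Set ℝ} (hI : IsOpen I)
    (hIa : ∀ t ∈ I, σ * t < a)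
    (hm : ∀ ξ, ((σ * ‖ξ‖ : ℝ) : ℂ) • h ξ + Complex.I • vec ξ * h ξ = 0) :
    MemHardy I (expSynth σ h) := by
  refine ⟨⟨contDiffOn_expSynth hh hI hIa, fun x hx => dirac_expSynth hh (hIa x.1 hx.1) hm⟩, ?_⟩
  have h1 : (∫⁻ ξ, ‖Real.exp (a * ‖ξ‖) • h ξ‖ₑ ^ 2) < ∞ :=
    (memLp_two_iff_lintegral_lt_top hh.1).1 hh
  refine lt_of_le_of_lt (iSup₂_le fun t ht => ?_)
    (ENNReal.mul_lt_top (ENNReal.ofReal_lt_top (r := twoPiInv m)) h1)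
  simp_rw [expSynth_slice]
  rw [lintegral_synth (hh.integrable_exp_smul (hIa t ht)) (hh.exp_smul (hIa t ht).le)]
  gcongr with ξ
  rw [enorm_le_iff_norm_le, norm_smul, norm_smul, Real.norm_eq_abs, Real.norm_eq_abs, Real.abs_exp,
    Real.abs_exp]
  have := (hIa t ht).le
  gcongr

end

/-! ### Elementary properties of the Hardy spaces -/

namespace MemHardy

variable {I J : Set ℝ} {F G : ℝ × E m → Cl m}

lemma mono (hF : MemHardy J F) (hIJ : I ⊆ J) : MemHardy I F :=
  have hs : slab m I ⊆ slab m J := prod_mono hIJ Subset.rfl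
  ⟨⟨hF.1.1.mono hs, fun x hx => hF.1.2 x (hs hx)⟩,
    lt_of_le_of_lt (biSup_mono hIJ) hF.2⟩

lemma congr (hF : MemHardy I F) (hI : IsOpen I) (h : EqOn G F (slab m I)) : MemHardy I G := by
  refine ⟨⟨hF.1.1.congr h, fun x hx => ?_⟩, ?_⟩
  · have h1 : G =ᶠ[nhds x] F := h.eventuallyEq_of_mem ((isOpen_slab hI).mem_nhds hx)
    rw [dirac_eq_diracL, h1.fderiv_eq, ← dirac_eq_diracL, hF.1.2 x hx]
  · refine lt_of_le_of_lt (iSup₂_mono fun t ht => le_of_eq ?_) hF.2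
    refine lintegral_congr fun v => ?_
    rw [h (show (t, v) ∈ slab m I from ⟨ht, trivial⟩)]

lemma differentiableAt (hF : MemHardy I F) (hI : IsOpen I) {x : ℝ × E m} (hx : x ∈ slab m I) :
    DifferentiableAt ℝ F x :=
  (hF.1.1.differentiableOn one_ne_zero).differentiableAt ((isOpen_slab hI).mem_nhds hx)

lemma continuous_slice (hF : MemHardy I F) {t : ℝ} (ht : t ∈ I) :
    Continuous fun v : E m => F (t, v) :=
  hF.1.1.continuousOn.comp_continuous (by fun_prop) fun _ => ⟨ht, trivial⟩

lemma lintegral_slice_le (_hF : MemHardy I F) {t : ℝ} (ht : t ∈ I) :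
    ∫⁻ v : E m, ‖F (t, v)‖ₑ ^ 2 ≤ ⨆ t ∈ I, ∫⁻ v : E m, ‖F (t, v)‖ₑ ^ 2 :=
  le_iSup₂ (f := fun t (_ : t ∈ I) => ∫⁻ v : E m, ‖F (t, v)‖ₑ ^ 2) t ht

lemma memLp_slice (hF : MemHardy I F) {t : ℝ} (ht : t ∈ I) :
    MemLp (fun v : E m => F (t, v)) 2 :=
  (memLp_two_iff_lintegral_lt_top (hF.continuous_slice ht).aestronglyMeasurable).2
    (lt_of_le_of_lt (hF.lintegral_slice_le ht) hF.2)

lemma neg (hF : MemHardy I F) : MemHardy I (-F) := by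
  refine ⟨⟨hF.1.1.neg, fun x hx => ?_⟩, ?_⟩
  · rw [dirac_eq_diracL, fderiv_neg, map_neg, ← dirac_eq_diracL, hF.1.2 x hx, neg_zero]
  · simpa using hF.2

lemma add (hF : MemHardy I F) (hG : MemHardy I G) (hI : IsOpen I) : MemHardy I (F + G) := by
  refine ⟨⟨hF.1.1.add hG.1.1, fun x hx => ?_⟩, ?_⟩
  · rw [dirac_eq_diracL, fderiv_add (hF.differentiableAt hI hx) (hG.differentiableAt hI hx), map_add,
      ← dirac_eq_diracL, ← dirac_eq_diracL, hF.1.2 x hx, hG.1.2 x hx, add_zero]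
  · have h1 : (⨆ t ∈ I, ∫⁻ v : E m, ‖(F + G) (t, v)‖ₑ ^ 2) ≤
        2 * (⨆ t ∈ I, ∫⁻ v : E m, ‖F (t, v)‖ₑ ^ 2) + 2 * ⨆ t ∈ I, ∫⁻ v : E m, ‖G (t, v)‖ₑ ^ 2 := by
      refine iSup₂_le fun t ht => ?_
      refine le_trans ?_ (add_le_add (mul_le_mul_right (hF.lintegral_slice_le ht) 2)
        (mul_le_mul_right (hG.lintegral_slice_le ht) 2))
      rw [← lintegral_const_mul' _ _ (by norm_num), ← lintegral_const_mul' _ _ (by norm_num),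
        ← lintegral_add_left' ((hF.continuous_slice ht).enorm.measurable.pow_const 2 |>.const_mul 2
          |>.aemeasurable)]
      refine lintegral_mono fun v => ?_
      have h2 : ‖(F + G) (t, v)‖ₑ ≤ ‖F (t, v)‖ₑ + ‖G (t, v)‖ₑ := enorm_add_le _ _
      refine (pow_le_pow_left' h2 2).trans ?_
      rw [← mul_add]
      have := ENNReal.rpow_add_le_mul_rpow_add_rpow ‖F (t, v)‖ₑ ‖G (t, v)‖ₑ (p := 2) (by norm_num)
      norm_num at this
      exact this
    exact lt_of_le_of_lt h1 (ENNReal.add_lt_top.2 ⟨ENNReal.mul_lt_top (by norm_num) hF.2,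
      ENNReal.mul_lt_top (by norm_num) hG.2⟩)

lemma sub (hF : MemHardy I F) (hG : MemHardy I G) (hI : IsOpen I) : MemHardy I (F - G) := by
  rw [sub_eq_add_neg]
  exact hF.add hG.neg hI

end MemHardy

/-! ### The representation formula gives Hardy functions -/

lemma eP_eq_cexp_phase (x : ℝ × E m) (ξ : E m) :
    eP x ξ = Complex.exp (phase (-1) ξ x) • chiP ξ := by
  rw [eP, phase_apply, Complex.exp_add, ← Complex.ofReal_exp, neg_one_mul]

lemma eM_eq_cexp_phase (x : ℝ × E m) (ξ : E m) :
    eM x ξ = Complex.exp (phase 1 ξ x) • chiM ξ := by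
  rw [eM, phase_apply, Complex.exp_add, ← Complex.ofReal_exp, one_mul]

lemma monogenic_chiP_mul (g : E m → Cl m) (ξ : E m) :
    (((-1) * ‖ξ‖ : ℝ) : ℂ) • (chiP ξ * g ξ) + Complex.I • vec ξ * (chiP ξ * g ξ) = 0 := by
  rw [← mul_assoc, I_smul_vec_mul_chiP, smul_mul_assoc, ← add_smul]
  simp

lemma monogenic_chiM_mul (g : E m → Cl m) (ξ : E m) :
    ((1 * ‖ξ‖ : ℝ) : ℂ) • (chiM ξ * g ξ) + Complex.I • vec ξ * (chiM ξ * g ξ) = 0 := by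
  rw [← mul_assoc, I_smul_vec_mul_chiM, smul_mul_assoc, ← add_smul]
  simp

/-- The part `(2π)^{-m} ∫ e⁺(x, ξ) g(ξ) dξ`. -/
def plusPart (g : E m → Cl m) : ℝ × E m → Cl m := expSynth (-1) fun ξ => chiP ξ * g ξ

/-- The part `(2π)^{-m} ∫ e⁻(x, ξ) g(ξ) dξ`. -/
def minusPart (g : E m → Cl m) : ℝ × E m → Cl m := expSynth 1 fun ξ => chiM ξ * g ξ

section

variable {a : ℝ} {g : E m → Cl m}

lemma memHardy_plusPart (hg : WeightedL2 a g) : MemHardy (Ioi (-a)) (plusPart g) :=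
  memHardy_expSynth hg.chiP_mul isOpen_Ioi (fun t (ht : -a < t) => by linarith)
    (monogenic_chiP_mul g)

lemma memHardy_minusPart (hg : WeightedL2 a g) : MemHardy (Iio a) (minusPart g) :=
  memHardy_expSynth hg.chiM_mul isOpen_Iio (fun t (ht : t < a) => by linarith)
    (monogenic_chiM_mul g)

/-- Inserting `1 = χ_+ + χ_-` splits the formula into pieces that extend to the two half-spaces.
This serves both the converse half of the characterization and the existence of the decomposition.
-/
lemma represents_plusPart_add_minusPart (hg : WeightedL2 a g) :
    Represents a g (plusPart g + minusPart g) := by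
  intro x hx
  have h1 := integrable_cexp_phase_smul (σ := -1) hg.chiP_mul (x := x) (by linarith [hx.1.1])
  have h2 := integrable_cexp_phase_smul (σ := 1) hg.chiM_mul (x := x) (by linarith [hx.1.2])
  have h3 : (fun ξ => monoExp x ξ * g ξ) = fun ξ =>
      Complex.exp (phase (-1) ξ x) • (chiP ξ * g ξ) + Complex.exp (phase 1 ξ x) • (chiM ξ * g ξ) := by
    ext1 ξ
    rw [monoExp, eP_eq_cexp_phase, eM_eq_cexp_phase, add_mul, smul_mul_assoc, smul_mul_assoc]
  rw [h3]
  refine ⟨h1.add h2, ?_⟩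
  rw [integral_add h1 h2, smul_add]
  rfl

lemma Ioo_subset_Ioi : Ioo (-a) a ⊆ Ioi (-a) := fun _ h => h.1

lemma Ioo_subset_Iio : Ioo (-a) a ⊆ Iio a := fun _ h => h.2

lemma Represents.eqOn {F G : ℝ × E m → Cl m} (hF : Represents a g F) (hG : Represents a g G) :
    EqOn F G (slab m (Ioo (-a) a)) := fun x hx => by rw [(hF x hx).2, (hG x hx).2]

lemma Represents.memHardy {F : ℝ × E m → Cl m} (hF : Represents a g F) (hg : WeightedL2 a g) :
    MemHardy (Ioo (-a) a) F :=
  (((memHardy_plusPart hg).mono Ioo_subset_Ioi).add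
    ((memHardy_minusPart hg).mono Ioo_subset_Iio) isOpen_Ioo).congr isOpen_Ioo
      (hF.eqOn (represents_plusPart_add_minusPart hg))

lemma Represents.slice {F : ℝ × E m → Cl m} (hF : Represents a g F) {t : ℝ}
    (ht : t ∈ Ioo (-a) a) (v : E m) : F (t, v) = synth (fun ξ => monoExp (t, 0) ξ * g ξ) v := by
  rw [(hF (t, v) ⟨ht, trivial⟩).2, synth]
  congr 2
  ext1 ξ
  rw [monoExp_eq_cexp_smul, smul_mul_assoc]

end

/-! ### Hölder's inequality for the Clifford product -/

section Hoelder

variable {u f : E m → Cl m}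

lemma integrable_mul_of_memLp (hu : MemLp u 2) (hf : MemLp f 2) :
    Integrable fun v => u v * f v := by
  have h := (mulL : Cl m →L[ℂ] _).memLp_of_bilin (r := 1) hu hf
  exact memLp_one_iff_integrable.1 h

lemma enorm_integral_mul_le (hu : MemLp u 2) (hf : MemLp f 2) :
    ‖∫ v, u v * f v‖ₑ ≤ ‖(mulL : Cl m →L[ℂ] _)‖₊ * eLpNorm u 2 volume * eLpNorm f 2 volume := by
  refine (enorm_integral_le_lintegral_enorm _).trans ?_
  rw [← eLpNorm_one_eq_lintegral_enorm]
  exact eLpNorm_le_eLpNorm_mul_eLpNorm'_of_norm hu.1 hf.1 (fun x y => x * y) _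
    (Filter.Eventually.of_forall fun v => norm_mul_le_mulL _ _)

end Hoelder

/-! ### Pairing slices of a Hardy function with test functions -/

/-- The symbol `∑ ∂_k ψ e_k` of a scalar function `ψ`. -/
def gradSymbol (ψ : E m → ℂ) (v : E m) : Cl m :=
  ∑ k, fderiv ℝ ψ v (EuclideanSpace.single k 1) • gen k

lemma gradSymbol_eq (ψ : E m → ℂ) (v : E m) (y : Cl m) :
    gradSymbol ψ v * y = ∑ k, gen k * fderiv ℝ ψ v (EuclideanSpace.single k 1) • y := by
  simp [gradSymbol, Finset.sum_mul]

section Pairing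

variable {I : Set ℝ} {F : ℝ × E m → Cl m} {ψ : E m → ℂ}

/-- Differentiate under the integral, replace `∂_0 F` by `-∑ e_k ∂_k F`, and integrate by parts. The
support of `ψ` is compact because the derivatives of `F` are controlled only locally. -/
lemma hasDerivAt_pairing_of_hasCompactSupport (hI : IsOpen I) (hF : MemHardy I F)
    (hψ : ContDiff ℝ 1 ψ) (hc : HasCompactSupport ψ) {t : ℝ} (ht : t ∈ I) :
    HasDerivAt (fun t => ∫ v, ψ v • F (t, v)) (∫ v, gradSymbol ψ v * F (t, v)) t := by
  obtain ⟨ε, hε, hεI⟩ := Metric.nhds_basis_closedBall.mem_iff.1 (hI.mem_nhds ht)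
  have hslab : ∀ s ∈ I, ∀ v : E m, ((s, v) : ℝ × E m) ∈ slab m I := fun s hs v => ⟨hs, trivial⟩
  have hdiff : ∀ s ∈ I, ∀ v : E m, HasFDerivAt F (fderiv ℝ F (s, v)) (s, v) :=
    fun s hs v => (hF.differentiableAt hI (hslab s hs v)).hasFDerivAt
  have hcont : ContinuousOn (fderiv ℝ F) (slab m I) :=
    hF.1.1.continuousOn_fderiv_of_isOpen (isOpen_slab hI) le_rfl
  have hcont2 : ∀ s ∈ I, Continuous fun v : E m => fderiv ℝ F (s, v) := fun s hs =>
    hcont.comp_continuous (by fun_prop) fun v => hslab s hs v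
  -- `C` bounds the full derivative of `F` on the compact product of a time interval and the support
  -- of `ψ`; it supplies the dominating function.
  obtain ⟨C, hC⟩ := ((isCompact_closedBall t ε).prod hc.isCompact).exists_bound_of_continuousOn
    (hcont.mono (prod_mono hεI (subset_univ (tsupport ψ))))
  have hint : ∀ (φ : E m → ℂ) (G : E m → Cl m), Continuous φ → HasCompactSupport φ → Continuous G →
      Integrable fun v => φ v • G v := fun φ G h1 h2 h3 =>
    (h1.smul h3).integrable_of_hasCompactSupport h2.smul_right
  have hderiv := hasDerivAt_integral_of_dominated_loc_of_deriv_le (μ := (volume : Measure (E m)))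
    (F := fun s v => ψ v • F (s, v)) (F' := fun s v => ψ v • fderiv ℝ F (s, v) (1, 0)) (x₀ := t)
    (bound := fun v => ‖ψ v‖ * (C * ‖((1, 0) : ℝ × E m)‖)) (s := Metric.closedBall t ε)
    (Metric.closedBall_mem_nhds t hε) ?_
    (hint _ _ hψ.continuous hc (hF.continuous_slice ht))
    (hint _ _ hψ.continuous hc ((hcont2 t ht).clm_apply continuous_const)).aestronglyMeasurable ?_
    ((hψ.continuous.integrable_of_hasCompactSupport hc).norm.mul_const _) ?_
  · refine hderiv.2.congr_deriv ?_
    have hdirac : ∀ v, fderiv ℝ F (t, v) (1, 0) =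
        -∑ k, gen k * fderiv ℝ F (t, v) (0, EuclideanSpace.single k 1) := fun v =>
      eq_neg_of_add_eq_zero_left (hF.1.2 (t, v) (hslab t ht v))
    have hparts : ∀ k : Fin m, ∫ v, ψ v • fderiv ℝ F (t, v) (0, EuclideanSpace.single k 1) =
        -∫ v, fderiv ℝ ψ v (EuclideanSpace.single k 1) • F (t, v) := by
      intro k
      have hslice : ∀ v, HasFDerivAt (fun v : E m => F (t, v))
          ((fderiv ℝ F (t, v)).comp (ContinuousLinearMap.inr ℝ ℝ (E m))) v := fun v =>
        (hdiff t ht v).comp v (hasFDerivAt_prodMk_right t v)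
      refine integral_bilinear_hasFDerivAt_right_eq_neg_left_of_integrable
        (B := (ContinuousLinearMap.lsmul ℝ ℂ : ℂ →L[ℝ] Cl m →L[ℝ] Cl m)) (f := ψ)
        (f' := fderiv ℝ ψ) (g := fun v => F (t, v))
        (g' := fun v => (fderiv ℝ F (t, v)).comp (ContinuousLinearMap.inr ℝ ℝ (E m)))
        (v := EuclideanSpace.single k 1) ?_ ?_ ?_
        (fun v _ => (hψ.differentiable one_ne_zero v).hasFDerivAt) fun v _ => hslice v
      · exact hint _ _ ((hψ.continuous_fderiv one_ne_zero).clm_apply continuous_const)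
          (hc.fderiv_apply ℝ _) (hF.continuous_slice ht)
      · exact hint _ _ hψ.continuous hc ((hcont2 t ht).clm_apply continuous_const)
      · exact hint _ _ hψ.continuous hc (hF.continuous_slice ht)
    have hint2 : ∀ k : Fin m,
        Integrable fun v => ψ v • fderiv ℝ F (t, v) (0, EuclideanSpace.single k 1) := fun k =>
      hint _ _ hψ.continuous hc ((hcont2 t ht).clm_apply continuous_const)
    have hint3 : ∀ k : Fin m,
        Integrable fun v => fderiv ℝ ψ v (EuclideanSpace.single k 1) • F (t, v) := fun k =>
      hint _ _ ((hψ.continuous_fderiv one_ne_zero).clm_apply continuous_const)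
        (hc.fderiv_apply ℝ _) (hF.continuous_slice ht)
    calc ∫ v, ψ v • fderiv ℝ F (t, v) (1, 0)
        = ∫ v, -∑ k, mulLeft (gen k) (ψ v • fderiv ℝ F (t, v) (0, EuclideanSpace.single k 1)) := by
          refine integral_congr_ae (Filter.Eventually.of_forall fun v => ?_)
          simp [hdirac v, Finset.smul_sum]
      _ = ∑ k, mulLeft (gen k) (∫ v, fderiv ℝ ψ v (EuclideanSpace.single k 1) • F (t, v)) := by
          rw [integral_neg, integral_finsetSum _ fun k _ => (mulLeft (gen k)).integrable_comp (hint2 k),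
            ← Finset.sum_neg_distrib]
          refine Finset.sum_congr rfl fun k _ => ?_
          rw [(mulLeft (gen k)).integral_comp_comm (hint2 k), hparts k, map_neg, neg_neg]
      _ = ∫ v, gradSymbol ψ v * F (t, v) := by
          simp_rw [gradSymbol_eq, ← mulLeft_apply]
          rw [integral_finsetSum _ fun k _ => (mulLeft (gen k)).integrable_comp (hint3 k)]
          exact Finset.sum_congr rfl fun k _ => ((mulLeft (gen k)).integral_comp_comm (hint3 k)).symm
  · filter_upwards [Metric.closedBall_mem_nhds t hε] with s hs
    exact (hint _ _ hψ.continuous hc (hF.continuous_slice (hεI hs))).aestronglyMeasurable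
  · refine Filter.Eventually.of_forall fun v s hs => ?_
    rw [norm_smul]
    by_cases hv : v ∈ tsupport ψ
    · gcongr
      exact ((fderiv ℝ F (s, v)).le_opNorm _).trans (by gcongr; exact hC (s, v) ⟨hs, hv⟩)
    · rw [image_eq_zero_of_notMem_tsupport hv]; simp
  · refine Filter.Eventually.of_forall fun v s hs => ?_
    have h1 : HasDerivAt (fun s : ℝ => ((s, v) : ℝ × E m)) (1, 0) s :=
      (hasDerivAt_id s).prodMk (hasDerivAt_const s v)
    exact ((hdiff s (hεI hs) v).comp_hasDerivAt s h1).const_smul (ψ v)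

/-- A smooth cutoff function at scale `n + 1`. -/
def cutoff (m n : ℕ) (v : E m) : ℝ :=
  (⟨1, 2, one_pos, one_lt_two⟩ : ContDiffBump (0 : E m)) ((1 / ((n : ℝ) + 1)) • v)

lemma contDiff_cutoff (n : ℕ) : ContDiff ℝ 1 (cutoff m n) :=
  (ContDiffBump.contDiff _).comp (contDiff_const_smul _)

lemma hasCompactSupport_cutoff (n : ℕ) : HasCompactSupport (cutoff m n) := by
  have h0 : (1 / ((n : ℝ) + 1)) ≠ 0 := by positivity
  exact (ContDiffBump.hasCompactSupport _).comp_homeomorph (Homeomorph.smulOfNeZero _ h0)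

lemma norm_cutoff_le (n : ℕ) (v : E m) : ‖cutoff m n v‖ ≤ 1 := by
  rw [cutoff, Real.norm_of_nonneg (ContDiffBump.nonneg _)]
  exact ContDiffBump.le_one _

/-- Equality holds on a neighbourhood, not merely at `v`, so that derivatives of truncated functions
also stabilise. -/
lemma cutoff_eventuallyEq (v : E m) :
    ∀ᶠ n in Filter.atTop, cutoff m n =ᶠ[nhds v] fun _ => 1 := by
  obtain ⟨N, hN⟩ := exists_nat_gt ‖v‖
  filter_upwards [Filter.eventually_ge_atTop N] with n hn
  have h1 : ‖v‖ < (n : ℝ) + 1 := by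
    have : (N : ℝ) ≤ n := by exact_mod_cast hn
    linarith
  have h2 : ∀ᶠ w in nhds v, ‖w‖ < (n : ℝ) + 1 := continuous_norm.continuousAt.eventually_lt_const h1
  filter_upwards [h2] with w hw
  refine ContDiffBump.one_of_mem_closedBall _ ?_
  rw [mem_closedBall_zero_iff, norm_smul, Real.norm_of_nonneg (by positivity),
    one_div, inv_mul_le_iff₀ (by positivity)]
  simpa using hw.le

/-- Dilation multiplies the derivative of the bump by `1/(n+1) ≤ 1`, so one constant serves all `n`.
-/
lemma exists_norm_fderiv_cutoff_le (m : ℕ) : ∃ C, 0 ≤ C ∧ ∀ n v, ‖fderiv ℝ (cutoff m n) v‖ ≤ C := by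
  set χ : ContDiffBump (0 : E m) := ⟨1, 2, one_pos, one_lt_two⟩ with hχ
  obtain ⟨C, hC⟩ := ((χ.contDiff (n := 1)).continuous_fderiv one_ne_zero).bounded_above_of_compact_support
    (χ.hasCompactSupport.fderiv ℝ)
  refine ⟨C, (norm_nonneg _).trans (hC 0), fun n v => ?_⟩
  have h1 : fderiv ℝ (cutoff m n) v = (1 / ((n : ℝ) + 1)) • fderiv ℝ χ ((1 / ((n : ℝ) + 1)) • v) :=
    fderiv_comp_smul ..
  rw [h1, norm_smul, Real.norm_of_nonneg (by positivity)]
  refine (mul_le_of_le_one_left (norm_nonneg _) ?_).trans (hC _)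
  rw [div_le_one (by positivity)]
  linarith [(Nat.cast_nonneg n : (0 : ℝ) ≤ n)]

end Pairing

/-! ### From compactly supported to Schwartz test functions. -/

lemma norm_gen (k : Fin m) : ‖gen k‖ = 1 := by
  have h : vec (EuclideanSpace.single k (1 : ℝ)) = gen k := by
    rw [vec, Finset.sum_eq_single k]
    · simp
    · intro j _ hj; simp [hj]
    · simp
  rw [← h, norm_vec]; simp

lemma norm_gradSymbol_sub_le (ψ φ : E m → ℂ) (v : E m) :
    ‖gradSymbol ψ v - gradSymbol φ v‖ ≤ m * ‖fderiv ℝ ψ v - fderiv ℝ φ v‖ := by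
  have h : gradSymbol ψ v - gradSymbol φ v =
      ∑ k, (fderiv ℝ ψ v - fderiv ℝ φ v) (EuclideanSpace.single k 1) • gen k := by
    simp [gradSymbol, sub_smul, Finset.sum_sub_distrib]
  rw [h]
  refine (norm_sum_le _ _).trans ?_
  have h2 : ∀ k ∈ (Finset.univ : Finset (Fin m)),
      ‖(fderiv ℝ ψ v - fderiv ℝ φ v) (EuclideanSpace.single k 1) • gen k‖ ≤
        ‖fderiv ℝ ψ v - fderiv ℝ φ v‖ := fun k _ => by
    rw [norm_smul, norm_gen, mul_one]
    refine ((fderiv ℝ ψ v - fderiv ℝ φ v).le_opNorm _).trans ?_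
    simp
  refine (Finset.sum_le_sum h2).trans ?_
  simp

lemma continuous_gradSymbol {ψ : E m → ℂ} (hψ : ContDiff ℝ 1 ψ) : Continuous (gradSymbol ψ) :=
  continuous_finsetSum _ fun _ _ =>
    ((hψ.continuous_fderiv one_ne_zero).clm_apply continuous_const).smul continuous_const

lemma tendsto_eLpNorm_two_zero {u : ℕ → E m → Cl m} {b : E m → ℝ} (hu : ∀ n, Continuous (u n))
    (hub : ∀ n v, ‖u n v‖ ≤ b v) (hb : MemLp b 2) (h0 : ∀ v, ∀ᶠ n in Filter.atTop, u n v = 0) :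
    Filter.Tendsto (fun n => eLpNorm (u n) 2 volume) Filter.atTop (nhds 0) := by
  have h1 : Filter.Tendsto (fun n => eLpNorm (u n) 2 volume ^ 2) Filter.atTop (nhds 0) := by
    simp_rw [eLpNorm_two_sq]
    have h2 := tendsto_lintegral_of_dominated_convergence (μ := (volume : Measure (E m)))
      (F := fun n v => ‖u n v‖ₑ ^ 2) (f := fun _ => 0) (fun v => ‖b v‖ₑ ^ 2)
      (fun n => (hu n).enorm.measurable.pow_const 2) ?_ ?_ ?_
    · simpa using h2
    · refine fun n => Filter.Eventually.of_forall fun v => pow_le_pow_left' ?_ 2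
      rw [enorm_le_iff_norm_le]
      exact (hub n v).trans (le_abs_self _)
    · exact ((memLp_two_iff_lintegral_lt_top hb.1).1 hb).ne
    · refine Filter.Eventually.of_forall fun v => tendsto_const_nhds.congr' ?_
      filter_upwards [h0 v] with n hn
      simp [hn]
  have h3 := (ENNReal.continuous_rpow_const (y := (1 / 2 : ℝ))).continuousAt.tendsto.comp h1
  rw [ENNReal.zero_rpow_of_pos (by norm_num)] at h3
  refine h3.congr fun n => ?_
  simp only [Function.comp_apply]
  rw [← ENNReal.rpow_natCast, ← ENNReal.rpow_mul]
  norm_num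

section

variable {I : Set ℝ} {F : ℝ × E m → Cl m}

lemma MemHardy.eLpNorm_slice_le (hF : MemHardy I F) {t : ℝ} (ht : t ∈ I) :
    eLpNorm (fun v : E m => F (t, v)) 2 volume ≤
      (⨆ t ∈ I, ∫⁻ v : E m, ‖F (t, v)‖ₑ ^ 2) ^ (1 / 2 : ℝ) := by
  have h1 : (eLpNorm (fun v : E m => F (t, v)) 2 volume ^ 2) ^ (1 / 2 : ℝ) ≤
      (⨆ t ∈ I, ∫⁻ v : E m, ‖F (t, v)‖ₑ ^ 2) ^ (1 / 2 : ℝ) := by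
    rw [eLpNorm_two_sq]
    exact ENNReal.rpow_le_rpow (hF.lintegral_slice_le ht) (by norm_num)
  rw [← ENNReal.rpow_natCast, ← ENNReal.rpow_mul] at h1
  norm_num at h1
  norm_num
  exact h1

lemma memLp_gradSymbol_schwartz (ψ : SchwartzMap (E m) ℂ) : MemLp (gradSymbol ψ) 2 := by
  refine memLp_finsetSum _ fun k _ => ?_
  have h1 : MemLp (fun v => fderiv ℝ ψ v (EuclideanSpace.single k 1)) 2 := by
    refine (memLp_congr_ae (Filter.Eventually.of_forall fun v => ?_)).1
      ((LineDeriv.lineDerivOp (EuclideanSpace.single k (1 : ℝ)) ψ).memLp 2)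
    exact SchwartzMap.lineDerivOp_apply_eq_fderiv _ _ _
  have h2 : AEStronglyMeasurable (fun v => fderiv ℝ ψ v (EuclideanSpace.single k 1) • gen k) volume :=
    h1.1.smul aestronglyMeasurable_const
  refine MemLp.of_le h1 h2 (Filter.Eventually.of_forall fun v => ?_)
  rw [norm_smul, norm_gen, mul_one]

/-- The pairing of a slice with a Schwartz function is differentiable, and the Dirac equation turns
its derivative into a pairing with the gradient. -/
lemma hasDerivAt_pairing_schwartz (hI : IsOpen I) (hF : MemHardy I F) (ψ : SchwartzMap (E m) ℂ)
    {t : ℝ} (ht : t ∈ I) :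
    HasDerivAt (fun t => ∫ v, ψ v • F (t, v)) (∫ v, gradSymbol ψ v * F (t, v)) t := by
  set ψc : ℕ → E m → ℂ := fun n v => cutoff m n v • ψ v with hψc
  have hψ1 : ContDiff ℝ 1 ψ := ψ.smooth 1
  have hψc1 : ∀ n, ContDiff ℝ 1 (ψc n) := fun n => (contDiff_cutoff n).smul hψ1
  have hψc2 : ∀ n, HasCompactSupport (ψc n) := fun n => (hasCompactSupport_cutoff n).smul_right
  have hev : ∀ v, ∀ᶠ n in Filter.atTop, ψc n =ᶠ[nhds v] ψ := fun v => by
    filter_upwards [cutoff_eventuallyEq v] with n hn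
    filter_upwards [hn] with w hw
    simp [hψc, hw]
  obtain ⟨C, hC0, hC⟩ := exists_norm_fderiv_cutoff_le m
  have hdiff : ∀ n v, ‖fderiv ℝ (ψc n) v - fderiv ℝ ψ v‖ ≤ C * ‖ψ v‖ + 2 * ‖fderiv ℝ ψ v‖ := by
    intro n v
    have h1 : fderiv ℝ (ψc n) v =
        cutoff m n v • fderiv ℝ ψ v + (fderiv ℝ (cutoff m n) v).smulRight (ψ v) :=
      fderiv_fun_smul ((contDiff_cutoff n).differentiable one_ne_zero v)
        (hψ1.differentiable one_ne_zero v)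
    have h2 : ‖cutoff m n v • fderiv ℝ ψ v‖ ≤ ‖fderiv ℝ ψ v‖ := by
      rw [norm_smul]; exact mul_le_of_le_one_left (norm_nonneg _) (norm_cutoff_le n v)
    have h3 : ‖(fderiv ℝ (cutoff m n) v).smulRight (ψ v)‖ ≤ C * ‖ψ v‖ := by
      rw [ContinuousLinearMap.norm_smulRight_apply]; gcongr; exact hC n v
    rw [h1]
    refine (norm_sub_le _ _).trans ?_
    have := norm_add_le (cutoff m n v • fderiv ℝ ψ v)
      ((fderiv ℝ (cutoff m n) v).smulRight (ψ v))
    linarith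
  set b : E m → ℝ := fun v => m * (C * ‖ψ v‖ + 2 * ‖fderiv ℝ ψ v‖) with hb
  have hbL : MemLp b 2 := by
    have h1 : MemLp (fun v => ‖fderiv ℝ ψ v‖) 2 :=
      ((SchwartzMap.fderivCLM ℝ (E m) ℂ ψ).memLp 2 volume).norm
    exact (((ψ.memLp 2).norm.const_mul C).add (h1.const_mul 2)).const_mul (m : ℝ)
  set u : ℕ → E m → Cl m := fun n v => gradSymbol (ψc n) v - gradSymbol ψ v with hu
  have hucont : ∀ n, Continuous (u n) := fun n =>
    (continuous_gradSymbol (hψc1 n)).sub (continuous_gradSymbol hψ1)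
  have hub : ∀ n v, ‖u n v‖ ≤ b v := fun n v =>
    (norm_gradSymbol_sub_le _ _ v).trans (mul_le_mul_of_nonneg_left (hdiff n v) (Nat.cast_nonneg m))
  have hu0 : ∀ v, ∀ᶠ n in Filter.atTop, u n v = 0 := fun v => by
    filter_upwards [hev v] with n hn
    simp only [hu, gradSymbol, hn.fderiv_eq, sub_self]
  have huL : ∀ n, MemLp (u n) 2 := fun n =>
    MemLp.of_le hbL (hucont n).aestronglyMeasurable (Filter.Eventually.of_forall fun v =>
      (hub n v).trans (le_abs_self _))
  have hgL := memLp_gradSymbol_schwartz ψ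
  have hlim := tendsto_eLpNorm_two_zero hucont hub hbL hu0
  set M : ℝ≥0∞ := (⨆ t ∈ I, ∫⁻ v : E m, ‖F (t, v)‖ₑ ^ 2) ^ (1 / 2 : ℝ) with hM
  have hMtop : M ≠ ∞ := ENNReal.rpow_ne_top_of_nonneg (by norm_num) hF.2.ne
  -- The truncated pairings converge pointwise. Their derivatives converge uniformly in `t ∈ I`:
  -- Hölder bounds the error by the `L²` norm of `u n`, which tends to zero, times the slice bound
  -- `M`, which does not depend on `t`.
  refine hasDerivAt_of_tendstoUniformlyOn (l := Filter.atTop) (s := I)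
    (f := fun n t => ∫ v, ψc n v • F (t, v))
    (f' := fun n t => ∫ v, gradSymbol (ψc n) v * F (t, v))
    (g := fun t => ∫ v, ψ v • F (t, v)) (g' := fun t => ∫ v, gradSymbol ψ v * F (t, v)) hI ?_
    (Filter.Eventually.of_forall fun n s hs =>
      hasDerivAt_pairing_of_hasCompactSupport hI hF (hψc1 n) (hψc2 n) hs) ?_ ht
  · rw [EMetric.tendstoUniformlyOn_iff]
    intro ε hε
    have hlim2 : Filter.Tendsto (fun n => (‖(mulL : Cl m →L[ℂ] _)‖₊ : ℝ≥0∞) *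
        eLpNorm (u n) 2 volume * M) Filter.atTop (nhds 0) := by
      have := ENNReal.Tendsto.mul_const (ENNReal.Tendsto.const_mul hlim
        (Or.inr (ENNReal.coe_ne_top (r := ‖(mulL : Cl m →L[ℂ] _)‖₊)))) (Or.inr hMtop)
      simpa using this
    filter_upwards [hlim2.eventually_lt_const hε] with n hn s hs
    refine lt_of_le_of_lt ?_ hn
    have hFs := hF.memLp_slice hs
    have hsplit : (∫ v, gradSymbol (ψc n) v * F (s, v)) =
        (∫ v, gradSymbol ψ v * F (s, v)) + ∫ v, u n v * F (s, v) := by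
      rw [← integral_add (integrable_mul_of_memLp hgL hFs) (integrable_mul_of_memLp (huL n) hFs)]
      refine integral_congr_ae (Filter.Eventually.of_forall fun v => ?_)
      simp only [hu, ← add_mul, add_sub_cancel]
    rw [edist_comm, edist_eq_enorm_sub, hsplit, add_sub_cancel_left]
    refine (enorm_integral_mul_le (huL n) hFs).trans ?_
    gcongr
    exact hF.eLpNorm_slice_le hs
  · intro s hs
    have hFs := hF.memLp_slice hs
    refine tendsto_integral_of_dominated_convergence (fun v => ‖ψ v‖ * ‖F (s, v)‖)
      (fun n => ((hψc1 n).continuous.smul (hF.continuous_slice hs)).aestronglyMeasurable)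
      (MemLp.integrable_mul (p := 2) (q := 2) (ψ.memLp 2).norm hFs.norm) (fun n => ?_) ?_
    · refine Filter.Eventually.of_forall fun v => ?_
      rw [norm_smul]
      gcongr
      simp only [hψc, norm_smul]
      exact mul_le_of_le_one_left (norm_nonneg _) (norm_cutoff_le n v)
    · refine Filter.Eventually.of_forall fun v => tendsto_const_nhds.congr' ?_
      filter_upwards [hev v] with n hn
      rw [hn.eq_of_nhds]

end

/-! ### Propagation of the Fourier transforms of the slices -/

open Classical in
/-- The slice `F(t, ·)` as an element of `L²` (zero if it is not square integrable). -/
def sliceL2 (F : ℝ × E m → Cl m) (t : ℝ) : L2 m :=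
  if h : MemLp (fun v : E m => F (t, v)) 2 volume then h.toLp else 0

/-- Multiplication of a Schwartz function by `-2πi η_k`. -/
def coordMul (k : Fin m) (φ : SchwartzMap (E m) ℂ) : SchwartzMap (E m) ℂ :=
  -(2 * Real.pi * Complex.I) •
    SchwartzMap.smulLeftCLM ℂ (fun x : E m => inner ℝ x (EuclideanSpace.single k (1 : ℝ))) φ

lemma coordMul_apply (k : Fin m) (φ : SchwartzMap (E m) ℂ) (η : E m) :
    coordMul k φ η = -(2 * Real.pi * Complex.I * η k) * φ η := by
  have h : Function.HasTemperateGrowth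
      fun x : E m => inner ℝ x (EuclideanSpace.single k (1 : ℝ)) := by fun_prop
  rw [coordMul, smul_apply, SchwartzMap.smulLeftCLM_apply_apply h, EuclideanSpace.inner_single_right]
  simp
  ring

/-- The pairing of the Fourier transform of a slice with a test function. -/
def fourierPairing (F : ℝ × E m → Cl m) (φ : SchwartzMap (E m) ℂ) (t : ℝ) : Cl m :=
  ∫ η, φ η • ((𝓕 (sliceL2 F t) : L2 m) : E m → Cl m) η

/-- The iterated derivatives of `fourierPairing` in `t`. -/
def iterPairing (F : ℝ × E m → Cl m) : ℕ → SchwartzMap (E m) ℂ → ℝ → Cl m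
  | 0, φ, t => fourierPairing F φ t
  | n + 1, φ, t => ∑ k, gen k * iterPairing F n (coordMul k φ) t

/-- The symbol `-2πi η` of the operator `-∑ e_k ∂_k`. -/
def diracSymbol (η : E m) : Cl m := -(Complex.I • vec ((2 * Real.pi) • η))

lemma continuous_diracSymbol : Continuous (diracSymbol : E m → Cl m) :=
  ((continuous_vec.comp (continuous_const_smul _)).const_smul Complex.I).neg

/-- Each factor acts by `∓|2πη|` on `χ_±`, and the empty product is `χ_+ + χ_- = 1`. Idempotence is
not used, so `η = 0` needs no separate treatment. -/
lemma diracSymbol_pow (η : E m) (n : ℕ) :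
    diracSymbol η ^ n = ((-‖(2 * Real.pi) • η‖) ^ n) • chiP ((2 * Real.pi) • η) +
      (‖(2 * Real.pi) • η‖ ^ n) • chiM ((2 * Real.pi) • η) := by
  induction n with
  | zero => simp [chiP_add_chiM]
  | succ n ih =>
    rw [pow_succ', ih, diracSymbol, neg_mul, mul_add, mul_smul_comm, mul_smul_comm,
      I_smul_vec_mul_chiP, I_smul_vec_mul_chiM, ← Complex.coe_smul, ← Complex.coe_smul,
      ← Complex.coe_smul, ← Complex.coe_smul]
    push_cast
    module

section

variable {I : Set ℝ} {F : ℝ × E m → Cl m}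

lemma MemHardy.sliceL2_ae_eq (hF : MemHardy I F) {t : ℝ} (ht : t ∈ I) :
    (sliceL2 F t : E m → Cl m) =ᵐ[volume] fun v => F (t, v) := by
  rw [sliceL2, dif_pos (hF.memLp_slice ht)]
  exact (hF.memLp_slice ht).coeFn_toLp

lemma MemHardy.fourierPairing_eq (hF : MemHardy I F) (φ : SchwartzMap (E m) ℂ) {t : ℝ}
    (ht : t ∈ I) : fourierPairing F φ t = ∫ v, (𝓕 φ) v • F (t, v) := by
  rw [fourierPairing, integral_schwartz_smul_fourier]
  refine integral_congr_ae ?_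
  filter_upwards [hF.sliceL2_ae_eq ht] with v hv
  rw [hv]

lemma integrable_schwartz_smul (φ : SchwartzMap (E m) ℂ) {f : E m → Cl m} (hf : MemLp f 2) :
    Integrable fun v => φ v • f v :=
  memLp_one_iff_integrable.1 (MemLp.smul (p := 2) (q := 2) (r := 1) hf (φ.memLp 2 volume))

/-- Derivatives of `𝓕 φ` are transforms of `φ` multiplied by `-2πi η_k`; hence the evolution
equation acts on the frequency side by multiplying the test function. -/
lemma MemHardy.hasDerivAt_fourierPairing (hI : IsOpen I) (hF : MemHardy I F)
    (φ : SchwartzMap (E m) ℂ) {t : ℝ} (ht : t ∈ I) :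
    HasDerivAt (fourierPairing F φ) (∑ k, gen k * fourierPairing F (coordMul k φ) t) t := by
  have h1 := hasDerivAt_pairing_schwartz hI hF (𝓕 φ) ht
  refine (h1.congr_deriv ?_).congr_of_eventuallyEq ?_
  · have hk : ∀ (k : Fin m) v, fderiv ℝ (𝓕 φ : SchwartzMap (E m) ℂ) v (EuclideanSpace.single k 1) =
        (𝓕 (coordMul k φ)) v := fun k v => by
      rw [← SchwartzMap.lineDerivOp_apply_eq_fderiv, SchwartzMap.lineDerivOp_fourier_eq]
      rfl
    simp_rw [gradSymbol_eq, hk, ← mulLeft_apply]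
    have hint : ∀ k : Fin m, Integrable fun v => (𝓕 (coordMul k φ)) v • F (t, v) := fun k =>
      integrable_schwartz_smul _ (hF.memLp_slice ht)
    rw [integral_finsetSum _ fun k _ => (mulLeft (gen k)).integrable_comp (hint k)]
    refine Finset.sum_congr rfl fun k _ => ?_
    rw [(mulLeft (gen k)).integral_comp_comm (hint k), hF.fourierPairing_eq _ ht]
  · filter_upwards [hI.mem_nhds ht] with s hs
    exact hF.fourierPairing_eq φ hs

lemma MemHardy.hasDerivAt_iterPairing (hI : IsOpen I) (hF : MemHardy I F) (n : ℕ) :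
    ∀ (φ : SchwartzMap (E m) ℂ) {t : ℝ}, t ∈ I →
      HasDerivAt (iterPairing F n φ) (iterPairing F (n + 1) φ t) t := by
  induction n with
  | zero => exact fun φ t ht => hF.hasDerivAt_fourierPairing hI φ ht
  | succ n ih =>
    intro φ t ht
    have h1 := HasDerivAt.fun_sum (u := Finset.univ) (A := fun k s => mulLeft (gen k)
      (iterPairing F n (coordMul k φ) s)) fun k _ =>
        (mulLeft (gen k)).hasFDerivAt.comp_hasDerivAt t (ih (coordMul k φ) ht)
    exact h1

lemma integrable_smul_diracSymbol_pow_mul {φ : SchwartzMap (E m) ℂ} (hφ : HasCompactSupport φ)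
    (n : ℕ) {f : E m → Cl m} (hf : MemLp f 2) :
    Integrable fun η => φ η • (diracSymbol η ^ n * f η) := by
  have h1 : MemLp (fun η => φ η • diracSymbol η ^ n) 2 :=
    (φ.continuous.smul (continuous_diracSymbol.pow n)).memLp_of_hasCompactSupport hφ.smul_right
  simpa only [smul_mul_assoc] using integrable_mul_of_memLp h1 hf

lemma hasCompactSupport_coordMul {φ : SchwartzMap (E m) ℂ} (hφ : HasCompactSupport φ) (k : Fin m) :
    HasCompactSupport (coordMul k φ) := by
  refine hφ.mono fun η hη h0 => hη ?_
  rw [coordMul_apply, h0, mul_zero]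

/-- Each derivative contributes `∑ e_k (-2πi η_k)`, which is one factor of the Dirac symbol.
Multiplication by coordinates preserves compact support, so the induction can run over all such `φ`.
-/
lemma iterPairing_eq (t : ℝ) (n : ℕ) : ∀ φ : SchwartzMap (E m) ℂ, HasCompactSupport φ →
    iterPairing F n φ t =
      ∫ η, φ η • (diracSymbol η ^ n * ((𝓕 (sliceL2 F t) : L2 m) : E m → Cl m) η) := by
  induction n with
  | zero => intro φ _; simp [iterPairing, fourierPairing]
  | succ n ih =>
    intro φ hφ
    have hint : ∀ k : Fin m, Integrable fun η => coordMul k φ η • (diracSymbol η ^ n *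
        ((𝓕 (sliceL2 F t) : L2 m) : E m → Cl m) η) := fun k =>
      integrable_smul_diracSymbol_pow_mul (hasCompactSupport_coordMul hφ k) n (Lp.memLp _)
    have h1 : ∀ k : Fin m, gen k * iterPairing F n (coordMul k φ) t =
        ∫ η, mulLeft (gen k) (coordMul k φ η • (diracSymbol η ^ n *
          ((𝓕 (sliceL2 F t) : L2 m) : E m → Cl m) η)) := fun k => by
      rw [(mulLeft (gen k)).integral_comp_comm (hint k), ih _ (hasCompactSupport_coordMul hφ k)]
      rfl
    rw [iterPairing, Finset.sum_congr rfl fun k _ => h1 k,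
      ← integral_finsetSum _ fun k _ => (mulLeft (gen k)).integrable_comp (hint k)]
    refine integral_congr_ae (Filter.Eventually.of_forall fun η => ?_)
    have h2 : diracSymbol η = ∑ k, (-(2 * Real.pi * Complex.I * η k)) • gen k := by
      simp only [diracSymbol, vec, Finset.smul_sum, ← Finset.sum_neg_distrib, smul_smul,
        ← neg_smul]
      refine Finset.sum_congr rfl fun k _ => ?_
      congr 1
      simp
      ring
    simp only [pow_succ', mul_assoc]
    nth_rewrite 2 [h2]
    simp only [mulLeft_apply, coordMul_apply, mul_smul_comm, Finset.sum_mul, Finset.smul_sum,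
      smul_mul_assoc, smul_smul]
    exact Finset.sum_congr rfl fun k _ => by rw [mul_comm]

/-! ### Taylor expansion in `t` and summation to the monogenic exponential. -/

lemma hasDerivAt_taylor_term (n : ℕ) (t r : ℝ) :
    HasDerivAt (fun r => (t - r) ^ (n + 1) / (n + 1).factorial) (-((t - r) ^ n / n.factorial)) r := by
  have h1 := (((hasDerivAt_id r).const_sub t).fun_pow (n + 1)).div_const ((n + 1).factorial : ℝ)
  refine h1.congr_deriv ?_
  rw [Nat.factorial_succ]
  push_cast
  field_simp
  simp

/-- Taylor polynomials of `fourierPairing`. -/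
lemma MemHardy.hasDerivAt_taylor (hI : IsOpen I) (hF : MemHardy I F) (φ : SchwartzMap (E m) ℂ)
    (t : ℝ) (N : ℕ) {r : ℝ} (hr : r ∈ I) :
    HasDerivAt (fun r => ∑ n ∈ Finset.range (N + 1),
        ((t - r) ^ n / n.factorial) • iterPairing F n φ r)
      (((t - r) ^ N / N.factorial) • iterPairing F (N + 1) φ r) r := by
  induction N with
  | zero => simpa using hF.hasDerivAt_iterPairing hI 0 φ hr
  | succ N ih =>
    simp_rw [Finset.sum_range_succ _ (N + 1)]
    refine (ih.add ((hasDerivAt_taylor_term N t r).smul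
      (hF.hasDerivAt_iterPairing hI (N + 1) φ hr))).congr_deriv ?_
    module

end

open Filter in
lemma tendsto_real_exp_sum (x : ℝ) :
    Tendsto (fun N => ∑ n ∈ Finset.range (N + 1), x ^ n / n.factorial) atTop
      (nhds (Real.exp x)) := by
  rw [Real.exp_eq_exp_ℝ]
  exact (NormedSpace.expSeries_div_hasSum_exp x).tendsto_sum_nat.comp (tendsto_add_atTop_nat 1)

lemma abs_exp_sum_le (x : ℝ) (N : ℕ) :
    |∑ n ∈ Finset.range (N + 1), x ^ n / n.factorial| ≤ Real.exp |x| := by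
  refine (Finset.abs_sum_le_sum_abs _ _).trans ?_
  refine le_trans (le_of_eq ?_) (Real.sum_le_exp_of_nonneg (abs_nonneg x) (N + 1))
  exact Finset.sum_congr rfl fun n _ => by rw [abs_div, abs_pow, Nat.abs_cast]

lemma sum_diracSymbol_pow (τ : ℝ) (η : E m) (N : ℕ) :
    ∑ n ∈ Finset.range (N + 1), (τ ^ n / n.factorial) • diracSymbol η ^ n =
      (∑ n ∈ Finset.range (N + 1), (-τ * ‖(2 * Real.pi) • η‖) ^ n / n.factorial) •
          chiP ((2 * Real.pi) • η) +
        (∑ n ∈ Finset.range (N + 1), (τ * ‖(2 * Real.pi) • η‖) ^ n / n.factorial) •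
          chiM ((2 * Real.pi) • η) := by
  rw [Finset.sum_smul, Finset.sum_smul, ← Finset.sum_add_distrib]
  refine Finset.sum_congr rfl fun n _ => ?_
  rw [diracSymbol_pow, smul_add, smul_smul, smul_smul]
  congr 2
  · rw [div_mul_eq_mul_div, ← mul_pow, mul_neg, neg_mul]
  · rw [div_mul_eq_mul_div, ← mul_pow]

lemma monoExp_time (τ : ℝ) (ξ : E m) :
    monoExp (τ, 0) ξ = Real.exp (-τ * ‖ξ‖) • chiP ξ + Real.exp (τ * ‖ξ‖) • chiM ξ := by
  simp [monoExp, eP, eM, ← Complex.coe_smul]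

open Filter in
-- On each of `χ_±` the partial sums are those of a real exponential series, so `e(τ, ξ)` is the
-- exponential of `τ` times the symbol.
lemma tendsto_sum_diracSymbol_pow (τ : ℝ) (η : E m) :
    Tendsto (fun N => ∑ n ∈ Finset.range (N + 1), (τ ^ n / n.factorial) • diracSymbol η ^ n) atTop
      (nhds (monoExp (τ, 0) ((2 * Real.pi) • η))) := by
  simp_rw [sum_diracSymbol_pow, monoExp_time]
  exact ((tendsto_real_exp_sum _).smul_const _).add ((tendsto_real_exp_sum _).smul_const _)

lemma norm_sum_diracSymbol_pow_le (τ : ℝ) (η : E m) (N : ℕ) :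
    ‖∑ n ∈ Finset.range (N + 1), (τ ^ n / n.factorial) • diracSymbol η ^ n‖ ≤
      2 * Real.exp (|τ| * ‖(2 * Real.pi) • η‖) := by
  rw [sum_diracSymbol_pow]
  generalize (2 * Real.pi) • η = ξ
  refine (norm_add_le _ _).trans ?_
  rw [norm_smul, norm_smul, Real.norm_eq_abs, Real.norm_eq_abs, two_mul]
  have h1 := abs_exp_sum_le (-τ * ‖ξ‖) N
  have h2 := abs_exp_sum_le (τ * ‖ξ‖) N
  rw [abs_mul, abs_norm, abs_neg] at h1
  rw [abs_mul, abs_norm] at h2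
  exact add_le_add
    ((mul_le_of_le_one_right (abs_nonneg _) (norm_chiP_le _)).trans h1)
    ((mul_le_of_le_one_right (abs_nonneg _) (norm_chiM_le _)).trans h2)

lemma norm_diracSymbol_pow_le (η : E m) (n : ℕ) :
    ‖diracSymbol η ^ n‖ ≤ 2 * ‖(2 * Real.pi) • η‖ ^ n := by
  rw [diracSymbol_pow]
  generalize (2 * Real.pi) • η = ξ
  refine (norm_add_le _ _).trans ?_
  rw [norm_smul, norm_smul, norm_pow, norm_pow, norm_neg, norm_norm, two_mul]
  exact add_le_add
    (mul_le_of_le_one_right (by positivity) (norm_chiP_le _))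
    (mul_le_of_le_one_right (by positivity) (norm_chiM_le _))

lemma exists_radius_of_hasCompactSupport {φ : E m → ℂ} (hφ : HasCompactSupport φ) :
    ∃ R : ℝ, 0 ≤ R ∧ ∀ η, φ η ≠ 0 → ‖(2 * Real.pi) • η‖ ≤ R := by
  obtain ⟨r, hr⟩ := hφ.isCompact.isBounded.exists_norm_le
  refine ⟨2 * Real.pi * max r 0, by positivity, fun η hη => ?_⟩
  rw [norm_smul, Real.norm_of_nonneg (by positivity)]
  gcongr
  exact (hr η (subset_tsupport _ hη)).trans (le_max_left _ _)

section

variable {I : Set ℝ} {F : ℝ × E m → Cl m}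

lemma MemHardy.eLpNorm_fourier_slice_le (hF : MemHardy I F) {t : ℝ} (ht : t ∈ I) :
    eLpNorm ((𝓕 (sliceL2 F t) : L2 m) : E m → Cl m) 2 volume ≤
      (⨆ t ∈ I, ∫⁻ v : E m, ‖F (t, v)‖ₑ ^ 2) ^ (1 / 2 : ℝ) := by
  rw [← Lp.enorm_def, ← ofReal_norm, Lp.norm_fourier_eq, ofReal_norm, Lp.enorm_def,
    eLpNorm_congr_ae (hF.sliceL2_ae_eq ht)]
  exact hF.eLpNorm_slice_le ht

/-- Frequencies in the support of `φ` satisfy `|2πη| ≤ R`, so every derivative costs at most a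
factor `R`. The remaining factor is uniform in `t` by Plancherel and the Hardy bound. -/
lemma MemHardy.exists_norm_iterPairing_le (hF : MemHardy I F) {φ : SchwartzMap (E m) ℂ}
    (hφ : HasCompactSupport φ) :
    ∃ K R : ℝ, 0 ≤ K ∧ 0 ≤ R ∧ ∀ n, ∀ t ∈ I, ‖iterPairing F n φ t‖ ≤ K * R ^ n := by
  obtain ⟨R, hR, hRφ⟩ := exists_radius_of_hasCompactSupport hφ
  set M : ℝ≥0∞ := (⨆ t ∈ I, ∫⁻ v : E m, ‖F (t, v)‖ₑ ^ 2) ^ (1 / 2 : ℝ) with hM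
  have hMtop : M ≠ ∞ := ENNReal.rpow_ne_top_of_nonneg (by norm_num) hF.2.ne
  have hφtop : eLpNorm φ 2 volume ≠ ∞ := (φ.memLp 2 volume).2.ne
  set K : ℝ := ‖(mulL : Cl m →L[ℂ] _)‖ * 2 * (eLpNorm φ 2 volume).toReal * M.toReal with hK
  refine ⟨K, R, by positivity, hR, fun n t ht => ?_⟩
  rw [iterPairing_eq t n φ hφ]
  have hu : MemLp (fun η => φ η • diracSymbol η ^ n) 2 :=
    (φ.continuous.smul (continuous_diracSymbol.pow n)).memLp_of_hasCompactSupport hφ.smul_right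
  have h1 := enorm_integral_mul_le hu (Lp.memLp (𝓕 (sliceL2 F t) : L2 m))
  have h2 : eLpNorm (fun η => φ η • diracSymbol η ^ n) 2 volume ≤
      ENNReal.ofReal (2 * R ^ n) * eLpNorm φ 2 volume := by
    refine eLpNorm_le_mul_eLpNorm_of_ae_le_mul (Filter.Eventually.of_forall fun η => ?_) 2
    rw [norm_smul]
    by_cases h0 : φ η = 0
    · simp [h0]
    · rw [mul_comm]
      gcongr
      refine (norm_diracSymbol_pow_le η n).trans ?_
      gcongr
      exact hRφ η h0
  have h3 : ‖∫ η, φ η • (diracSymbol η ^ n * ((𝓕 (sliceL2 F t) : L2 m) : E m → Cl m) η)‖ₑ ≤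
      ‖(mulL : Cl m →L[ℂ] _)‖₊ * (ENNReal.ofReal (2 * R ^ n) * eLpNorm φ 2 volume) * M := by
    simp only [smul_mul_assoc] at h1
    refine h1.trans ?_
    gcongr
    exact hF.eLpNorm_fourier_slice_le ht
  have h4 : (‖(mulL : Cl m →L[ℂ] _)‖₊ : ℝ≥0∞) *
      (ENNReal.ofReal (2 * R ^ n) * eLpNorm φ 2 volume) * M = ENNReal.ofReal (K * R ^ n) := by
    have e1 : (‖(mulL : Cl m →L[ℂ] _)‖₊ : ℝ≥0∞) = ENNReal.ofReal ‖(mulL : Cl m →L[ℂ] _)‖ := by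
      rw [ENNReal.ofReal, norm_toNNReal]
    rw [e1, ← ENNReal.ofReal_toReal hφtop, ← ENNReal.ofReal_toReal hMtop,
      ← ENNReal.ofReal_mul (by positivity), ← ENNReal.ofReal_mul (by positivity),
      ← ENNReal.ofReal_mul (by positivity)]
    congr 1
    rw [hK]; ring
  rw [h4, ← ofReal_norm] at h3
  exact (ENNReal.ofReal_le_ofReal_iff (by positivity)).1 h3

open Filter in
-- The Taylor sum is regarded as a function of its base point `r`. At `r = t` it equals the pairing
-- at `t`, at `r = s` it is the Taylor polynomial, and its `r`-derivative is a single term. The mean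
-- value inequality thus gives a remainder of order `(|t - s| R)^N / N!`.
lemma MemHardy.tendsto_taylor (hI : IsOpen I) (hIc : I.OrdConnected) (hF : MemHardy I F)
    {φ : SchwartzMap (E m) ℂ} (hφ : HasCompactSupport φ) {s t : ℝ} (hs : s ∈ I) (ht : t ∈ I) :
    Tendsto (fun N => ∑ n ∈ Finset.range (N + 1),
      ((t - s) ^ n / n.factorial) • iterPairing F n φ s) atTop (nhds (fourierPairing F φ t)) := by
  obtain ⟨K, R, hK, hR, hKR⟩ := hF.exists_norm_iterPairing_le hφ
  rw [tendsto_iff_norm_sub_tendsto_zero]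
  have hlim : Tendsto (fun N : ℕ => K * R * |t - s| * ((|t - s| * R) ^ N / N.factorial)) atTop
      (nhds 0) := by
    have := (FloorSemiring.tendsto_pow_div_factorial_atTop (|t - s| * R)).const_mul
      (K * R * |t - s|)
    simpa using this
  refine squeeze_zero (fun _ => norm_nonneg _) (fun N => ?_) hlim
  have hsub : uIcc t s ⊆ I := hIc.uIcc_subset ht hs
  have h0 : ∑ n ∈ Finset.range (N + 1), ((t - t) ^ n / n.factorial) • iterPairing F n φ t =
      fourierPairing F φ t := by
    rw [Finset.sum_range_succ']
    simp [iterPairing]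
  rw [← h0]
  have h1 := (convex_uIcc t s).norm_image_sub_le_of_norm_hasDerivWithin_le
    (f := fun r => ∑ n ∈ Finset.range (N + 1), ((t - r) ^ n / n.factorial) • iterPairing F n φ r)
    (f' := fun r => ((t - r) ^ N / N.factorial) • iterPairing F (N + 1) φ r)
    (C := |t - s| ^ N / N.factorial * (K * R ^ (N + 1))) (x := t) (y := s)
    (fun r hr => (hF.hasDerivAt_taylor hI φ t N (hsub hr)).hasDerivWithinAt) (fun r hr => ?_)
    left_mem_uIcc right_mem_uIcc
  · refine h1.trans (le_of_eq ?_)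
    rw [Real.norm_eq_abs, abs_sub_comm s t, mul_pow, pow_succ R]
    ring
  · rw [norm_smul, norm_div, norm_pow, Real.norm_eq_abs, Real.norm_natCast]
    have h2 : |t - r| ≤ |t - s| := by
      have := abs_sub_left_of_mem_uIcc hr
      rw [abs_sub_comm t r, abs_sub_comm t s]
      exact this
    gcongr
    exact hKR (N + 1) r (hsub hr)

open Filter in
-- The Taylor series is summed inside the integral, where the powers of the symbol add up to the
-- monogenic exponential. The compact support of `φ` makes the dominating function integrable.
lemma MemHardy.fourierPairing_propagation (hI : IsOpen I) (hIc : I.OrdConnected)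
    (hF : MemHardy I F) {φ : SchwartzMap (E m) ℂ} (hφ : HasCompactSupport φ) {s t : ℝ}
    (hs : s ∈ I) (ht : t ∈ I) :
    fourierPairing F φ t = ∫ η, φ η • (monoExp (t - s, 0) ((2 * Real.pi) • η) *
      ((𝓕 (sliceL2 F s) : L2 m) : E m → Cl m) η) := by
  obtain ⟨R, hR, hRφ⟩ := exists_radius_of_hasCompactSupport hφ
  set G : E m → Cl m := ((𝓕 (sliceL2 F s) : L2 m) : E m → Cl m) with hG
  have hGL : MemLp G 2 := Lp.memLp _
  have hsum : ∀ N, ∑ n ∈ Finset.range (N + 1), ((t - s) ^ n / n.factorial) • iterPairing F n φ s =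
      ∫ η, φ η • ((∑ n ∈ Finset.range (N + 1), ((t - s) ^ n / n.factorial) • diracSymbol η ^ n) *
        G η) := by
    intro N
    have hint : ∀ n ∈ Finset.range (N + 1), Integrable fun η =>
        ((t - s) ^ n / (n.factorial : ℝ)) • φ η • (diracSymbol η ^ n * G η) := fun n _ =>
      (integrable_smul_diracSymbol_pow_mul hφ n hGL).smul _
    have h1 : ∀ n ∈ Finset.range (N + 1), ((t - s) ^ n / (n.factorial : ℝ)) • iterPairing F n φ s =
        ∫ η, ((t - s) ^ n / (n.factorial : ℝ)) • φ η • (diracSymbol η ^ n * G η) := fun n _ => by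
      rw [iterPairing_eq s n φ hφ, integral_smul]
    rw [Finset.sum_congr rfl h1, ← integral_finsetSum _ hint]
    refine integral_congr_ae (Eventually.of_forall fun η => ?_)
    simp only [Finset.sum_mul, Finset.smul_sum, smul_mul_assoc]
    exact Finset.sum_congr rfl fun n _ => smul_comm _ _ _
  refine tendsto_nhds_unique (hF.tendsto_taylor hI hIc hφ hs ht) ?_
  simp_rw [hsum]
  refine tendsto_integral_of_dominated_convergence
    (fun η => (‖(mulL : Cl m →L[ℂ] _)‖ * (2 * Real.exp (|t - s| * R))) * (‖φ η‖ * ‖G η‖))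
    (fun N => ?_)
    ((MemLp.integrable_mul (p := 2) (q := 2) (φ.memLp 2).norm hGL.norm).const_mul _)
    (fun N => Eventually.of_forall fun η => ?_) (Eventually.of_forall fun η => ?_)
  · refine φ.continuous.aestronglyMeasurable.smul (AEStronglyMeasurable.mul ?_ hGL.1)
    exact (continuous_finsetSum _ fun n _ =>
      (continuous_diracSymbol.pow n).const_smul _).aestronglyMeasurable
  · rw [norm_smul]
    by_cases h0 : φ η = 0
    · simp [h0]
    · have h1 := norm_mul_le_mulL (∑ n ∈ Finset.range (N + 1),
        ((t - s) ^ n / (n.factorial : ℝ)) • diracSymbol η ^ n) (G η)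
      have h2 := norm_sum_diracSymbol_pow_le (t - s) η N
      have h3 : Real.exp (|t - s| * ‖(2 * Real.pi) • η‖) ≤ Real.exp (|t - s| * R) := by
        gcongr; exact hRφ η h0
      calc _ ≤ ‖φ η‖ * (‖(mulL : Cl m →L[ℂ] _)‖ * (2 * Real.exp (|t - s| * R)) * ‖G η‖) := by
            gcongr
            refine h1.trans ?_
            gcongr
            exact h2.trans (by gcongr)
        _ = _ := by ring
  · exact ((tendsto_sum_diracSymbol_pow (t - s) η).mul_const (G η)).const_smul (φ η)

lemma norm_exp_smul_monoExp_le (τ : ℝ) (ξ : E m) :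
    ‖Real.exp (-|τ| * ‖ξ‖) • monoExp (τ, 0) ξ‖ ≤ 2 := by
  rw [norm_smul, Real.norm_eq_abs, Real.abs_exp]
  have h1 := norm_monoExp_le (τ, 0) ξ
  calc _ ≤ Real.exp (-|τ| * ‖ξ‖) * (2 * Real.exp (|τ| * ‖ξ‖)) := by gcongr
    _ = 2 * Real.exp (-|τ| * ‖ξ‖ + |τ| * ‖ξ‖) := by rw [Real.exp_add]; ring
    _ = 2 := by simp

/-- Multiplication by `e(τ, ξ)` costs at most `|τ|` in the exponent of the weight. The factors `1/2`
and `2` normalise the multiplier, whose bound is `2`, to norm at most one. -/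
lemma weightedL2_monoExp_mul {b : ℝ} {g : E m → Cl m} (hg : WeightedL2 b g) (τ : ℝ) :
    WeightedL2 (b - |τ|) fun ξ => monoExp (τ, 0) ξ * g ξ := by
  have h1 := hg.bounded_mul (u := fun ξ => (1 / 2 : ℝ) • Real.exp (-|τ| * ‖ξ‖) • monoExp (τ, 0) ξ)
    ((StronglyMeasurable.smul (Continuous.stronglyMeasurable
      (f := fun ξ : E m => Real.exp (-|τ| * ‖ξ‖)) (by fun_prop))
      (stronglyMeasurable_monoExp _)).const_smul _) (fun ξ => by
        rw [norm_smul]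
        have := norm_exp_smul_monoExp_le τ ξ
        rw [Real.norm_of_nonneg (by norm_num)]
        linarith)
  have h2 : MemLp (fun ξ => (2 : ℝ) • Real.exp (b * ‖ξ‖) • (((1 / 2 : ℝ) • Real.exp (-|τ| * ‖ξ‖) •
    monoExp (τ, 0) ξ) * g ξ)) 2 := MemLp.const_smul h1 (2 : ℝ)
  refine (memLp_congr_ae (Filter.Eventually.of_forall fun ξ => ?_)).1 h2
  simp only [smul_mul_assoc, smul_smul]
  congr 1
  rw [sub_mul, sub_eq_add_neg, Real.exp_add, neg_mul]
  ring

/-- The Fourier transforms of two slices of a Hardy function on a slab are related by a monogenic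
exponential. -/
theorem MemHardy.fourierL2_slice (hI : IsOpen I) (hIc : I.OrdConnected) (hF : MemHardy I F)
    {s t : ℝ} (hs : s ∈ I) (ht : t ∈ I) :
    fourierL2 (sliceL2 F t) =ᵐ[volume]
      fun ξ => monoExp (t - s, 0) ξ * fourierL2 (sliceL2 F s) ξ := by
  have h0 : ((𝓕 (sliceL2 F t) : L2 m) : E m → Cl m) =ᵐ[volume] fun η =>
      monoExp (t - s, 0) ((2 * Real.pi) • η) * ((𝓕 (sliceL2 F s) : L2 m) : E m → Cl m) η := by
    refine ae_eq_of_integral_contDiff_smul_eq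
      ((Lp.memLp (𝓕 (sliceL2 F t) : L2 m)).locallyIntegrable (by norm_num)) ?_ fun g hg hgc => ?_
    · have h1 : WeightedL2 0 (fourierL2 (sliceL2 F s)) := by
        simpa [WeightedL2] using memLp_fourierL2 (sliceL2 F s)
      have h2 := memLp_comp_two_pi (weightedL2_monoExp_mul h1 (t - s))
      -- The right side need not be in `L²` because of the growth of the exponential. It is an `L²`
      -- function times a continuous one, which suffices for local integrability.
      have h3 := (h2.locallyIntegrable (by norm_num)).continuous_smul
        (g := fun η : E m => Real.exp (-(0 - |t - s|) * ‖(2 * Real.pi) • η‖)) (by fun_prop)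
      refine h3.congr (Filter.Eventually.of_forall fun η => ?_)
      simp only [smul_smul, ← Real.exp_add, fourierL2, inv_mul_cancel₀ two_pi_ne_zero, one_smul]
      rw [← add_mul, neg_add_cancel, zero_mul, Real.exp_zero, one_smul]
    · have hg1 : HasCompactSupport (Complex.ofRealCLM ∘ g) := hgc.comp_left rfl
      have hg2 : ContDiff ℝ ((⊤ : ℕ∞) : WithTop ℕ∞) (Complex.ofRealCLM ∘ g) :=
        Complex.ofRealCLM.contDiff.comp hg
      have h1 := hF.fourierPairing_propagation hI hIc (φ := hg1.toSchwartzMap hg2) hg1 hs ht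
      simpa [fourierPairing] using h1
  have h1 := fourierL2_congr h0
  filter_upwards [h1] with ξ hξ
  rw [hξ]
  simp only [smul_smul, mul_inv_cancel₀ two_pi_ne_zero, one_smul]
  rfl

end

/-! ### The Paley–Wiener theorem on strips and half-spaces -/

section Fatou

variable {u : E m → Cl m} {τ : ℕ → ℝ} {C : ℝ≥0∞}

open Filter in
-- Fatou's lemma: the bounds are available only for exponents inside the open interval, and this
-- carries them to the endpoint.
lemma lintegral_exp_smul_le_of_tendsto {a : ℝ} (hu : AEStronglyMeasurable u volume)
    (hτ : Tendsto τ atTop (nhds a))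
    (hC : ∀ n, ∫⁻ ξ, ‖Real.exp (τ n * ‖ξ‖) • u ξ‖ₑ ^ 2 ≤ C) :
    ∫⁻ ξ, ‖Real.exp (a * ‖ξ‖) • u ξ‖ₑ ^ 2 ≤ C := by
  have hlim : ∀ ξ, liminf (fun n => ‖Real.exp (τ n * ‖ξ‖) • u ξ‖ₑ ^ 2) atTop =
      ‖Real.exp (a * ‖ξ‖) • u ξ‖ₑ ^ 2 := fun ξ => by
    have h1 : Continuous fun s : ℝ => ‖Real.exp (s * ‖ξ‖) • u ξ‖ₑ ^ 2 := by
      refine (ENNReal.continuous_pow 2).comp (continuous_enorm.comp ?_)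
      fun_prop
    exact (h1.continuousAt.tendsto.comp hτ).liminf_eq
  simp_rw [← hlim]
  refine (lintegral_liminf_le' fun n => ?_).trans ?_
  · exact ((Continuous.aestronglyMeasurable (f := fun ξ : E m => Real.exp (τ n * ‖ξ‖))
      (by fun_prop)).smul hu).enorm.pow_const 2
  · exact (liminf_le_liminf (Eventually.of_forall hC)).trans_eq (liminf_const C)

lemma ae_ne_zero (hm : 1 ≤ m) : ∀ᵐ ξ : E m, ξ ≠ 0 := by
  have : Nontrivial (E m) := Module.nontrivial_of_finrank_pos (R := ℝ)
    (by rw [finrank_euclideanSpace_fin]; exact hm)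
  exact Measure.ae_ne volume 0

open Filter in
-- Wherever `u ξ ≠ 0` and `ξ ≠ 0` the integrands tend to infinity, while Fatou makes their lower
-- limit finite almost everywhere. The exceptional point `ξ = 0` is null because `m ≥ 1`.
lemma ae_eq_zero_of_lintegral_exp_smul_le_aux (hm : 1 ≤ m) (hu : StronglyMeasurable u)
    (hτ : Tendsto τ atTop atTop) (hCtop : C ≠ ∞)
    (hC : ∀ n, ∫⁻ ξ, ‖Real.exp (τ n * ‖ξ‖) • u ξ‖ₑ ^ 2 ≤ C) : u =ᵐ[volume] 0 := by
  have hmeas : ∀ n, Measurable (fun ξ => ‖Real.exp (τ n * ‖ξ‖) • u ξ‖ₑ ^ 2) := fun n =>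
    ((Continuous.stronglyMeasurable (f := fun ξ : E m => Real.exp (τ n * ‖ξ‖))
      (by fun_prop)).smul hu).enorm.pow_const 2
  have h1 : ∫⁻ ξ, liminf (fun n => ‖Real.exp (τ n * ‖ξ‖) • u ξ‖ₑ ^ 2) atTop ≤ C :=
    (lintegral_liminf_le hmeas).trans
      ((liminf_le_liminf (Eventually.of_forall hC)).trans_eq (liminf_const C))
  have h2 := ae_lt_top (Measurable.liminf hmeas) (lt_of_le_of_lt h1 hCtop.lt_top).ne
  filter_upwards [h2, ae_ne_zero hm] with ξ hξ hξ0
  by_contra hne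
  have hne' : u ξ ≠ 0 := hne
  refine hξ.ne (Tendsto.liminf_eq ?_)
  have h3 : Tendsto (fun n => ‖Real.exp (τ n * ‖ξ‖) • u ξ‖) atTop atTop := by
    simp_rw [norm_smul, Real.norm_eq_abs, Real.abs_exp]
    exact (Real.tendsto_exp_atTop.comp (hτ.atTop_mul_const (norm_pos_iff.2 hξ0))).atTop_mul_const
      (norm_pos_iff.2 hne')
  have h4 := ENNReal.tendsto_ofReal_atTop.comp
    ((tendsto_pow_atTop (two_ne_zero (α := ℕ))).comp h3)
  refine h4.congr fun n => ?_
  simp only [Function.comp_apply]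
  rw [ENNReal.ofReal_pow (norm_nonneg _), ofReal_norm]

lemma ae_eq_zero_of_lintegral_exp_smul_le (hm : 1 ≤ m) (hu : AEStronglyMeasurable u volume)
    (hτ : Filter.Tendsto τ Filter.atTop Filter.atTop) (hCtop : C ≠ ∞)
    (hC : ∀ n, ∫⁻ ξ, ‖Real.exp (τ n * ‖ξ‖) • u ξ‖ₑ ^ 2 ≤ C) : u =ᵐ[volume] 0 := by
  refine hu.ae_eq_mk.trans (ae_eq_zero_of_lintegral_exp_smul_le_aux hm hu.stronglyMeasurable_mk hτ
    hCtop fun n => le_trans (le_of_eq (lintegral_congr_ae ?_)) (hC n))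
  filter_upwards [hu.ae_eq_mk] with ξ hξ
  rw [hξ]

end Fatou

section

variable {I : Set ℝ} {F : ℝ × E m → Cl m} {a : ℝ}

/-- A bound for the weighted norms of the two parts of the Fourier transform. -/
def hardyBound (I : Set ℝ) (F : ℝ × E m → Cl m) : ℝ≥0∞ :=
  ‖(mulL : Cl m →L[ℂ] _)‖ₑ ^ 2 *
    (ENNReal.ofReal (twoPiInv m)⁻¹ * ⨆ t ∈ I, ∫⁻ v : E m, ‖F (t, v)‖ₑ ^ 2)

lemma MemHardy.hardyBound_ne_top (hF : MemHardy I F) : hardyBound I F ≠ ∞ :=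
  ENNReal.mul_ne_top (by simp) (ENNReal.mul_ne_top ENNReal.ofReal_ne_top hF.2.ne)

lemma MemHardy.lintegral_mul_fourierL2_le (hF : MemHardy I F) {t : ℝ} (ht : t ∈ I)
    {u : E m → Cl m} (hu : ∀ ξ, ‖u ξ‖ ≤ 1) :
    ∫⁻ ξ, ‖u ξ * fourierL2 (sliceL2 F t) ξ‖ₑ ^ 2 ≤ hardyBound I F := by
  have h1 : ∫⁻ ξ, ‖fourierL2 (sliceL2 F t) ξ‖ₑ ^ 2 ≤
      ENNReal.ofReal (twoPiInv m)⁻¹ * ⨆ t ∈ I, ∫⁻ v : E m, ‖F (t, v)‖ₑ ^ 2 := by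
    rw [lintegral_fourierL2]
    gcongr
    refine le_trans (le_of_eq ?_) (hF.lintegral_slice_le ht)
    refine lintegral_congr_ae ?_
    filter_upwards [hF.sliceL2_ae_eq ht] with v hv
    rw [hv]
  refine le_trans ?_ (mul_le_mul_right h1 _)
  rw [← lintegral_const_mul' _ _ (by simp)]
  refine lintegral_mono fun ξ => ?_
  rw [← mul_pow]
  gcongr
  have h2 := norm_mul_le_mulL (u ξ) (fourierL2 (sliceL2 F t) ξ)
  have h3 : ‖u ξ * fourierL2 (sliceL2 F t) ξ‖ ≤
      ‖(mulL : Cl m →L[ℂ] _)‖ * ‖fourierL2 (sliceL2 F t) ξ‖ := by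
    refine h2.trans ?_
    gcongr
    exact mul_le_of_le_one_right (norm_nonneg _) (hu ξ)
  rw [← ofReal_norm, ← ofReal_norm, ← ofReal_norm, ← ENNReal.ofReal_mul (norm_nonneg _)]
  exact ENNReal.ofReal_le_ofReal h3

/-- By propagation the integrand equals `χ_+` times the transform of the slice at `t`, and
Plancherel bounds this independently of `t`. -/
lemma MemHardy.lintegral_chiP_le (hm : 1 ≤ m) (hI : IsOpen I) (hIc : I.OrdConnected)
    (hF : MemHardy I F) (h0 : (0 : ℝ) ∈ I) {t : ℝ} (ht : t ∈ I) :
    ∫⁻ ξ, ‖Real.exp (-t * ‖ξ‖) • (chiP ξ * fourierL2 (sliceL2 F 0) ξ)‖ₑ ^ 2 ≤ hardyBound I F := by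
  refine le_trans (le_of_eq ?_) (hF.lintegral_mul_fourierL2_le ht norm_chiP_le)
  refine lintegral_congr_ae ?_
  filter_upwards [hF.fourierL2_slice hI hIc h0 ht, ae_ne_zero hm] with ξ hξ hξ0
  rw [hξ, ← mul_assoc, sub_zero, chiP_mul_monoExp hξ0, smul_mul_assoc]

lemma MemHardy.lintegral_chiM_le (hm : 1 ≤ m) (hI : IsOpen I) (hIc : I.OrdConnected)
    (hF : MemHardy I F) (h0 : (0 : ℝ) ∈ I) {t : ℝ} (ht : t ∈ I) :
    ∫⁻ ξ, ‖Real.exp (t * ‖ξ‖) • (chiM ξ * fourierL2 (sliceL2 F 0) ξ)‖ₑ ^ 2 ≤ hardyBound I F := by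
  refine le_trans (le_of_eq ?_) (hF.lintegral_mul_fourierL2_le ht norm_chiM_le)
  refine lintegral_congr_ae ?_
  filter_upwards [hF.fourierL2_slice hI hIc h0 ht, ae_ne_zero hm] with ξ hξ hξ0
  rw [hξ, ← mul_assoc, sub_zero, chiM_mul_monoExp hξ0, smul_mul_assoc]

lemma aestronglyMeasurable_chiP_mul (f : L2 m) :
    AEStronglyMeasurable (fun ξ => chiP ξ * fourierL2 f ξ) volume :=
  stronglyMeasurable_chiP.aestronglyMeasurable.mul (aestronglyMeasurable_fourierL2 f)

lemma aestronglyMeasurable_chiM_mul (f : L2 m) :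
    AEStronglyMeasurable (fun ξ => chiM ξ * fourierL2 f ξ) volume :=
  stronglyMeasurable_chiM.aestronglyMeasurable.mul (aestronglyMeasurable_fourierL2 f)

/-- The Fourier transform of the restriction of a Hardy function on a strip decays
exponentially. -/
theorem MemHardy.weightedL2 (hm : 1 ≤ m) (ha : 0 < a) (hF : MemHardy (Ioo (-a) a) F) :
    WeightedL2 a (fourierL2 (sliceL2 F 0)) := by
  -- The `χ_+` part grows towards the lower face and the `χ_-` part towards the upper one, so the
  -- slices at `-τ n` and `τ n` are used respectively.
  obtain ⟨τ, -, hτ, hτa⟩ := exists_seq_strictMono_tendsto' ha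
  have h0 : (0 : ℝ) ∈ Ioo (-a) a := ⟨by linarith, ha⟩
  have hP : WeightedL2 a fun ξ => chiP ξ * fourierL2 (sliceL2 F 0) ξ := by
    refine (memLp_two_iff_lintegral_lt_top ((Continuous.aestronglyMeasurable
      (f := fun ξ : E m => Real.exp (a * ‖ξ‖)) (by fun_prop)).smul
        (aestronglyMeasurable_chiP_mul _))).2 ?_
    refine lt_of_le_of_lt (lintegral_exp_smul_le_of_tendsto (aestronglyMeasurable_chiP_mul _) hτa
      fun n => ?_) hF.hardyBound_ne_top.lt_top
    have := hF.lintegral_chiP_le hm isOpen_Ioo ordConnected_Ioo h0 (t := -τ n)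
      ⟨by linarith [(hτ n).2], by linarith [(hτ n).1]⟩
    rwa [neg_neg] at this
  have hM : WeightedL2 a fun ξ => chiM ξ * fourierL2 (sliceL2 F 0) ξ := by
    refine (memLp_two_iff_lintegral_lt_top ((Continuous.aestronglyMeasurable
      (f := fun ξ : E m => Real.exp (a * ‖ξ‖)) (by fun_prop)).smul
        (aestronglyMeasurable_chiM_mul _))).2 ?_
    exact lt_of_le_of_lt (lintegral_exp_smul_le_of_tendsto (aestronglyMeasurable_chiM_mul _) hτa
      fun n => hF.lintegral_chiM_le hm isOpen_Ioo ordConnected_Ioo h0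
        ⟨by linarith [(hτ n).1], (hτ n).2⟩) hF.hardyBound_ne_top.lt_top
  refine (memLp_congr_ae (Filter.Eventually.of_forall fun ξ => ?_)).1 (MemLp.add hP hM)
  simp only [Pi.add_apply]
  rw [← smul_add, ← add_mul, chiP_add_chiM, one_mul]

/-- Hardy functions are recovered from the Fourier transforms of their restrictions. -/
theorem MemHardy.represents (hm : 1 ≤ m) (ha : 0 < a) (hF : MemHardy (Ioo (-a) a) F) :
    Represents a (fourierL2 (sliceL2 F 0)) F := by
  have hg := hF.weightedL2 hm ha
  have hG := represents_plusPart_add_minusPart hg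
  have h0 : (0 : ℝ) ∈ Ioo (-a) a := ⟨by linarith, ha⟩
  rintro ⟨t, v⟩ hx
  refine ⟨(hG _ hx).1, ?_⟩
  rw [← (hG _ hx).2, hG.slice hx.1]
  have hta : 0 < a - |t| := sub_pos.2 (abs_lt.2 hx.1)
  have hh := weightedL2_monoExp_mul hg t
  -- The transform of the slice at `t` keeps the positive weight `a - |t|`; it is therefore
  -- integrable as well as square integrable, and pointwise inversion applies.
  have h1 := eq_synth_of_continuous (hh.integrable hta) (hh.memLp hta.le) (f := sliceL2 F t)
    (by simpa using hF.fourierL2_slice isOpen_Ioo ordConnected_Ioo h0 hx.1)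
    (hF.continuous_slice hx.1) (hF.sliceL2_ae_eq hx.1).symm
  exact congrFun h1 v

lemma IsRestriction.memLp {f : L2 m} (hf : IsRestriction f F) :
    MemLp (fun v : E m => F (0, v)) 2 :=
  (memLp_congr_ae hf).2 (Lp.memLp f)

lemma IsRestriction.sliceL2_eq {f : L2 m} (hf : IsRestriction f F) : sliceL2 F 0 = f := by
  rw [sliceL2, dif_pos hf.memLp]
  exact Lp.ext (hf.memLp.coeFn_toLp.trans hf)

lemma restrFourier_eq (hF : MemLp (fun v : E m => F (0, v)) 2) :
    restrFourier F = fourierL2 (sliceL2 F 0) := by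
  rw [restrFourier, dif_pos hF, sliceL2, dif_pos hF]

/-- The density in the representation formula is the Fourier transform of the restriction. -/
theorem Represents.ae_eq_fourierL2 (ha : 0 < a) {g : E m → Cl m} (hF : Represents a g F)
    (hg : WeightedL2 a g) : g =ᵐ[volume] fourierL2 (sliceL2 F 0) := by
  have h0 : (0 : ℝ) ∈ Ioo (-a) a := ⟨by linarith, ha⟩
  refine (fourierL2_of_ae_eq_synth (hg.integrable ha) (hg.memLp ha.le) ?_).symm
  refine Filter.EventuallyEq.trans (Filter.Eventually.of_forall fun v => ?_)
    ((hF.memHardy hg).sliceL2_ae_eq h0).symm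
  have h1 : (fun ξ : E m => monoExp (0, 0) ξ * g ξ) = g := by
    ext1 ξ
    rw [show ((0, 0) : ℝ × E m) = 0 from rfl, monoExp_zero_left, one_mul]
  simp only [hF.slice h0, h1]

open Filter in
-- Slices at `t = n → ∞` are available here, and `e^{n|ξ|} χ_- F̂_0` stays bounded in `L²`. On `x_0
-- < a` the slices at `t = -n` eliminate `χ_+` in the same way.
lemma MemHardy.chiM_mul_eq_zero (hm : 1 ≤ m) (ha : 0 < a) (hF : MemHardy (Ioi (-a)) F) :
    (fun ξ => chiM ξ * fourierL2 (sliceL2 F 0) ξ) =ᵐ[volume] 0 :=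
  ae_eq_zero_of_lintegral_exp_smul_le hm (aestronglyMeasurable_chiM_mul _)
    tendsto_natCast_atTop_atTop hF.hardyBound_ne_top fun n =>
      hF.lintegral_chiM_le hm isOpen_Ioi ordConnected_Ioi (by simpa using ha)
        (show -a < (n : ℝ) by linarith [(Nat.cast_nonneg n : (0 : ℝ) ≤ n)])

open Filter in
lemma MemHardy.chiP_mul_eq_zero (hm : 1 ≤ m) (ha : 0 < a) (hF : MemHardy (Iio a) F) :
    (fun ξ => chiP ξ * fourierL2 (sliceL2 F 0) ξ) =ᵐ[volume] 0 :=
  ae_eq_zero_of_lintegral_exp_smul_le hm (aestronglyMeasurable_chiP_mul _)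
    tendsto_natCast_atTop_atTop hF.hardyBound_ne_top fun n => by
      have := hF.lintegral_chiP_le hm isOpen_Iio ordConnected_Iio ha
        (show -(n : ℝ) < a by linarith [(Nat.cast_nonneg n : (0 : ℝ) ≤ n)])
      rwa [neg_neg] at this

/-- A Hardy function on a slab vanishes if its restriction has vanishing Fourier transform. -/
lemma MemHardy.eqOn_zero (hI : IsOpen I) (hIc : I.OrdConnected) (hF : MemHardy I F)
    (h0 : (0 : ℝ) ∈ I) (hz : fourierL2 (sliceL2 F 0) =ᵐ[volume] 0) : EqOn F 0 (slab m I) := by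
  rintro ⟨t, v⟩ ht
  have h1 := eq_synth_of_continuous (h := 0) (integrable_zero _ _ _) MemLp.zero (f := sliceL2 F t)
    (by
      filter_upwards [hF.fourierL2_slice hI hIc h0 ht.1, hz] with ξ h1 h2
      rw [h1, h2, Pi.zero_apply, mul_zero])
    (hF.continuous_slice ht.1) (hF.sliceL2_ae_eq ht.1).symm
  have h2 := congrFun h1 v
  simpa [synth] using h2

/-- The common restriction to `x_0 = 0` has a transform annihilated by `χ_-` because of `D` and by
`χ_+` because of `M`, and `χ_+ + χ_- = 1`. Propagation then kills every slice of both functions. -/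
theorem eqOn_zero_of_halfspaces (hm : 1 ≤ m) (ha : 0 < a) {D M : ℝ × E m → Cl m}
    (hD : MemHardy (Ioi (-a)) D) (hM : MemHardy (Iio a) M)
    (h : EqOn D M (slab m (Ioo (-a) a))) :
    EqOn D 0 (slab m (Ioi (-a))) ∧ EqOn M 0 (slab m (Iio a)) := by
  have h1 : sliceL2 D 0 = sliceL2 M 0 := by
    have : (fun v : E m => D (0, v)) = fun v => M (0, v) := by
      ext1 v
      exact h ⟨⟨by linarith, ha⟩, trivial⟩
    classical
    unfold sliceL2
    -- The membership proof in `sliceL2` depends on the function, so the whole conditional is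
    -- treated as a function of the slice.
    exact congrArg (fun f : E m → Cl m => if h : MemLp f 2 volume then h.toLp else 0) this
  have h2 : fourierL2 (sliceL2 D 0) =ᵐ[volume] 0 := by
    have h3 := hM.chiP_mul_eq_zero hm ha
    rw [← h1] at h3
    filter_upwards [hD.chiM_mul_eq_zero hm ha, h3] with ξ h4 h5
    rw [← one_mul (fourierL2 (sliceL2 D 0) ξ), ← chiP_add_chiM ξ, add_mul, h4, h5]
    simp
  refine ⟨hD.eqOn_zero isOpen_Ioi ordConnected_Ioi (by simpa using ha) h2,
    hM.eqOn_zero isOpen_Iio ordConnected_Iio ha ?_⟩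
  rwa [← h1]

end

/-! ### The induced inner product -/

lemma star_real_smul (r : ℝ) (x : Cl m) : star (r • x) = r • star x := by
  rw [← Complex.coe_smul, star_smul_eq, ← Complex.coe_smul]
  simp

/-- Clifford conjugation as a continuous real linear map. -/
def starL : Cl m →L[ℝ] Cl m :=
  LinearMap.toContinuousLinearMap
    { toFun := star
      map_add' := star_add
      map_smul' := star_real_smul }

@[simp] lemma starL_apply (x : Cl m) : starL x = star x := rfl

/-- The coefficient at a basis element as a continuous real linear map. -/
def coeffL (T : Finset (Fin m)) : Cl m →L[ℝ] ℂ :=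
  LinearMap.toContinuousLinearMap
    { toFun := fun x => coeff x T
      map_add' := fun x y => coeff_add x y T
      map_smul' := fun c x => coeff_real_smul c x T }

@[simp] lemma coeffL_apply (T : Finset (Fin m)) (x : Cl m) : coeffL T x = coeff x T := rfl

section

variable {a : ℝ} {F G : ℝ × E m → Cl m} {g h : E m → Cl m}

lemma WeightedL2.add (hg : WeightedL2 a g) (hh : WeightedL2 a h) : WeightedL2 a (g + h) := by
  refine (memLp_congr_ae (Filter.Eventually.of_forall fun ξ => ?_)).1 (MemLp.add hg hh)
  simp

lemma WeightedL2.mul_const (hg : WeightedL2 a g) (c : Cl m) : WeightedL2 a fun ξ => g ξ * c := by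
  refine (memLp_congr_ae (Filter.Eventually.of_forall fun ξ => ?_)).1
    ((mulRight c).comp_memLp' hg)
  simp

lemma Represents.add (hF : Represents a g F) (hG : Represents a h G) :
    Represents a (g + h) (F + G) := by
  intro x hx
  have h1 : (fun ξ => monoExp x ξ * (g + h) ξ) = fun ξ => monoExp x ξ * g ξ + monoExp x ξ * h ξ := by
    ext1 ξ; rw [Pi.add_apply, mul_add]
  rw [h1]
  refine ⟨(hF x hx).1.add (hG x hx).1, ?_⟩
  rw [integral_add (hF x hx).1 (hG x hx).1, smul_add, Pi.add_apply, (hF x hx).2, (hG x hx).2]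

lemma Represents.mul_const (hF : Represents a g F) (c : Cl m) :
    Represents a (fun ξ => g ξ * c) fun x => F x * c := by
  intro x hx
  have h1 : (fun ξ => monoExp x ξ * (g ξ * c)) = fun ξ => mulRight c (monoExp x ξ * g ξ) := by
    ext1 ξ; rw [mulRight_apply, mul_assoc]
  rw [h1]
  refine ⟨(mulRight c).integrable_comp (hF x hx).1, ?_⟩
  change F x * c = _
  rw [(mulRight c).integral_comp_comm (hF x hx).1, mulRight_apply, (hF x hx).2, smul_mul_assoc]

lemma Represents.assoc_ae_eq (ha : 0 < a) (hF : Represents a g F) (hg : WeightedL2 a g) :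
    assoc a F =ᵐ[volume] fun ξ => Real.exp (a * ‖ξ‖) • g ξ := by
  have h1 := hF.ae_eq_fourierL2 ha hg
  have h2 := (hF.memHardy hg).memLp_slice (t := 0) ⟨by linarith, ha⟩
  filter_upwards [h1] with ξ hξ
  rw [assoc, restrFourier_eq h2, hξ]

lemma memLp_assoc (hm : 1 ≤ m) (ha : 0 < a) (hF : MemHardy (Ioo (-a) a) F) :
    MemLp (assoc a F) 2 :=
  (memLp_congr_ae ((hF.represents hm ha).assoc_ae_eq ha (hF.weightedL2 hm ha))).2
    (hF.weightedL2 hm ha)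

/-- The sum of the densities represents `F + G`, and the density is unique almost everywhere.
Additivity thus follows without comparing `L²` classes of slices. -/
lemma assoc_add_ae_eq (hm : 1 ≤ m) (ha : 0 < a) (hF : MemHardy (Ioo (-a) a) F)
    (hG : MemHardy (Ioo (-a) a) G) :
    assoc a (F + G) =ᵐ[volume] fun ξ => assoc a F ξ + assoc a G ξ := by
  have h1 := hF.represents hm ha
  have h2 := hG.represents hm ha
  have h3 := hF.weightedL2 hm ha
  have h4 := hG.weightedL2 hm ha
  filter_upwards [(h1.add h2).assoc_ae_eq ha (h3.add h4), h1.assoc_ae_eq ha h3,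
    h2.assoc_ae_eq ha h4] with ξ e1 e2 e3
  rw [e1, e2, e3, Pi.add_apply, smul_add]

lemma assoc_mul_const_ae_eq (hm : 1 ≤ m) (ha : 0 < a) (hF : MemHardy (Ioo (-a) a) F) (c : Cl m) :
    assoc a (fun x => F x * c) =ᵐ[volume] fun ξ => assoc a F ξ * c := by
  have h1 := hF.represents hm ha
  have h3 := hF.weightedL2 hm ha
  filter_upwards [(h1.mul_const c).assoc_ae_eq ha (h3.mul_const c), h1.assoc_ae_eq ha h3]
    with ξ e1 e2
  rw [e1, e2, smul_mul_assoc]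

lemma integrable_star_mul {u f : E m → Cl m} (hu : MemLp u 2) (hf : MemLp f 2) :
    Integrable fun ξ => star (u ξ) * f ξ :=
  integrable_mul_of_memLp ((starL (m := m)).comp_memLp' hu) hf

lemma star_hardyInner (hm : 1 ≤ m) (ha : 0 < a) (hF : MemHardy (Ioo (-a) a) F)
    (hG : MemHardy (Ioo (-a) a) G) : star (hardyInner a F G) = hardyInner a G F := by
  rw [hardyInner, star_real_smul, ← starL_apply,
    ← starL.integral_comp_comm (integrable_star_mul (memLp_assoc hm ha hG) (memLp_assoc hm ha hF)),
    hardyInner]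
  simp

lemma hardyInner_add (hm : 1 ≤ m) (ha : 0 < a) (hF : MemHardy (Ioo (-a) a) F)
    (hG : MemHardy (Ioo (-a) a) G) {F' : ℝ × E m → Cl m} (hF' : MemHardy (Ioo (-a) a) F') :
    hardyInner a (F + F') G = hardyInner a F G + hardyInner a F' G := by
  have hG2 := memLp_assoc hm ha hG
  rw [hardyInner, hardyInner, hardyInner, ← smul_add,
    ← integral_add (integrable_star_mul hG2 (memLp_assoc hm ha hF))
      (integrable_star_mul hG2 (memLp_assoc hm ha hF'))]
  congr 1
  refine integral_congr_ae ?_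
  filter_upwards [assoc_add_ae_eq hm ha hF hF'] with ξ hξ
  rw [hξ, mul_add]

lemma hardyInner_mul_const (hm : 1 ≤ m) (ha : 0 < a) (hF : MemHardy (Ioo (-a) a) F)
    (hG : MemHardy (Ioo (-a) a) G) (c : Cl m) :
    hardyInner a (fun x => F x * c) G = hardyInner a F G * c := by
  have hint := integrable_star_mul (memLp_assoc hm ha hG) (memLp_assoc hm ha hF)
  rw [hardyInner, hardyInner, smul_mul_assoc, ← mulRight_apply,
    ← (mulRight c).integral_comp_comm hint]
  congr 1
  refine integral_congr_ae ?_
  filter_upwards [assoc_mul_const_ae_eq hm ha hF c] with ξ hξ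
  rw [hξ, mulRight_apply, mul_assoc]

lemma integrable_norm_sq_assoc (hm : 1 ≤ m) (ha : 0 < a) (hF : MemHardy (Ioo (-a) a) F) :
    Integrable fun ξ => ‖assoc a F ξ‖ ^ 2 :=
  (memLp_two_iff_integrable_sq_norm (memLp_assoc hm ha hF).1).1 (memLp_assoc hm ha hF)

lemma coeff_hardyInner_self (hm : 1 ≤ m) (ha : 0 < a) (hF : MemHardy (Ioo (-a) a) F) :
    coeff (hardyInner a F F) ∅ = ((twoPiInv m * ∫ ξ, ‖assoc a F ξ‖ ^ 2 : ℝ) : ℂ) := by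
  have hL := memLp_assoc hm ha hF
  rw [hardyInner, coeff_real_smul, ← coeffL_apply,
    ← (coeffL ∅).integral_comp_comm (integrable_star_mul hL hL)]
  simp only [coeffL_apply, coeff_star_mul_self]
  rw [Complex.ofReal_mul, ← integral_complex_ofReal]

lemma eq_zero_of_coeff_hardyInner_self (hm : 1 ≤ m) (ha : 0 < a) (hF : MemHardy (Ioo (-a) a) F)
    (h : coeff (hardyInner a F F) ∅ = 0) : EqOn F 0 (slab m (Ioo (-a) a)) := by
  rw [coeff_hardyInner_self hm ha hF, Complex.ofReal_eq_zero, mul_eq_zero,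
    or_iff_right twoPiInv_pos.ne', integral_eq_zero_iff_of_nonneg (fun _ => by positivity)
      (integrable_norm_sq_assoc hm ha hF)] at h
  refine hF.eqOn_zero isOpen_Ioo ordConnected_Ioo ⟨by linarith, ha⟩ ?_
  filter_upwards [h, (hF.represents hm ha).assoc_ae_eq ha (hF.weightedL2 hm ha)] with ξ h1 h2
  simp only [Pi.zero_apply, ne_eq, OfNat.ofNat_ne_zero, not_false_eq_true, pow_eq_zero_iff,
    norm_eq_zero] at h1
  rw [h1] at h2
  exact (smul_eq_zero.1 h2.symm).resolve_left (Real.exp_pos _).ne'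

/-- The density `e^{-a|ξ|} u` satisfies the weight condition precisely because `u ∈ L²`. -/
lemma exists_assoc_ae_eq (ha : 0 < a) (u : L2 m) :
    ∃ F : ℝ × E m → Cl m, MemHardy (Ioo (-a) a) F ∧
      assoc a F =ᵐ[volume] (u : E m → Cl m) := by
  have h1 : ∀ ξ, Real.exp (a * ‖ξ‖) • Real.exp (-a * ‖ξ‖) • (u : E m → Cl m) ξ = u ξ := fun ξ => by
    rw [smul_smul, ← Real.exp_add]; simp
  have hg : WeightedL2 a fun ξ => Real.exp (-a * ‖ξ‖) • (u : E m → Cl m) ξ :=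
    (memLp_congr_ae (Filter.Eventually.of_forall h1)).2 (Lp.memLp u)
  have hF := represents_plusPart_add_minusPart hg
  exact ⟨_, hF.memHardy hg, (hF.assoc_ae_eq ha hg).trans (Filter.Eventually.of_forall h1)⟩

/-! ### The Szegő kernel -/

/-- The density of the Szegő kernel. -/
def szegoDensity (a : ℝ) (x : ℝ × E m) (ξ : E m) : Cl m :=
  Real.exp (-2 * a * ‖ξ‖) • monoExp (pconj x) ξ

/-- The exponents add up to `a - 2a + |x_0| = -(a - |x_0|) < 0`. -/
lemma weightedL2_szegoDensity {x : ℝ × E m} (hx : x.1 ∈ Ioo (-a) a) :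
    WeightedL2 a (szegoDensity a x) := by
  have h1 : 0 < a - |x.1| := sub_pos.2 (abs_lt.2 hx)
  refine MemLp.of_le ((memLp_exp_neg_mul_norm (m := m) h1).const_mul 2) ?_
    (Filter.Eventually.of_forall fun ξ => ?_)
  · exact (Continuous.aestronglyMeasurable (f := fun ξ : E m => Real.exp (a * ‖ξ‖))
      (by fun_prop)).smul ((Continuous.aestronglyMeasurable
        (f := fun ξ : E m => Real.exp (-2 * a * ‖ξ‖)) (by fun_prop)).smul
          (stronglyMeasurable_monoExp _).aestronglyMeasurable)
  · have h2 := norm_monoExp_le (pconj x) ξ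
    rw [szegoDensity, smul_smul, ← Real.exp_add, norm_smul, Real.norm_eq_abs, Real.abs_exp]
    calc _ ≤ Real.exp (a * ‖ξ‖ + -2 * a * ‖ξ‖) * (2 * Real.exp (|x.1| * ‖ξ‖)) := by
          gcongr
          exact h2
      _ = 2 * Real.exp (-(a - |x.1|) * ‖ξ‖) := by
          rw [mul_left_comm, ← Real.exp_add]; congr 2; ring
      _ ≤ _ := le_abs_self _

/-- The group law `e(w + x̄, ξ) = e(w, ξ) e(x̄, ξ)` separates the variables, so the kernel is itself
given by the representation formula. -/
lemma represents_szego {x : ℝ × E m} (hx : x.1 ∈ Ioo (-a) a) :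
    Represents a (szegoDensity a x) fun w => szego a w x := by
  intro w hw
  refine ⟨(represents_plusPart_add_minusPart (weightedL2_szegoDensity hx) w hw).1, ?_⟩
  change szego a w x = _
  rw [szego]
  congr 2
  ext1 ξ
  rw [monoExp_add, szegoDensity, mul_smul_comm]

/-- The weights `e^{a|ξ|}` of the two associated functions cancel `e^{-2a|ξ|}`, and conjugation
turns `e(x̄, ξ)` into `e(x, ξ)`. What remains is the representation of `F` at `x`. -/
lemma hardyInner_szego (hm : 1 ≤ m) (ha : 0 < a) (hF : MemHardy (Ioo (-a) a) F) {x : ℝ × E m}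
    (hx : x ∈ slab m (Ioo (-a) a)) : hardyInner a F (fun w => szego a w x) = F x := by
  have h1 := hF.represents hm ha
  rw [(h1 x hx).2, hardyInner]
  congr 1
  refine integral_congr_ae ?_
  filter_upwards [h1.assoc_ae_eq ha (hF.weightedL2 hm ha),
    (represents_szego hx.1).assoc_ae_eq ha (weightedL2_szegoDensity hx.1)] with ξ e1 e2
  rw [e1, e2, szegoDensity, star_real_smul, star_real_smul, star_monoExp_pconj, smul_mul_assoc,
    smul_mul_assoc, mul_smul_comm, smul_smul, smul_smul, ← Real.exp_add, ← Real.exp_add]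
  ring_nf
  simp

end

/-! ### The Poisson kernel of the half-space -/

/-- Substitute `z = ys - r/(2s)`, a bijection from `(0, ∞)` onto `ℝ` with `dz = (y + r/(2s²)) ds`,
in the Gaussian integral. The involution `s ↦ r/(2ys)` sends `z` to `-z` and exchanges the two
summands of the Jacobian, so each contributes `√π / 2`. -/
lemma integral_exp_neg_sq_sub_div {y r : ℝ} (hy : 0 < y) (hr : 0 < r) :
    ∫ s in Ioi (0 : ℝ), Real.exp (-(y * s - r / (2 * s)) ^ 2) = √Real.pi / (2 * y) := by
  set φ : ℝ → ℝ := fun s => y * s - r / (2 * s) with hφ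
  have hφ' : ∀ s ∈ Ioi (0 : ℝ), HasDerivWithinAt φ (y + r / (2 * s ^ 2)) (Ioi 0) s := by
    intro s hs
    have hs' : s ≠ 0 := (mem_Ioi.1 hs).ne'
    have h1 := ((hasDerivAt_id s).const_mul y).sub ((hasDerivAt_inv hs').const_mul (r / 2))
    refine (h1.congr_deriv ?_).hasDerivWithinAt.congr_of_mem (fun t ht => ?_) hs
    · field_simp; ring
    · have ht' : t ≠ 0 := (mem_Ioi.1 ht).ne'
      simp only [hφ, Pi.sub_apply, id]
      field_simp
  have hinj : InjOn φ (Ioi 0) := by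
    intro s hs t ht h
    have hs' : 0 < s := hs
    have ht' : 0 < t := ht
    have h1 : (s - t) * (y + r / (2 * (s * t))) = 0 := by
      have : φ s - φ t = (s - t) * (y + r / (2 * (s * t))) := by
        simp only [hφ]; field_simp; ring
      rw [← this, h, sub_self]
    have h2 : y + r / (2 * (s * t)) ≠ 0 := by positivity
    exact sub_eq_zero.1 ((mul_eq_zero.1 h1).resolve_right h2)
  have himg : φ '' Ioi 0 = univ := by
    refine eq_univ_of_forall fun z => ?_
    have h0 : 0 < z ^ 2 + 2 * y * r := by positivity
    have hq : √(z ^ 2 + 2 * y * r) ^ 2 = z ^ 2 + 2 * y * r := Real.sq_sqrt h0.le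
    have hlt : |z| < √(z ^ 2 + 2 * y * r) := by
      rw [← Real.sqrt_sq_eq_abs]
      exact Real.sqrt_lt_sqrt (sq_nonneg z) (by linarith [mul_pos hy hr])
    have hpos : 0 < z + √(z ^ 2 + 2 * y * r) := by linarith [neg_abs_le z]
    -- The positive root of `2ys² - 2zs - r = 0`, which is the equation `ys - r/(2s) = z`.
    refine ⟨(z + √(z ^ 2 + 2 * y * r)) / (2 * y), mem_Ioi.2 (by positivity), ?_⟩
    set q := √(z ^ 2 + 2 * y * r)
    have h1 : r = (q ^ 2 - z ^ 2) / (2 * y) := by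
      rw [hq]; field_simp; ring
    simp only [hφ]
    rw [h1]
    have hy' := hy.ne'
    have hp' := hpos.ne'
    field_simp
    ring
  have hψ' : ∀ s ∈ Ioi (0 : ℝ),
      HasDerivWithinAt (fun s => r / (2 * y) * s⁻¹) (-(r / (2 * y * s ^ 2))) (Ioi 0) s := by
    intro s hs
    have hs' : s ≠ 0 := (mem_Ioi.1 hs).ne'
    refine (((hasDerivAt_inv hs').const_mul (r / (2 * y))).congr_deriv ?_).hasDerivWithinAt
    field_simp
  have hψinj : InjOn (fun s => r / (2 * y) * s⁻¹) (Ioi 0) := by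
    intro s hs t ht h
    have : r / (2 * y) ≠ 0 := by positivity
    exact inv_injective (mul_left_cancel₀ this h)
  have hψimg : (fun s => r / (2 * y) * s⁻¹) '' Ioi 0 = Ioi 0 := by
    refine Subset.antisymm ?_ fun z hz => ⟨r / (2 * y) * z⁻¹, ?_, ?_⟩
    · rintro _ ⟨s, hs, rfl⟩
      have hs' : 0 < s := hs
      exact mem_Ioi.2 (by positivity)
    · have hz' : 0 < z := hz
      exact mem_Ioi.2 (by positivity)
    · have hz' : 0 < z := hz
      simp only
      field_simp
  have hg : Integrable fun z : ℝ => Real.exp (-z ^ 2) := by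
    simpa using integrable_exp_neg_mul_sq one_pos
  have hI : IntegrableOn (fun s => (y + r / (2 * s ^ 2)) * Real.exp (-(φ s) ^ 2)) (Ioi 0) := by
    have h1 := (integrableOn_image_iff_integrableOn_abs_deriv_smul measurableSet_Ioi hφ' hinj
      (fun z => Real.exp (-z ^ 2))).1 (by rw [himg]; exact hg.integrableOn)
    refine h1.congr_fun (fun s hs => ?_) measurableSet_Ioi
    have hs' : 0 < s := hs
    simp only [smul_eq_mul]
    rw [abs_of_pos (by positivity)]
  have hmeas : Measurable fun s => Real.exp (-(φ s) ^ 2) := by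
    simp only [hφ]; fun_prop
  have hI1 : IntegrableOn (fun s => y * Real.exp (-(φ s) ^ 2)) (Ioi 0) := by
    refine hI.mono' (hmeas.const_mul y).aestronglyMeasurable ?_
    filter_upwards [ae_restrict_mem measurableSet_Ioi] with s hs
    have hs' : 0 < s := hs
    rw [Real.norm_of_nonneg (by positivity)]
    gcongr
    exact le_add_of_nonneg_right (by positivity)
  have hI2 : IntegrableOn (fun s => r / (2 * s ^ 2) * Real.exp (-(φ s) ^ 2)) (Ioi 0) := by
    refine (hI.sub hI1).congr_fun (fun s _ => ?_) measurableSet_Ioi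
    simp only [Pi.sub_apply]; ring
  have e1 : √Real.pi = (∫ s in Ioi (0 : ℝ), y * Real.exp (-(φ s) ^ 2)) +
      ∫ s in Ioi (0 : ℝ), r / (2 * s ^ 2) * Real.exp (-(φ s) ^ 2) := by
    rw [← integral_add hI1 hI2]
    have h1 := integral_image_eq_integral_abs_deriv_smul measurableSet_Ioi hφ' hinj
      (fun z => Real.exp (-z ^ 2))
    have h2 := integral_gaussian 1
    rw [himg, setIntegral_univ] at h1
    simp only [neg_mul, one_mul, div_one] at h2
    rw [← h2, h1]
    refine setIntegral_congr_fun measurableSet_Ioi fun s hs => ?_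
    have hs' : 0 < s := hs
    simp only [smul_eq_mul]
    rw [abs_of_pos (by positivity)]
    ring
  have e2 : (∫ s in Ioi (0 : ℝ), y * Real.exp (-(φ s) ^ 2)) =
      ∫ s in Ioi (0 : ℝ), r / (2 * s ^ 2) * Real.exp (-(φ s) ^ 2) := by
    have h1 := integral_image_eq_integral_abs_deriv_smul measurableSet_Ioi hψ' hψinj
      (fun s => y * Real.exp (-(φ s) ^ 2))
    rw [hψimg] at h1
    rw [h1]
    refine setIntegral_congr_fun measurableSet_Ioi fun s hs => ?_
    have hs' : 0 < s := hs
    have hφψ : φ (r / (2 * y) * s⁻¹) = -φ s := by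
      simp only [hφ]; field_simp; ring
    simp only [smul_eq_mul]
    rw [hφψ, abs_neg, abs_of_pos (by positivity), neg_sq]
    field_simp
  rw [← e2, integral_const_mul] at e1
  rw [eq_div_iff (by positivity), e1]
  ring

/-- The subordination of the exponential function to Gaussians. -/
lemma integral_exp_neg_sq_mul_sq_sub {y r : ℝ} (hy : 0 < y) (hr : 0 < r) :
    ∫ s in Ioi (0 : ℝ), Real.exp (-y ^ 2 * s ^ 2 - r ^ 2 / (4 * s ^ 2)) =
      √Real.pi / (2 * y) * Real.exp (-y * r) := by
  rw [← integral_exp_neg_sq_sub_div hy hr, ← integral_mul_const]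
  refine setIntegral_congr_fun measurableSet_Ioi fun s hs => ?_
  have hs' : 0 < s := hs
  rw [← Real.exp_add]
  congr 1
  field_simp
  ring

lemma integral_cexp_inner_mul_exp_neg_sq_div (v : E m) {s : ℝ} (hs : 0 < s) :
    ∫ ξ : E m, Complex.exp (Complex.I * (inner ℝ v ξ : ℝ)) *
        (Real.exp (-(‖ξ‖ ^ 2 / (4 * s ^ 2))) : ℝ) =
      (((2 * √Real.pi) ^ m * (s ^ m * Real.exp (-s ^ 2 * ‖v‖ ^ 2)) : ℝ) : ℂ) := by
  have h1 := GaussianFourier.integral_cexp_neg_mul_sq_norm_add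
    (b := ((1 / (4 * s ^ 2) : ℝ) : ℂ)) (by rw [Complex.ofReal_re]; positivity) Complex.I v
  have h2 : ((Real.pi : ℂ) / ((1 / (4 * s ^ 2) : ℝ) : ℂ)) ^ (Module.finrank ℝ (E m) / 2 : ℂ) =
      (((2 * √Real.pi) ^ m * s ^ m : ℝ) : ℂ) := by
    have h3 : Real.pi / (1 / (4 * s ^ 2)) = (2 * √Real.pi * s) ^ 2 := by
      rw [mul_pow, mul_pow, Real.sq_sqrt Real.pi_pos.le]; field_simp; norm_num
    have h4 : ((Module.finrank ℝ (E m) / 2 : ℂ)) = ((m / 2 : ℝ) : ℂ) := by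
      rw [finrank_euclideanSpace_fin]; push_cast; rfl
    rw [h4, ← Complex.ofReal_div, h3, ← Complex.ofReal_cpow (by positivity), ← Real.rpow_natCast,
      ← Real.rpow_mul (by positivity), ← mul_pow, ← Real.rpow_natCast]
    congr 2
    push_cast
    ring
  rw [h2] at h1
  have h5 : (((2 * √Real.pi) ^ m * (s ^ m * Real.exp (-s ^ 2 * ‖v‖ ^ 2)) : ℝ) : ℂ) =
      (((2 * √Real.pi) ^ m * s ^ m : ℝ) : ℂ) *
        Complex.exp (Complex.I ^ 2 * ‖v‖ ^ 2 / (4 * ((1 / (4 * s ^ 2) : ℝ) : ℂ))) := by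
    rw [← mul_assoc, Complex.ofReal_mul, Complex.ofReal_exp]
    congr 2
    rw [Complex.I_sq]
    push_cast
    have : (s : ℂ) ≠ 0 := by exact_mod_cast hs.ne'
    field_simp
  rw [h5, ← h1]
  refine integral_congr_ae (Filter.Eventually.of_forall fun ξ => ?_)
  simp only
  rw [Complex.ofReal_exp, ← Complex.exp_add]
  congr 1
  push_cast
  ring

/-- A non-integrable function would have integral `0` by convention, whereas the value already
computed at `v = 0` is positive. -/
lemma integrable_exp_neg_sq_div {s : ℝ} (hs : 0 < s) :
    Integrable fun ξ : E m => Real.exp (-(‖ξ‖ ^ 2 / (4 * s ^ 2))) := by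
  by_contra h
  have h1 := integral_cexp_inner_mul_exp_neg_sq_div (0 : E m) hs
  have h2 : (∫ ξ : E m, ((Real.exp (-(‖ξ‖ ^ 2 / (4 * s ^ 2))) : ℝ) : ℂ)) = 0 := by
    rw [integral_complex_ofReal, integral_undef h, Complex.ofReal_zero]
  simp only [inner_zero_left, Complex.ofReal_zero, mul_zero, Complex.exp_zero, one_mul, h2] at h1
  have h3 : 0 < (2 * √Real.pi) ^ m * (s ^ m * Real.exp (-s ^ 2 * ‖(0 : E m)‖ ^ 2)) := by positivity
  exact h3.ne (by exact_mod_cast h1)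

lemma integral_exp_neg_sq_div {s : ℝ} (hs : 0 < s) :
    ∫ ξ : E m, Real.exp (-(‖ξ‖ ^ 2 / (4 * s ^ 2))) = (2 * √Real.pi) ^ m * s ^ m := by
  have h1 := integral_cexp_inner_mul_exp_neg_sq_div (0 : E m) hs
  simp only [inner_zero_left, Complex.ofReal_zero, mul_zero, Complex.exp_zero, one_mul, norm_zero,
    integral_complex_ofReal, Complex.ofReal_inj] at h1
  simpa using h1

lemma integrableOn_pow_mul_exp_neg_mul_sq (m : ℕ) {b : ℝ} (hb : 0 < b) :
    IntegrableOn (fun s : ℝ => s ^ m * Real.exp (-b * s ^ 2)) (Ioi 0) := by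
  simpa using integrableOn_rpow_mul_exp_neg_mul_sq hb (s := (m : ℝ))
    (by have : (0 : ℝ) ≤ m := m.cast_nonneg
        linarith)

lemma integral_pow_mul_exp_neg_sq (m : ℕ) {ρ : ℝ} (hρ : 0 < ρ) :
    ∫ s in Ioi (0 : ℝ), s ^ m * Real.exp (-ρ ^ 2 * s ^ 2) =
      Real.Gamma (((m : ℝ) + 1) / 2) / 2 / ρ ^ (m + 1) := by
  have h := integral_rpow_mul_exp_neg_mul_rpow (p := 2) (q := (m : ℝ)) (b := ρ ^ 2) two_pos
    (by have : (0 : ℝ) ≤ m := m.cast_nonneg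
        linarith) (by positivity)
  have h2 : (ρ ^ 2) ^ (-((m : ℝ) + 1) / 2) = (ρ ^ (m + 1))⁻¹ := by
    rw [← Real.rpow_natCast ρ 2, ← Real.rpow_mul hρ.le, ← Real.rpow_natCast ρ (m + 1),
      ← Real.rpow_neg hρ.le]
    congr 1
    push_cast
    ring
  rw [h2] at h
  simp only [Real.rpow_natCast, Real.rpow_two] at h
  rw [h]
  field_simp

/-- The Poisson kernel as a Fourier integral. -/
lemma integral_cexp_inner_mul_exp_neg_mul_norm {y : ℝ} (hy : 0 < y) (hm : 1 ≤ m) (v : E m) :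
    twoPiInv m * ∫ ξ : E m, Complex.exp (Complex.I * (inner ℝ v ξ : ℝ)) *
        (Real.exp (-y * ‖ξ‖) : ℝ) =
      ((y / sigma m / √(y ^ 2 + ‖v‖ ^ 2) ^ (m + 1) : ℝ) : ℂ) := by
  set ρ := √(y ^ 2 + ‖v‖ ^ 2) with hρ
  have hρ0 : 0 < ρ := Real.sqrt_pos.2 (by positivity)
  have hρ2 : ρ ^ 2 = y ^ 2 + ‖v‖ ^ 2 := Real.sq_sqrt (by positivity)
  -- Subordination: integrating `f ξ` over `s > 0` gives `√π/(2y) · e^{i⟨v,ξ⟩} e^{-y|ξ|}` for `ξ ≠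
  -- 0`. In the other order, the `ξ`-integral is Gaussian and the `s`-integral is a Gamma integral.
  set f : E m → ℝ → ℂ := fun ξ s => Complex.exp (Complex.I * (inner ℝ v ξ : ℝ)) *
    (Real.exp (-y ^ 2 * s ^ 2 - ‖ξ‖ ^ 2 / (4 * s ^ 2)) : ℝ) with hf
  have hnf : ∀ ξ s, ‖f ξ s‖ = Real.exp (-y ^ 2 * s ^ 2 - ‖ξ‖ ^ 2 / (4 * s ^ 2)) := by
    intro ξ s
    rw [hf, norm_mul, norm_cexp_I_mul_ofReal, one_mul, Complex.norm_real, Real.norm_eq_abs,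
      Real.abs_exp]
  have hsplit : ∀ (ξ : E m) (s : ℝ), Real.exp (-y ^ 2 * s ^ 2 - ‖ξ‖ ^ 2 / (4 * s ^ 2)) =
      Real.exp (-y ^ 2 * s ^ 2) * Real.exp (-(‖ξ‖ ^ 2 / (4 * s ^ 2))) := by
    intro ξ s
    rw [← Real.exp_add]; rfl
  have hmeas : Measurable (Function.uncurry f) := by
    simp only [hf, Function.uncurry_def]
    fun_prop
  have hint : Integrable (Function.uncurry f)
      ((volume : Measure (E m)).prod (volume.restrict (Ioi (0 : ℝ)))) := by
    rw [integrable_prod_iff' hmeas.aestronglyMeasurable]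
    constructor
    · filter_upwards [ae_restrict_mem measurableSet_Ioi] with s hs
      refine ((integrable_exp_neg_sq_div hs).const_mul (Real.exp (-y ^ 2 * s ^ 2))).mono'
        (hmeas.comp measurable_prodMk_right).aestronglyMeasurable ?_
      exact Filter.Eventually.of_forall fun ξ => ((hnf ξ s).trans (hsplit ξ s)).le
    · have h1 := (integrableOn_pow_mul_exp_neg_mul_sq m (sq_pos_of_pos hy)).const_mul
        ((2 * √Real.pi) ^ m)
      refine IntegrableOn.congr_fun h1 (fun s hs => ?_) measurableSet_Ioi
      simp only [Function.uncurry_apply_pair, hnf, hsplit]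
      rw [integral_const_mul, integral_exp_neg_sq_div hs]
      ring
  have hswap := integral_integral_swap hint
  have hL : ∫ ξ, ∫ s in Ioi (0 : ℝ), f ξ s = ((√Real.pi / (2 * y) : ℝ) : ℂ) *
      ∫ ξ : E m, Complex.exp (Complex.I * (inner ℝ v ξ : ℝ)) * (Real.exp (-y * ‖ξ‖) : ℝ) := by
    rw [← integral_const_mul]
    have hne : ∀ᵐ ξ : E m, ξ ≠ 0 := by
      have : Nonempty (Fin m) := ⟨⟨0, hm⟩⟩
      exact Measure.ae_ne volume 0
    refine integral_congr_ae ?_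
    filter_upwards [hne] with ξ hξ
    simp only [hf]
    rw [integral_const_mul, integral_complex_ofReal,
      integral_exp_neg_sq_mul_sq_sub hy (norm_pos_iff.2 hξ)]
    push_cast
    ring
  have hR : ∫ s in Ioi (0 : ℝ), ∫ ξ, f ξ s = (((2 * √Real.pi) ^ m *
      (Real.Gamma (((m : ℝ) + 1) / 2) / 2 / ρ ^ (m + 1)) : ℝ) : ℂ) := by
    rw [← integral_pow_mul_exp_neg_sq m hρ0, ← integral_const_mul, ← integral_complex_ofReal]
    refine setIntegral_congr_fun measurableSet_Ioi fun s hs => ?_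
    have h1 := integral_cexp_inner_mul_exp_neg_sq_div v (mem_Ioi.1 hs)
    have h2 : ∫ ξ, f ξ s = ((Real.exp (-y ^ 2 * s ^ 2) : ℝ) : ℂ) *
        ∫ ξ : E m, Complex.exp (Complex.I * (inner ℝ v ξ : ℝ)) *
          (Real.exp (-(‖ξ‖ ^ 2 / (4 * s ^ 2))) : ℝ) := by
      rw [← integral_const_mul]
      refine integral_congr_ae (Filter.Eventually.of_forall fun ξ => ?_)
      simp only [hf, hsplit]
      push_cast
      ring
    rw [h2, h1, ← Complex.ofReal_mul, Complex.ofReal_inj, hρ2]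
    have h3 : Real.exp (-(y ^ 2 + ‖v‖ ^ 2) * s ^ 2) =
        Real.exp (-y ^ 2 * s ^ 2) * Real.exp (-s ^ 2 * ‖v‖ ^ 2) := by
      rw [← Real.exp_add]; congr 1; ring
    rw [h3]
    ring
  rw [hL, hR] at hswap
  have hG : 0 < Real.Gamma (((m : ℝ) + 1) / 2) := Real.Gamma_pos_of_pos (by positivity)
  have hpi : Real.pi ^ (((m : ℝ) + 1) / 2) = √Real.pi ^ (m + 1) := by
    rw [Real.sqrt_eq_rpow, ← Real.rpow_natCast, ← Real.rpow_mul Real.pi_pos.le]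
    congr 1
    push_cast
    ring
  have hsq : √Real.pi ^ 2 = Real.pi := Real.sq_sqrt Real.pi_pos.le
  have hsp : 0 < √Real.pi := Real.sqrt_pos.2 Real.pi_pos
  have hc : ((√Real.pi / (2 * y) : ℝ) : ℂ) ≠ 0 := by
    rw [Complex.ofReal_ne_zero]; positivity
  refine mul_left_cancel₀ hc ?_
  rw [mul_left_comm, hswap, ← Complex.ofReal_mul, ← Complex.ofReal_mul, Complex.ofReal_inj,
    twoPiInv, sigma, hpi, ← hsq]
  simp only [Real.sqrt_sq hsp.le]
  field_simp
  ring

/-! ### The Cauchy kernel as a Fourier integral -/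

/-- A negative exponent makes the calculus of `expSynth` available for bounded densities: for `σ =
-1` the condition `σ x_0 < a` says `x_0 > -a`. The later choice `a = -x_0 / 2` leaves room around a
given point with `x_0 > 0`. -/
lemma weightedL2_of_norm_le_one {a : ℝ} (ha : a < 0) {h : E m → Cl m} (hh : StronglyMeasurable h)
    (hb : ∀ ξ, ‖h ξ‖ ≤ 1) : WeightedL2 a h := by
  refine MemLp.of_le (memLp_exp_neg_mul_norm (m := m) (neg_pos.2 ha)) ?_
    (Filter.Eventually.of_forall fun ξ => ?_)
  · exact (Continuous.aestronglyMeasurable (f := fun ξ : E m => Real.exp (a * ‖ξ‖))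
      (by fun_prop)).smul hh.aestronglyMeasurable
  · rw [norm_smul, neg_neg]
    exact mul_le_of_le_one_right (norm_nonneg _) (hb ξ)

lemma hasDerivAt_inv_sqrt_pow (m : ℕ) {N : ℝ → ℝ} {N' s : ℝ} (hN : HasDerivAt N N' s)
    (h0 : 0 < N s) :
    HasDerivAt (fun s => (√(N s) ^ (m + 1))⁻¹) (-((m + 1) / 2 * N' / √(N s) ^ (m + 3))) s := by
  have hρ : 0 < √(N s) := Real.sqrt_pos.2 h0
  refine (((hN.sqrt h0.ne').pow (m + 1)).inv (by simp only [Pi.pow_apply]; positivity)).congr_deriv ?_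
  simp only [Pi.pow_apply, Nat.add_sub_cancel, Nat.cast_add, Nat.cast_one]
  field_simp
  ring

lemma expSynth_one {x : ℝ × E m} (hm : 1 ≤ m) (hx : 0 < x.1) :
    expSynth (-1) (fun _ => (1 : Cl m)) x =
      (x.1 / sigma m * (√(x.1 ^ 2 + ‖x.2‖ ^ 2) ^ (m + 1))⁻¹) • (1 : Cl m) := by
  have h := integral_cexp_inner_mul_exp_neg_mul_norm hx hm x.2
  rw [expSynth, integral_smul_const, ← Complex.coe_smul, smul_smul, ← Complex.coe_smul]
  congr 1
  rw [← div_eq_mul_inv, ← h]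
  congr 2
  ext1 ξ
  rw [phase_apply, Complex.exp_add, ← Complex.ofReal_exp, neg_one_mul]

lemma hasDerivAt_expSynth_line {a σ : ℝ} {h : E m → Cl m} (hh : WeightedL2 a h) {x : ℝ × E m}
    (hx : σ * x.1 < a) (y : ℝ × E m) :
    HasDerivAt (fun s : ℝ => expSynth σ h (x + s • y))
      ((twoPiInv m • ∫ ξ, expSynthDeriv σ h x ξ) y) 0 := by
  have h1 : HasDerivAt (fun s : ℝ => x + s • y) y 0 := by
    simpa using ((hasDerivAt_id (0 : ℝ)).smul_const y).const_add x
  have h2 : HasFDerivAt (expSynth σ h) (twoPiInv m • ∫ ξ, expSynthDeriv σ h x ξ)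
      (x + (0 : ℝ) • y) := by
    rw [zero_smul, add_zero]; exact hasFDerivAt_expSynth hh hx
  exact h2.comp_hasDerivAt 0 h1

/-- The derivative of the Poisson kernel in a direction of `ℝ^m`. -/
lemma expSynthDeriv_one_apply {x : ℝ × E m} (hm : 1 ≤ m) (hx : 0 < x.1) (w : E m) :
    (twoPiInv m • ∫ ξ, expSynthDeriv (-1) (fun _ => (1 : Cl m)) x ξ) (0, w) =
      (-((m + 1) * x.1 / sigma m / √(x.1 ^ 2 + ‖x.2‖ ^ 2) ^ (m + 3)) * inner ℝ x.2 w) •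
        (1 : Cl m) := by
  have h1 := hasDerivAt_expSynth_line (weightedL2_of_norm_le_one (a := -x.1 / 2) (by linarith)
    (stronglyMeasurable_const (b := (1 : Cl m))) fun _ => norm_one_cl.le)
    (σ := -1) (x := x) (by linarith) (0, w)
  have hN : HasDerivAt (fun s : ℝ => x.1 ^ 2 + ‖x.2 + s • w‖ ^ 2) (2 * inner ℝ x.2 w) 0 := by
    have h2 : HasDerivAt (fun s : ℝ => x.2 + s • w) w 0 := by
      simpa using ((hasDerivAt_id (0 : ℝ)).smul_const w).const_add x.2
    simpa using h2.norm_sq.const_add (x.1 ^ 2)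
  have h3 := (((hasDerivAt_inv_sqrt_pow m hN (by positivity)).const_mul
    (x.1 / sigma m)).smul_const (1 : Cl m))
  have h4 : (fun s : ℝ => expSynth (-1) (fun _ => (1 : Cl m)) (x + s • (0, w))) =
      fun s : ℝ => (x.1 / sigma m * (√(x.1 ^ 2 + ‖x.2 + s • w‖ ^ 2) ^ (m + 1))⁻¹) • (1 : Cl m) := by
    ext1 s
    rw [expSynth_one hm (by simpa using hx)]
    simp
  rw [h4] at h1
  rw [h1.unique h3]
  congr 1
  simp only [zero_smul, add_zero]
  ring

/-- The relation between the conjugate Poisson kernels and the Poisson kernel. -/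
lemma expSynthDeriv_unitVec_apply {x : ℝ × E m} (hx : 0 < x.1) :
    (twoPiInv m • ∫ ξ, expSynthDeriv (-1) (fun ξ => (Complex.I / (‖ξ‖ : ℂ)) • vec ξ) x ξ) (1, 0) =
      -∑ k, gen k * (twoPiInv m • ∫ ξ, expSynthDeriv (-1) (fun _ => (1 : Cl m)) x ξ)
        (0, EuclideanSpace.single k 1) := by
  have hQ := weightedL2_of_norm_le_one (a := -x.1 / 2) (by linarith)
    (stronglyMeasurable_unitVec (m := m)) norm_I_div_smul_vec_le
  have hP := weightedL2_of_norm_le_one (a := -x.1 / 2) (by linarith)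
    (stronglyMeasurable_const (b := (1 : Cl m)) (α := E m)) fun _ => norm_one_cl.le
  have hσ : -1 * x.1 < -x.1 / 2 := by linarith
  -- Subtracting the Dirac operator from `∂_0` leaves `-∑ e_k ∂_k`, whose symbol is `-iξ`. It equals
  -- the symbol `-|ξ|` of `∂_0` times `iξ/|ξ|`.
  set Λ : (ℝ × E m →L[ℝ] Cl m) →L[ℝ] Cl m :=
    ContinuousLinearMap.apply ℝ (Cl m) ((1, 0) : ℝ × E m) - diracL with hΛ
  have hΛ' : ∀ A : ℝ × E m →L[ℝ] Cl m,
      Λ A = -∑ k, gen k * A (0, EuclideanSpace.single k 1) := by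
    intro A
    rw [hΛ, sub_apply, diracL_apply, ContinuousLinearMap.apply_apply]
    abel
  rw [← hΛ', map_smul, ← ContinuousLinearMap.integral_comp_comm _ (integrable_expSynthDeriv hP hσ),
    smul_apply, ContinuousLinearMap.integral_apply
      (integrable_expSynthDeriv hQ hσ)]
  congr 2
  ext1 ξ
  have h0 : phase (-1) ξ ((1, 0) : ℝ × E m) = -(‖ξ‖ : ℂ) := by
    rw [phase_apply]; simp
  rw [hΛ, sub_apply, diracL_expSynthDeriv, ContinuousLinearMap.apply_apply,
    expSynthDeriv_apply, expSynthDeriv_apply, h0]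
  rcases eq_or_ne ξ 0 with rfl | hξ
  · simp
  · have h1 : (‖ξ‖ : ℂ) ≠ 0 := by exact_mod_cast (norm_pos_iff.2 hξ).ne'
    rw [← smul_sub]
    congr 1
    have h2 : (-(‖ξ‖ : ℂ)) * (Complex.I / (‖ξ‖ : ℂ)) = -Complex.I := by field_simp
    rw [smul_smul, h2, mul_one, neg_one_mul, Complex.ofReal_neg, sub_add_cancel_left, neg_smul]

/-- Differentiating in `t` cancels the `1/|ξ|` in the density; the derivative is then minus the
Dirac gradient of the Poisson kernel, which is explicit. -/
lemma hasDerivAt_expSynth_unitVec {t : ℝ} (hm : 1 ≤ m) (ht : 0 < t) (v : E m) :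
    HasDerivAt (fun t : ℝ => expSynth (-1) (fun ξ => (Complex.I / (‖ξ‖ : ℂ)) • vec ξ) (t, v))
      (((m + 1) * t / sigma m / √(t ^ 2 + ‖v‖ ^ 2) ^ (m + 3)) • vec v) t := by
  have h1 := hasFDerivAt_expSynth (weightedL2_of_norm_le_one (a := -t / 2) (by linarith)
    (stronglyMeasurable_unitVec (m := m)) norm_I_div_smul_vec_le) (σ := -1) (x := (t, v))
    (by simp only; linarith)
  have h2 : HasDerivAt (fun s : ℝ => (s, v)) ((1 : ℝ), (0 : E m)) t :=
    (hasDerivAt_id t).prodMk (hasDerivAt_const t v)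
  refine (h1.comp_hasDerivAt t h2).congr_deriv ?_
  rw [expSynthDeriv_unitVec_apply ht]
  simp only [expSynthDeriv_one_apply (x := (t, v)) hm ht]
  rw [vec, Finset.smul_sum, ← Finset.sum_neg_distrib]
  refine Finset.sum_congr rfl fun k _ => ?_
  rw [mul_smul_comm, mul_one, ← neg_smul, Complex.coe_smul, smul_smul,
    EuclideanSpace.inner_single_right]
  congr 1
  simp

open Filter in
-- Dominated convergence with majorant `e^{-|ξ|}` for `t ≥ 1`. This fixes the constant of
-- integration in `t`.
lemma tendsto_expSynth_neg_one_atTop (hm : 1 ≤ m) {h : E m → Cl m} (hh : StronglyMeasurable h)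
    (hb : ∀ ξ, ‖h ξ‖ ≤ 1) (v : E m) :
    Tendsto (fun t : ℝ => expSynth (-1) h (t, v)) atTop (nhds 0) := by
  have h1 : Tendsto (fun t : ℝ => ∫ ξ, Complex.exp (phase (-1) ξ (t, v)) • h ξ) atTop
      (nhds (∫ _ : E m, (0 : Cl m))) := by
    have hn : ∀ (t : ℝ) (ξ : E m),
        ‖Complex.exp (phase (-1) ξ (t, v)) • h ξ‖ ≤ Real.exp (-t * ‖ξ‖) := by
      intro t ξ
      rw [norm_smul, norm_cexp_phase, neg_one_mul]
      exact mul_le_of_le_one_right (Real.exp_pos _).le (hb ξ)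
    refine tendsto_integral_filter_of_dominated_convergence (fun ξ => Real.exp (-1 * ‖ξ‖)) ?_ ?_
      (integrable_exp_neg_mul_norm one_pos) ?_
    · exact Eventually.of_forall fun t => ((Complex.continuous_exp.comp
        ((continuous_phase (-1)).clm_apply continuous_const)).aestronglyMeasurable).smul
          hh.aestronglyMeasurable
    · filter_upwards [eventually_ge_atTop 1] with t ht
      refine Eventually.of_forall fun ξ => (hn t ξ).trans ?_
      gcongr
    · have : Nonempty (Fin m) := ⟨⟨0, hm⟩⟩
      filter_upwards [Measure.ae_ne volume (0 : E m)] with ξ hξ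
      refine squeeze_zero_norm (hn · ξ) ?_
      refine Real.tendsto_exp_atBot.comp ?_
      simp only [neg_mul]
      exact tendsto_neg_atTop_atBot.comp (tendsto_id.atTop_mul_const (norm_pos_iff.2 hξ))
  simpa [expSynth] using h1.const_smul (twoPiInv m)

open Filter in
lemma tendsto_inv_sqrt_pow_atTop (m : ℕ) (c : ℝ) :
    Tendsto (fun t : ℝ => (√(t ^ 2 + c ^ 2) ^ (m + 1))⁻¹) atTop (nhds 0) := by
  refine tendsto_inv_atTop_zero.comp ((tendsto_pow_atTop m.succ_ne_zero).comp ?_)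
  refine tendsto_atTop_mono (fun t => ?_) tendsto_id
  exact Real.le_sqrt_of_sq_le (le_add_of_nonneg_right (sq_nonneg c))

/-- The conjugate Poisson kernels as a Fourier integral. -/
lemma expSynth_unitVec {x : ℝ × E m} (hm : 1 ≤ m) (hx : 0 < x.1) :
    expSynth (-1) (fun ξ => (Complex.I / (‖ξ‖ : ℂ)) • vec ξ) x =
      -((1 / sigma m * (√(x.1 ^ 2 + ‖x.2‖ ^ 2) ^ (m + 1))⁻¹) • vec x.2) := by
  obtain ⟨t, v⟩ := x
  -- The difference of the two sides has zero derivative on `t > 0` and tends to zero as `t → ∞`, so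
  -- it vanishes.
  set D : ℝ → Cl m := fun t =>
    expSynth (-1) (fun ξ => (Complex.I / (‖ξ‖ : ℂ)) • vec ξ) (t, v) +
      (1 / sigma m * (√(t ^ 2 + ‖v‖ ^ 2) ^ (m + 1))⁻¹) • vec v with hD
  have hd : ∀ t ∈ Ioi (0 : ℝ), HasDerivAt D 0 t := by
    intro t ht
    have ht' : 0 < t := ht
    have hN : HasDerivAt (fun t : ℝ => t ^ 2 + ‖v‖ ^ 2) (2 * t) t := by
      simpa using (hasDerivAt_pow 2 t).add_const (‖v‖ ^ 2)
    refine ((hasDerivAt_expSynth_unitVec hm ht v).add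
      (((hasDerivAt_inv_sqrt_pow m hN (by positivity)).const_mul
        (1 / sigma m)).smul_const (vec v))).congr_deriv ?_
    rw [← add_smul]
    convert! zero_smul ℝ (vec v) using 2
    ring
  have hc : ∀ s ∈ Ioi (0 : ℝ), D s = D t := fun s hs =>
    isOpen_Ioi.is_const_of_deriv_eq_zero isPreconnected_Ioi
      (fun u hu => (hd u hu).differentiableAt.differentiableWithinAt)
      (fun u hu => (hd u hu).deriv) hs hx
  have hlim : Filter.Tendsto D Filter.atTop (nhds 0) := by
    have h1 := (tendsto_expSynth_neg_one_atTop hm (stronglyMeasurable_unitVec (m := m))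
      norm_I_div_smul_vec_le v).add
      (((tendsto_inv_sqrt_pow_atTop m ‖v‖).const_mul (1 / sigma m)).smul_const (vec v))
    simpa [hD] using h1
  have h0 : D t = 0 := tendsto_nhds_unique
    (tendsto_const_nhds.congr' ((Filter.eventually_gt_atTop 0).mono fun s hs => (hc s hs).symm)) hlim
  exact eq_neg_of_add_eq_zero_left h0

lemma integrable_eP {y : ℝ × E m} (hy : 0 < y.1) : Integrable (eP y) :=
  (integrable_exp_neg_mul_norm hy).mono' (stronglyMeasurable_eP y).aestronglyMeasurable
    (Filter.Eventually.of_forall (norm_eP_le y))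

lemma norm_para (x : ℝ × E m) : ‖para x‖ = √(x.1 ^ 2 + ‖x.2‖ ^ 2) := by
  rw [← norm_para_sq, Real.sqrt_sq (norm_nonneg _)]

/-- The Cauchy kernel as the Fourier integral of the monogenic exponentials. -/
lemma integral_eP {y : ℝ × E m} (hm : 1 ≤ m) (hy : 0 < y.1) :
    twoPiInv m • ∫ ξ, eP y ξ = cauchyKernel y := by
  have hσ : -1 * y.1 < -y.1 / 2 := by linarith
  have h1 := integrable_cexp_phase_smul (weightedL2_of_norm_le_one (a := -y.1 / 2) (by linarith)
    (stronglyMeasurable_const (b := (1 : Cl m)) (α := E m)) fun _ => norm_one_cl.le) hσ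
  have h2 := integrable_cexp_phase_smul (weightedL2_of_norm_le_one (a := -y.1 / 2) (by linarith)
    (stronglyMeasurable_unitVec (m := m)) norm_I_div_smul_vec_le) hσ
  have h3 : ∀ ξ, eP y ξ = (1 / 2 : ℂ) • (Complex.exp (phase (-1) ξ y) • (1 : Cl m) +
      Complex.exp (phase (-1) ξ y) • (Complex.I / (‖ξ‖ : ℂ)) • vec ξ) := by
    intro ξ
    rw [eP_eq_cexp_phase, chiP, smul_comm, smul_add]
  simp only [h3]
  rw [integral_smul, integral_add h1 h2, smul_comm, smul_add]
  change (1 / 2 : ℂ) • (expSynth (-1) (fun _ => (1 : Cl m)) y +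
    expSynth (-1) (fun ξ => (Complex.I / (‖ξ‖ : ℂ)) • vec ξ) y) = _
  rw [expSynth_one hm hy, expSynth_unitVec hm hy, cauchyKernel, norm_para, para, pconj, vec_neg,
    Complex.coe_smul, show (1 / 2 : ℂ) = ((1 / 2 : ℝ) : ℂ) by push_cast; rfl, Complex.coe_smul]
  simp only [smul_add, smul_neg, smul_smul]
  congr 1
  · congr 1; ring
  · congr 2; ring

lemma chiM_eq_chiP_neg (ξ : E m) : chiM ξ = chiP (-ξ) := by
  rw [chiM, chiP, norm_neg, vec_neg, smul_neg, sub_eq_add_neg]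

/-- The reflection `ξ ↦ -ξ` exchanges `χ_+` and `χ_-`, which reduces the lower half-space to the
upper one. -/
lemma eM_eq_eP_neg (y : ℝ × E m) (ξ : E m) : eM y ξ = eP (-y) (-ξ) := by
  rw [eM, eP, chiM_eq_chiP_neg]
  simp

lemma cauchyKernel_neg (y : ℝ × E m) : cauchyKernel (-y) = -cauchyKernel y := by
  have h1 : ∀ x : ℝ × E m, para (-x) = -para x := fun x => by
    simp [para, vec_neg, add_comm]
  rw [cauchyKernel, cauchyKernel, h1, norm_neg, show pconj (-y) = -pconj y from rfl, h1, smul_neg]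

lemma integrable_eM {y : ℝ × E m} (hy : y.1 < 0) : Integrable (eM y) := by
  have h1 := (integrable_eP (y := -y) (by simpa using hy)).comp_neg
  simpa only [← eM_eq_eP_neg] using h1

lemma integral_eM {y : ℝ × E m} (hm : 1 ≤ m) (hy : y.1 < 0) :
    twoPiInv m • ∫ ξ, eM y ξ = -cauchyKernel y := by
  simp only [eM_eq_eP_neg]
  rw [integral_neg_eq_self (eP (-y)) volume, integral_eP hm (by simpa using hy), cauchyKernel_neg]

/-- The damping is a translation in `x_0`: upwards by `2a` for `e⁺` and, in the companion lemma,
downwards for `e⁻`. -/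
lemma exp_smul_eP (a : ℝ) (y : ℝ × E m) (ξ : E m) :
    Real.exp (-2 * a * ‖ξ‖) • eP y ξ = eP (y + (2 * a, 0)) ξ := by
  rw [eP, eP, ← Complex.coe_smul, smul_smul, mul_left_comm, ← Complex.ofReal_mul, ← Real.exp_add]
  congr 5
  · simp
  · simp; ring

lemma exp_smul_eM (a : ℝ) (y : ℝ × E m) (ξ : E m) :
    Real.exp (-2 * a * ‖ξ‖) • eM y ξ = eM (y - (2 * a, 0)) ξ := by
  rw [eM, eM, ← Complex.coe_smul, smul_smul, mul_left_comm, ← Complex.ofReal_mul, ← Real.exp_add]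
  congr 5
  · simp
  · simp; ring

/-- The closed form of the Szegő kernel through the Cauchy kernel. -/
lemma szego_closed_form {a : ℝ} (hm : 1 ≤ m) {w x : ℝ × E m} (hw : w.1 ∈ Ioo (-a) a)
    (hx : x.1 ∈ Ioo (-a) a) :
    Integrable (fun ξ : E m => Real.exp (-2 * a * ‖ξ‖) • eP (w + pconj x) ξ) ∧
    Integrable (fun ξ : E m => Real.exp (-2 * a * ‖ξ‖) • eM (w + pconj x) ξ) ∧
    twoPiInv m • (∫ ξ : E m, Real.exp (-2 * a * ‖ξ‖) • eP (w + pconj x) ξ) =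
      cauchyKernel (w + pconj x + (2 * a, 0)) ∧
    twoPiInv m • (∫ ξ : E m, Real.exp (-2 * a * ‖ξ‖) • eM (w + pconj x) ξ) =
      -cauchyKernel (w + pconj x - (2 * a, 0)) ∧
    szego a w x =
      cauchyKernel (w + pconj x + (2 * a, 0)) - cauchyKernel (w + pconj x - (2 * a, 0)) := by
  -- Since `w_0 + x_0` lies in `(-2a, 2a)`, the shifted arguments fall in the half-spaces where the
  -- respective integrals converge.
  have hp : 0 < (w + pconj x + (2 * a, 0)).1 := by
    change 0 < w.1 + x.1 + 2 * a
    linarith [hw.1, hx.1]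
  have hn : (w + pconj x - (2 * a, 0)).1 < 0 := by
    change w.1 + x.1 - 2 * a < 0
    linarith [hw.2, hx.2]
  rw [szego]
  simp only [monoExp, smul_add, exp_smul_eP, exp_smul_eM]
  refine ⟨integrable_eP hp, integrable_eM hn, integral_eP hm hp, integral_eM hm hn, ?_⟩
  rw [integral_add (integrable_eP hp) (integrable_eM hn), smul_add, integral_eP hm hp,
    integral_eM hm hn]
  exact (sub_eq_add_neg _ _).symm

end PWStrip

end

/-! ### Assembly of the three parts. -/

theorem theorem3p1 (m : ℕ) (hm : 1 ≤ m) (a : ℝ) (ha : 0 < a) :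
    -- Paley-Wiener characterization of the restrictions to `ℝ^m` of functions in `H²(S_a)`
    (∀ f : L2 m,
      ((∃ F : ℝ × E m → Cl m, MemHardy (Ioo (-a) a) F ∧ IsRestriction f F) ↔
        ∃ (g : E m → Cl m) (F : ℝ × E m → Cl m),
          WeightedL2 a g ∧ Represents a g F ∧ IsRestriction f F) ∧
      -- the function in `H²(S_a)` is the one given by the formula with `g = f̂`, and no other `g`
      -- can occur
      (∀ F : ℝ × E m → Cl m, IsRestriction f F →
        ((MemHardy (Ioo (-a) a) F ↔
            WeightedL2 a (fourierL2 f) ∧ Represents a (fourierL2 f) F) ∧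
          ∀ g : E m → Cl m, WeightedL2 a g → Represents a g F →
            MemHardy (Ioo (-a) a) F ∧ g =ᵐ[volume] fourierL2 f))) ∧
    -- `H²(S_a)` is the direct sum of the Hardy spaces on `x_0 > -a` and `x_0 < a`: existence of
    -- the decomposition, its uniqueness, and the inclusion of all sums
    (∀ F : ℝ × E m → Cl m, MemHardy (Ioo (-a) a) F →
      ∃ P N : ℝ × E m → Cl m, MemHardy (Ioi (-a)) P ∧ MemHardy (Iio a) N ∧
        EqOn F (P + N) (slab m (Ioo (-a) a))) ∧
    (∀ P N P' N' : ℝ × E m → Cl m, MemHardy (Ioi (-a)) P → MemHardy (Iio a) N →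
      MemHardy (Ioi (-a)) P' → MemHardy (Iio a) N' →
      EqOn (P + N) (P' + N') (slab m (Ioo (-a) a)) →
        EqOn P P' (slab m (Ioi (-a))) ∧ EqOn N N' (slab m (Iio a))) ∧
    (∀ P N : ℝ × E m → Cl m, MemHardy (Ioi (-a)) P → MemHardy (Iio a) N →
      MemHardy (Ioo (-a) a) (P + N)) ∧
    -- the induced inner product: `F ↦ F_a` is onto `L²`, and `⟨F, G⟩` is well defined, conjugate
    -- symmetric, right linear in `F`, and positive definite
    (∀ u : L2 m, ∃ F : ℝ × E m → Cl m, MemHardy (Ioo (-a) a) F ∧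
      assoc a F =ᵐ[volume] (u : E m → Cl m)) ∧
    (∀ F G : ℝ × E m → Cl m, MemHardy (Ioo (-a) a) F → MemHardy (Ioo (-a) a) G →
      Integrable (fun ξ => star (assoc a G ξ) * assoc a F ξ) ∧
      star (hardyInner a F G) = hardyInner a G F ∧
      (∀ F' : ℝ × E m → Cl m, MemHardy (Ioo (-a) a) F' →
        hardyInner a (F + F') G = hardyInner a F G + hardyInner a F' G) ∧
      ∀ c : Cl m, hardyInner a (fun x => F x * c) G = hardyInner a F G * c) ∧
    (∀ F : ℝ × E m → Cl m, MemHardy (Ioo (-a) a) F →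
      Integrable (fun ξ => ‖assoc a F ξ‖ ^ 2) ∧
      coeff (hardyInner a F F) ∅ = ((twoPiInv m * ∫ ξ, ‖assoc a F ξ‖ ^ 2 : ℝ) : ℂ) ∧
      (coeff (hardyInner a F F) ∅ = 0 → ∀ x ∈ slab m (Ioo (-a) a), F x = 0)) ∧
    -- the Szegő kernel: it belongs to the space and reproduces it
    (∀ x ∈ slab m (Ioo (-a) a),
      MemHardy (Ioo (-a) a) (fun w => szego a w x) ∧
      ∀ F : ℝ × E m → Cl m, MemHardy (Ioo (-a) a) F →
        hardyInner a F (fun w => szego a w x) = F x) ∧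
    -- its closed form through the Cauchy kernel
    (∀ w ∈ slab m (Ioo (-a) a), ∀ x ∈ slab m (Ioo (-a) a),
      Integrable (fun ξ : E m => Real.exp (-2 * a * ‖ξ‖) • eP (w + pconj x) ξ) ∧
      Integrable (fun ξ : E m => Real.exp (-2 * a * ‖ξ‖) • eM (w + pconj x) ξ) ∧
      twoPiInv m • (∫ ξ : E m, Real.exp (-2 * a * ‖ξ‖) • eP (w + pconj x) ξ) =
        cauchyKernel (w + pconj x + (2 * a, 0)) ∧
      twoPiInv m • (∫ ξ : E m, Real.exp (-2 * a * ‖ξ‖) • eM (w + pconj x) ξ) =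
        -cauchyKernel (w + pconj x - (2 * a, 0)) ∧
      szego a w x =
        cauchyKernel (w + pconj x + (2 * a, 0)) - cauchyKernel (w + pconj x - (2 * a, 0))) := by
  refine ⟨fun f => ⟨⟨?_, ?_⟩, ?_⟩, ?_, ?_, ?_, exists_assoc_ae_eq ha, ?_, ?_, ?_, ?_⟩
  · rintro ⟨F, hF, hf⟩
    have hs := hf.sliceL2_eq
    have h1 := hF.weightedL2 hm ha
    have h2 := hF.represents hm ha
    rw [hs] at h1 h2
    exact ⟨fourierL2 f, F, h1, h2, hf⟩
  · rintro ⟨g, F, hg, hF, hf⟩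
    exact ⟨F, hF.memHardy hg, hf⟩
  · intro F hf
    have hs := hf.sliceL2_eq
    refine ⟨⟨fun hF => ?_, fun h => h.2.memHardy h.1⟩, fun g hg hF => ⟨hF.memHardy hg, ?_⟩⟩
    · rw [← hs]
      exact ⟨hF.weightedL2 hm ha, hF.represents hm ha⟩
    · rw [← hs]
      exact hF.ae_eq_fourierL2 ha hg
  · intro F hF
    have hg := hF.weightedL2 hm ha
    exact ⟨_, _, memHardy_plusPart hg, memHardy_minusPart hg,
      (hF.represents hm ha).eqOn (represents_plusPart_add_minusPart hg)⟩
  · intro P N P' N' hP hN hP' hN' h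
    -- Two decompositions give `P - P' = N' - N` on the strip, a function that is Hardy on both
    -- half-spaces.
    have h1 := eqOn_zero_of_halfspaces hm ha (hP.sub hP' isOpen_Ioi) (hN'.sub hN isOpen_Iio)
      (fun x hx => by
        have := h hx
        simp only [Pi.add_apply, Pi.sub_apply] at this ⊢
        rw [sub_eq_sub_iff_add_eq_add, this, add_comm])
    exact ⟨fun x hx => sub_eq_zero.1 (h1.1 hx), fun x hx => (sub_eq_zero.1 (h1.2 hx)).symm⟩
  · exact fun P N hP hN => (hP.mono Ioo_subset_Ioi).add (hN.mono Ioo_subset_Iio) isOpen_Ioo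
  · exact fun F G hF hG => ⟨integrable_star_mul (memLp_assoc hm ha hG) (memLp_assoc hm ha hF),
      star_hardyInner hm ha hF hG, fun F' hF' => hardyInner_add hm ha hF hG hF',
      hardyInner_mul_const hm ha hF hG⟩
  · exact fun F hF => ⟨integrable_norm_sq_assoc hm ha hF, coeff_hardyInner_self hm ha hF,
      fun h x hx => eq_zero_of_coeff_hardyInner_self hm ha hF h hx⟩
  · exact fun x hx => ⟨(represents_szego hx.1).memHardy (weightedL2_szegoDensity hx.1),
      fun F hF => hardyInner_szego hm ha hF hx⟩
  · exact fun w hw x hx => szego_closed_form hm hw.1 hx.1
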